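/- **Conventions.** Let $G$ be a finite graph (multiple edges and self-loops allowed) with edges $e_1,\dots,e_N$ and loop number $h_G=N-|V_G|+1$. Its graph polynomial is $\Psi_G=\sum_T\prod_{e\notin T}\alpha_e\in\mathbb Z[\alpha_1,\dots,\alpha_N]$, the sum over the spanning trees $T$ of $G$. For a prime power $q$ let $[\Psi_G]_q$ be the number of zeros of $\Psi_G$ in $\mathbb F_q^N$, and $c_2(G)_q:=[\Psi_G]_q/q^2 \bmod q$. Let $M_G=\begin{pmatrix}\mathrm{diag}(\alpha_1,\dots,\alpha_N)&\mathcal E\\-\mathcal E^T&0\end{pmatrix}$, where $\mathcal E$ is the incidence matrix of (an orientation of) $G$ with one column deleted; for sets of edges $I,J,K$ with $|I|=|J|$ the Dodgson polynomial $\Psi^{I,J}_K$ is the determinant of $M_G$ with rows $I$ and columns $J$ removed and $\alpha_t=0$ for $t\in K$. **Semilinear reducibility.** For a finite set $s$ of variables, and $D$ a homogeneous polynomial or an unordered pair of homogeneous polynomials in $\mathbb Z[s]$, put $\delta(D)=\deg_{tot}(D)-|s|$ ($\deg_{tot}$ is the degree, resp. the sum of the two degrees, and $\deg 0=0$). A *semilinear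 reduction* of $D$ over $s$ is a finite tree with root $D$ built by the following rules; it has a value in $\mathbb Z$. Write $f=f^1x+f_0$ when $f$ is of degree at most $1$ in $x\in s$, with $f^1,f_0$ free of $x$. 1. $D=mx$ with $s=\{x\}$ and $0\ne m\in\mathbb Z$ is a leaf, of value $1$. 2. $D$ with $\delta(D)<0$ is a leaf, of value $0$. 3. A pair $(f,mx)$ with $x\in s$, $0\neq m\in\mathbb Z$ reduces to $m\cdot f|_{x=0}$ over $s\setminus\{x\}$, with the same value. 4. $f=f^1x+f_0$ with $\delta(f)\ge0$ reduces to $f^1$ over $s\setminus\{x\}$; the value is minus that of $f^1$. 5. $h=f^2g$ with $\delta(h)\ge0$, $\deg f\ge1$, and $f,g\in\mathbb Z[s]$ homogeneous, reduces to $fg$ over $s$, with the same value. 6. A pair $(f,g)$ with $\delta(f,g)\ge0$ and $|s|>1$, both of degree at most $1$ in $x$, reduces to $(f^1,g^1)$ and $f^1g_0-f_0g^1$ over $s\setminus\{x\}$; the value is that of $f^1g_0-f_0g^1$ minus that of $(f^1,g^1)$. 7. $h=fg$, with $f,g\in\mathbb Z[s]$ homogeneous, reduces to $f$, $g$ and $(f,g)$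 over $s$; the value is that of $f$ plus that of $g$ minus that of $(f,g)$. The *primes of bad reduction* of the tree are the prime divisors of the integers $m$ that occur in rules 1 and 3. $D$ is *semilinearly reducible* over $s$ if it has a semilinear reduction. A *semilinear reduction of $G$* consists of one of the following. * A 3-valent vertex with three different incident edges $e_1,e_2,e_3$ and a semilinear reduction of the pair $(\Psi^{1,2}_3,\Psi^{13,23})$ over the other $N-3$ variables. Its *result* is minus the value of the tree. * A 4-valent vertex with four different incident edges $e_1,\dots,e_4$ and semilinear reductions, over the other $N-4$ variables, of the pair $(\Psi^{13,24},\Psi^{14,23})$ and of the four pairs $(\Psi^{it,jt}_k,\Psi^{ikt,jkt})$, for $(i,j,k,t)$ the cyclic permutations of $(1,2,3,4)$ (these are the pairs $(\Psi^{i,j}_k,\Psi^{ik,jk})$ of the graph $G\setminus e_t$). Its *result* is the sum of the five values. $G$ is *semilinearly reducible* if it has a semilinear reduction. **Proposition.** Let $G$ be a graph with $|V_G|\ge4$ and with at least one vertex of valency $\le4$, and assume that $G$ is semilinearly reducible. Then $c_2$ can be computed in finitely many steps of semilinear reduction: there is an integer $c$ with $$|c|<\tfrac12\,4^{h_G}$$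 such that $G$ has a semilinear reduction, and every semilinear reduction of $G$ has the result $c$ and satisfies: for every power $q$ of a prime that is not one of its (finitely many) primes of bad reduction, $q^2$ divides $[\Psi_G]_q$ and $$c_2(G)_q\equiv -c \pmod q .$$ -/

import Mathlib

open MvPolynomial

/-! ### Graphs, the graph polynomial and Dodgson polynomials -/

/-- A finite graph (multiple edges and self-loops allowed) with vertices `0, …, n` and edges
`0, …, N - 1`, together with an auxiliary orientation of its edges. -/
structure FeynmanGraph (n N : ℕ) where
  /-- the tail of an edge -/
  src : Fin N → Fin (n + 1)
  /-- the head of an edge -/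
  tgt : Fin N → Fin (n + 1)

namespace FeynmanGraph

variable {n N : ℕ} (G : FeynmanGraph n N)

/-- The valency of a vertex; a self-loop counts twice. -/
def valency (v : Fin (n + 1)) : ℕ :=
  ∑ e : Fin N, ((if G.src e = v then 1 else 0) + (if G.tgt e = v then 1 else 0))

/-- The edge `e` is incident to the vertex `v`. -/
def Incident (e : Fin N) (v : Fin (n + 1)) : Prop :=
  G.src e = v ∨ G.tgt e = v

/-- The loop number `h_G = N_G - |V_G| + 1`, an integer. -/
def loopNumber (_G : FeynmanGraph n N) : ℤ :=
  (N : ℤ) - ((n : ℤ) + 1) + 1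

/-- Two vertices are joined by a path all of whose edges lie in `T`. -/
def JoinedIn (T : Finset (Fin N)) : Fin (n + 1) → Fin (n + 1) → Prop :=
  Relation.EqvGen (fun a b => ∃ e ∈ T, G.src e = a ∧ G.tgt e = b)

/-- `T` is (the edge set of) a spanning tree: it connects all `n + 1` vertices and has
`n` edges. -/
def IsSpanningTree (T : Finset (Fin N)) : Prop :=
  T.card = n ∧ ∀ u v : Fin (n + 1), G.JoinedIn T u v

open Classical in
/-- The graph polynomial `Ψ_G = ∑_T ∏_{e ∉ T} α_e`, over all spanning trees `T`. -/
noncomputable def graphPolynomial : MvPolynomial (Fin N) ℤ :=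
  ∑ T ∈ Finset.univ.filter (fun T : Finset (Fin N) => G.IsSpanningTree T), ∏ e ∈ Tᶜ, X e

/-- The incidence matrix with the column of the last vertex deleted. -/
noncomputable def incidence : Matrix (Fin N) (Fin n) (MvPolynomial (Fin N) ℤ) :=
  Matrix.of fun e v =>
    (if G.src e = v.castSucc then 1 else 0) - (if G.tgt e = v.castSucc then 1 else 0)

/-- The matrix `M_G = [[Δ(α), 𝓔], [-𝓔ᵀ, 0]]` in which `α_t` is set to `0` for all `t ∈ K`. -/
noncomputable def graphMatrix (K : Finset (Fin N)) :
    Matrix (Fin N ⊕ Fin n) (Fin N ⊕ Fin n) (MvPolynomial (Fin N) ℤ) :=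
  Matrix.fromBlocks (Matrix.diagonal fun e => if e ∈ K then 0 else X e) G.incidence
    (-G.incidence.transpose) 0

/-- The Dodgson polynomial `Ψ^{I,J}_{G,K}`, used for `|I| = |J|`: the determinant of the matrix
obtained from `M_G` by removing the rows `I` and the columns `J` (keeping the order of the others)
and setting `α_t = 0` for `t ∈ K`. -/
noncomputable def dodgson (I J K : Finset (Fin N)) : MvPolynomial (Fin N) ℤ :=
  if h : Jᶜ.card = Iᶜ.card then
    ((G.graphMatrix K).submatrix
      (Sum.map (Iᶜ.orderEmbOfFin rfl) id : Fin Iᶜ.card ⊕ Fin n → Fin N ⊕ Fin n)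
      (Sum.map (Jᶜ.orderEmbOfFin h) id : Fin Iᶜ.card ⊕ Fin n → Fin N ⊕ Fin n)).det
  else 0

/-! ### The `c₂` invariant -/

/-- `[Ψ_G]_q`: the number of points of `Ψ_G = 0` in the affine space `F ^ N`, where `q = |F|`. -/
noncomputable def pointCount (F : Type) [Field F] : ℕ :=
  Nat.card {a : Fin N → F // aeval a G.graphPolynomial = 0}

/-- `c₂(G)_q = [Ψ_G]_q / q² mod q`, where `q = |F|`. -/
noncomputable def c2 (F : Type) [Field F] : ZMod (Nat.card F) :=
  ((G.pointCount F / Nat.card F ^ 2 : ℕ) : ZMod (Nat.card F))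

end FeynmanGraph

/-! ### Semilinear reducibility -/

/-- A polynomial, or a pair of polynomials, with integer coefficients. -/
inductive PolyEntry (σ : Type) where
  | single (f : MvPolynomial σ ℤ) : PolyEntry σ
  | pair (f g : MvPolynomial σ ℤ) : PolyEntry σ

namespace PolyEntry

variable {σ : Type}

/-- All entries are homogeneous. -/
def IsHomogeneous : PolyEntry σ → Prop
  | single f => ∃ d, MvPolynomial.IsHomogeneous f d
  | pair f g => (∃ d, MvPolynomial.IsHomogeneous f d) ∧ (∃ d, MvPolynomial.IsHomogeneous g d)

/-- All entries are polynomials in the variables `s`. -/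
def InVars (s : Finset σ) : PolyEntry σ → Prop
  | single f => (f.vars : Set σ) ⊆ s
  | pair f g => (f.vars : Set σ) ⊆ s ∧ (g.vars : Set σ) ⊆ s

/-- The total degree of a polynomial or of a pair. -/
noncomputable def degTot : PolyEntry σ → ℕ
  | single f => f.totalDegree
  | pair f g => f.totalDegree + g.totalDegree

/-- `δ(D) = deg_tot(D) - N(D)`, for an entry `D` in the variables `s`, with `N(D) = |s|`. -/
noncomputable def delta (s : Finset σ) (D : PolyEntry σ) : ℤ :=
  (D.degTot : ℤ) - (s.card : ℤ)

end PolyEntry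

/-- `f` with the variable `x` set to `0`. -/
noncomputable def setZero {σ : Type} [DecidableEq σ] (x : σ) (f : MvPolynomial σ ℤ) :
    MvPolynomial σ ℤ :=
  aeval (fun i => if i = x then (0 : MvPolynomial σ ℤ) else X i) f

/-- `f = f¹ x + f₀` is linear in `x`, with `f¹`, `f₀` independent of `x`. -/
def LinearIn {σ : Type} (x : σ) (f f1 f0 : MvPolynomial σ ℤ) : Prop :=
  f = f1 * X x + f0 ∧ x ∉ f1.vars ∧ x ∉ f0.vars

/-- The finite trees of semilinear reduction steps: an element of `SemilinearTree s D` is a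
reduction of `D`, a polynomial or pair of polynomials in the variables `s`, down to elementary
ones. -/
inductive SemilinearTree {σ : Type} [DecidableEq σ] : Finset σ → PolyEntry σ → Type
  /-- leaf: a linear form `m x` in one variable -/
  | linear (x : σ) (m : ℤ) (hm : m ≠ 0) (f : MvPolynomial σ ℤ) (hf : f = C m * X x) :
      SemilinearTree {x} (.single f)
  /-- leaf: a polynomial or a pair with `δ < 0` -/
  | negative (s : Finset σ) (D : PolyEntry σ) (hD : D.delta s < 0) :
      SemilinearTree s D
  /-- the pairs are unordered -/
  | swap (s : Finset σ) (f g : MvPolynomial σ ℤ) (T : SemilinearTree s (.pair f g)) :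
      SemilinearTree s (.pair g f)
  /-- `(f, m x)` reduces to `m f₀`, where `f₀` is `f` at `x = 0` -/
  | restrict (s : Finset σ) (x : σ) (hx : x ∈ s) (m : ℤ) (hm : m ≠ 0)
      (f g : MvPolynomial σ ℤ) (hg : g = C m * X x)
      (T : SemilinearTree (s.erase x) (.single (C m * setZero x f))) :
      SemilinearTree s (.pair f g)
  /-- `f = f¹ x + f₀` with `δ ≥ 0` reduces to `f¹` -/
  | single (s : Finset σ) (x : σ) (hx : x ∈ s) (f f1 f0 : MvPolynomial σ ℤ)
      (hf : LinearIn x f f1 f0) (hd : 0 ≤ (PolyEntry.single f).delta s)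
      (T : SemilinearTree (s.erase x) (.single f1)) :
      SemilinearTree s (.single f)
  /-- `h = f² g` with `δ ≥ 0` and `deg f ≥ 1` reduces to `f g` -/
  | square (s : Finset σ) (h f g : MvPolynomial σ ℤ) (hh : h = f ^ 2 * g)
      (hfg : (PolyEntry.pair f g).IsHomogeneous) (hs : (PolyEntry.pair f g).InVars s)
      (hf : 1 ≤ f.totalDegree) (hd : 0 ≤ (PolyEntry.single h).delta s)
      (T : SemilinearTree s (.single (f * g))) :
      SemilinearTree s (.single h)
  /-- `(f¹ x + f₀, g¹ x + g₀)` with `δ ≥ 0`, in more than one variable, reduces to the pair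
  `(f¹, g¹)` and the resultant `f¹ g₀ - f₀ g¹` -/
  | pair (s : Finset σ) (x : σ) (hx : x ∈ s) (hs : 1 < s.card)
      (f f1 f0 g g1 g0 : MvPolynomial σ ℤ) (hf : LinearIn x f f1 f0) (hg : LinearIn x g g1 g0)
      (hd : 0 ≤ (PolyEntry.pair f g).delta s)
      (T₁ : SemilinearTree (s.erase x) (.pair f1 g1))
      (T₂ : SemilinearTree (s.erase x) (.single (f1 * g0 - f0 * g1))) :
      SemilinearTree s (.pair f g)
  /-- `h = f g` reduces to `f`, to `g` and to the pair `(f, g)` -/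
  | factor (s : Finset σ) (h f g : MvPolynomial σ ℤ) (hh : h = f * g)
      (hfg : (PolyEntry.pair f g).IsHomogeneous) (hs : (PolyEntry.pair f g).InVars s)
      (T₁ : SemilinearTree s (.single f)) (T₂ : SemilinearTree s (.single g))
      (T₃ : SemilinearTree s (.pair f g)) :
      SemilinearTree s (.single h)

namespace SemilinearTree

variable {σ : Type} [DecidableEq σ]

/-- The integer computed by a reduction: every step replaces the point count (mod `q`) of a node
by the corresponding combination of the point counts of its children,
`[f, m x] ≡ [m f₀]`, `[f] ≡ -[f¹]`, `[f² g] = [f g]`,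
`[f, g] ≡ [f¹ g₀ - f₀ g¹] - [f¹, g¹]`, `[f g] = [f] + [g] - [f, g]`; a leaf `m x` counts `1`, a
leaf with `δ < 0` counts `0`. -/
noncomputable def value : {s : Finset σ} → {D : PolyEntry σ} → SemilinearTree s D → ℤ
  | _, _, linear _ _ _ _ _ => 1
  | _, _, negative _ _ _ => 0
  | _, _, swap _ _ _ T => T.value
  | _, _, restrict _ _ _ _ _ _ _ _ T => T.value
  | _, _, single _ _ _ _ _ _ _ _ T => -T.value
  | _, _, square _ _ _ _ _ _ _ _ _ T => T.value
  | _, _, pair _ _ _ _ _ _ _ _ _ _ _ _ _ T₁ T₂ => T₂.value - T₁.value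
  | _, _, factor _ _ _ _ _ _ _ T₁ T₂ T₃ => T₁.value + T₂.value - T₃.value

/-- The primes of bad reduction: the prime divisors of the coefficients `m` of the linear forms
`m x` that are used in the reduction. -/
noncomputable def badPrimes : {s : Finset σ} → {D : PolyEntry σ} → SemilinearTree s D → Finset ℕ
  | _, _, linear _ m _ _ _ => m.natAbs.primeFactors
  | _, _, negative _ _ _ => ∅
  | _, _, swap _ _ _ T => T.badPrimes
  | _, _, restrict _ _ _ m _ _ _ _ T => m.natAbs.primeFactors ∪ T.badPrimes
  | _, _, single _ _ _ _ _ _ _ _ T => T.badPrimes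
  | _, _, square _ _ _ _ _ _ _ _ _ T => T.badPrimes
  | _, _, pair _ _ _ _ _ _ _ _ _ _ _ _ _ T₁ T₂ => T₁.badPrimes ∪ T₂.badPrimes
  | _, _, factor _ _ _ _ _ _ _ T₁ T₂ T₃ => T₁.badPrimes ∪ T₂.badPrimes ∪ T₃.badPrimes

end SemilinearTree

/-- The set `SLR` of semilinearly reducible homogeneous polynomials, and pairs of homogeneous
polynomials, in the variables `s`. (All nodes of a reduction of a homogeneous entry in the
variables `s` are homogeneous again, in the remaining variables.) -/
def SLR {σ : Type} [DecidableEq σ] (s : Finset σ) (D : PolyEntry σ) : Prop :=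
  D.IsHomogeneous ∧ D.InVars s ∧ Nonempty (SemilinearTree s D)

namespace FeynmanGraph

variable {n N : ℕ} (G : FeynmanGraph n N)

/-- The variables different from those of the edges `e 0, …, e (k - 1)`. -/
def otherEdges {k : ℕ} (e : Fin k ↪ Fin N) : Finset (Fin N) :=
  (Finset.univ.map e)ᶜ

/-- `v` is a `k`-valent vertex incident to the `k` different edges `e 0, …, e (k - 1)`. -/
def IsVertexWithEdges {k : ℕ} (v : Fin (n + 1)) (e : Fin k ↪ Fin N) : Prop :=
  G.valency v = k ∧ ∀ i, G.Incident (e i) v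

/-- The pair `(Ψ^{1,2}_3, Ψ^{13,23})` at a 3-valent vertex with edges `e₁, e₂, e₃`. -/
noncomputable def pair3 (e : Fin 3 ↪ Fin N) : PolyEntry (Fin N) :=
  .pair (G.dodgson {e 0} {e 1} {e 2}) (G.dodgson {e 0, e 2} {e 1, e 2} ∅)

/-- The pair `(Ψ^{13,24}, Ψ^{14,23})` at a 4-valent vertex with edges `e₁, e₂, e₃, e₄`. -/
noncomputable def pair4 (e : Fin 4 ↪ Fin N) : PolyEntry (Fin N) :=
  .pair (G.dodgson {e 0, e 2} {e 1, e 3} ∅) (G.dodgson {e 0, e 3} {e 1, e 2} ∅)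

/-- At a 4-valent vertex with edges `e₁, …, e₄`, for a cyclic permutation `(i, j, k, t)` of
`(1, 2, 3, 4)`: the pair `(Ψ^{i,j}_k, Ψ^{ik,jk})` of the graph `G \ e_t`, at its 3-valent vertex
with edges `e_i, e_j, e_k`. As Dodgson polynomials of `G` these are `Ψ^{it,jt}_k` and
`Ψ^{ikt,jkt}`. -/
noncomputable def pair4Del (e : Fin 4 ↪ Fin N) (i : Fin 4) : PolyEntry (Fin N) :=
  .pair (G.dodgson {e i, e (i + 3)} {e (i + 1), e (i + 3)} {e (i + 2)})
    (G.dodgson {e i, e (i + 2), e (i + 3)} {e (i + 1), e (i + 2), e (i + 3)} ∅)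

/-- `G` is semilinearly reducible. -/
def SemilinearlyReducible : Prop :=
  (∃ (v : Fin (n + 1)) (e : Fin 3 ↪ Fin N), G.IsVertexWithEdges v e ∧
    SLR (otherEdges e) (G.pair3 e)) ∨
  (∃ (v : Fin (n + 1)) (e : Fin 4 ↪ Fin N), G.IsVertexWithEdges v e ∧
    SLR (otherEdges e) (G.pair4 e) ∧ ∀ i, SLR (otherEdges e) (G.pair4Del e i))

/-- A finite semilinear reduction of `G`: a 3-valent vertex and a reduction tree of its pair, or a
4-valent vertex and reduction trees of its five pairs. -/
inductive Reduction (G : FeynmanGraph n N) : Type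
  | three (v : Fin (n + 1)) (e : Fin 3 ↪ Fin N) (hv : G.IsVertexWithEdges v e)
      (T : SemilinearTree (otherEdges e) (G.pair3 e)) : Reduction G
  | four (v : Fin (n + 1)) (e : Fin 4 ↪ Fin N) (hv : G.IsVertexWithEdges v e)
      (T : SemilinearTree (otherEdges e) (G.pair4 e))
      (T' : ∀ i, SemilinearTree (otherEdges e) (G.pair4Del e i)) : Reduction G

/-- The integer `c` computed by a reduction, for which `c₂(G)_q ≡ -c`: it is minus the value of the
pair at a 3-valent vertex, and the sum of the five values at a 4-valent vertex. -/
noncomputable def Reduction.value {G : FeynmanGraph n N} : Reduction G → ℤ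
  | .three _ _ _ T => -T.value
  | .four _ _ _ T T' => T.value + ∑ i, (T' i).value

/-- The primes of bad reduction. -/
noncomputable def Reduction.badPrimes {G : FeynmanGraph n N} : Reduction G → Finset ℕ
  | .three _ _ _ T => T.badPrimes
  | .four _ _ _ T T' => T.badPrimes ∪ Finset.univ.biUnion fun i => (T' i).badPrimes

end FeynmanGraph

/-!
# The `c₂` invariant of a semilinearly reducible graph

Write `q` for the order of the finite field `F`. Three facts about numbers of zeros over `F` are
combined.

*Reduction trees compute point counts modulo `q`.* Fibring over the variable that a rule
eliminates, each rule replaces the number of zeros of a polynomial or a pair as the definition of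
the value prescribes (`SemilinearTree.card_dvd_pointsOver_sub_value`). The leaves with `δ < 0` need
Ax's theorem: a polynomial of degree less than the number of variables has a number of zeros
divisible by `q`, and not only by the characteristic (`card_dvd_count_zeros`). Here it is proved by
counting zeros with Teichmüller representatives in the Witt vectors of `F`, where the remaining
terms carry multinomial coefficients that are divisible by `q` (`pow_dvd_multinomial`).

*The values are small.* Modulo `p`, the number of zeros of `f` over the field with `p ^ k` elements
is up to sign the trace of the `k`-th power of a Hasse-Witt matrix, whose rows are indexed by
fewer than `2 ^ deg f` exponent vectors. For a suitable `k` the power is idempotent and its trace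
is its rank. Applied to `f`, `g` and `f g` at a large prime `p`, this bounds the value of every
tree for a pair `(f, g)` by `2 ^ (deg f + deg g)` (`SemilinearTree.abs_value_lt`). The Dodgson
polynomials have degree at most `h_G - |I|` (`FeynmanGraph.totalDegree_dodgson_le`), which gives the
bound by `4 ^ h_G / 2`.

*The point count of the graph modulo `q³`.* By the matrix-tree theorem `Ψ_G` is the determinant of
the graph matrix. At a vertex with three or four edges this determinant is obtained from a symmetric
matrix `C(a)`, which depends on the variables `a` of the other edges only, by adding a border for
the edges at the vertex. The number of zeros in the variables of these edges is found separately
when `C(a)` is invertible, has corank one, and has corank at least two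
(`card_cube_dvd_starCount_three`, `card_cube_dvd_starCount_four`); in each case the determinant
becomes an explicit polynomial in these variables. Modulo `q³` the result is a combination of
indicators of the vanishing of `det C(a)` and of the bilinear forms of its adjugate that the
Dodgson polynomials `Ψ^{I,J}_K` define. Summed over `a`, all contributions but those of the pairs in
a reduction of `G` are multiples of `q³`: some by Ax's theorem, and those in which a form has equal
arguments by counting the solutions of linear systems `C(a) v = s`, which can be solved for `a`
first (`card_dvd_count_both_eq_zero`, `card_sq_dvd_count_det_ne_zero`). So the pairs determine `c₂`
(`FeynmanGraph.card_cube_dvd_pointCount_three`, `FeynmanGraph.card_cube_dvd_pointCount_four`).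

Two reductions have equal values since both are determined by `c₂` modulo a large prime of good
reduction.
-/

/-! ### Digit sums and divisibility of multinomial coefficients -/

/-- The number with base `p` digits `L`, with the digits moved cyclically: the digit at position
`l` contributes with weight `p ^ ((l + j) % k)`. -/
def cyclicDigits (p k : ℕ) : ℕ → List ℕ → ℕ
  | _, [] => 0
  | j, d :: L => d * p ^ (j % k) + cyclicDigits p k (j + 1) L

lemma pow_mod_modEq (p k j : ℕ) (hp : 0 < p) : p ^ (j % k) ≡ p ^ j [MOD p ^ k - 1] := by
  have h1 : p ^ k ≡ 1 [MOD p ^ k - 1] := by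
    have : 1 ≤ p ^ k := Nat.one_le_pow _ _ hp
    exact ((Nat.modEq_iff_dvd' this).2 dvd_rfl).symm
  calc p ^ (j % k) = p ^ (j % k) * 1 ^ (j / k) := by simp
    _ ≡ p ^ (j % k) * (p ^ k) ^ (j / k) [MOD p ^ k - 1] :=
        (Nat.ModEq.refl _).mul ((h1.symm).pow _)
    _ = p ^ j := by rw [← pow_mul, ← pow_add, Nat.mod_add_div]

lemma cyclicDigits_modEq (p k : ℕ) (hp : 0 < p) (L : List ℕ) (j : ℕ) :
    cyclicDigits p k j L ≡ p ^ j * Nat.ofDigits p L [MOD p ^ k - 1] := by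
  induction L generalizing j with
  | nil => simp [cyclicDigits, Nat.ofDigits]; rfl
  | cons d L ih =>
    simp only [cyclicDigits, Nat.ofDigits_cons]
    have h := ((Nat.ModEq.refl d).mul (pow_mod_modEq p k j hp)).add (ih (j + 1))
    refine h.trans ?_
    have : d * p ^ j + p ^ (j + 1) * Nat.ofDigits p L = p ^ j * (d + p * Nat.ofDigits p L) := by
      ring
    rw [this]

lemma ofDigits_eq_zero_of_cyclicDigits (p k : ℕ) (hp : 0 < p) (L : List ℕ) (j : ℕ)
    (h : cyclicDigits p k j L = 0) : Nat.ofDigits p L = 0 := by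
  induction L generalizing j with
  | nil => simp [Nat.ofDigits]
  | cons d L ih =>
    simp only [cyclicDigits, Nat.add_eq_zero_iff, mul_eq_zero, pow_eq_zero_iff', hp.ne', ne_eq,
      false_and, or_false] at h
    simp [Nat.ofDigits_cons, h.1, ih _ h.2]

lemma sum_pow_add_mod (p k c : ℕ) :
    ∑ j ∈ Finset.range k, p ^ ((j + c) % k) = ∑ j ∈ Finset.range k, p ^ j := by
  rcases Nat.eq_zero_or_pos k with rfl | hk
  · simp
  have : NeZero k := ⟨hk.ne'⟩
  rw [Finset.sum_range, Finset.sum_range]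
  refine Fintype.sum_equiv (Equiv.addRight (Fin.ofNat k c)) _ _ fun j => ?_
  simp [Fin.val_add]

lemma sum_cyclicDigits (p k c : ℕ) (L : List ℕ) :
    ∑ j ∈ Finset.range k, cyclicDigits p k (j + c) L = L.sum * ∑ j ∈ Finset.range k, p ^ j := by
  induction L generalizing c with
  | nil => simp [cyclicDigits]
  | cons d L ih =>
    simp only [cyclicDigits, Finset.sum_add_distrib, List.sum_cons, add_mul]
    rw [← Finset.mul_sum, sum_pow_add_mod]
    congr 1
    rw [← ih (c + 1)]
    simp only [add_assoc]

/-- The digits of `(p ^ k - 1) * p ^ M` are `k` digits `p - 1`, followed by zeros. -/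
lemma digits_sum_pow_sub_one_mul_pow {p : ℕ} (hp : 1 < p) (k M : ℕ) :
    (Nat.digits p ((p ^ k - 1) * p ^ M)).sum ≤ k * (p - 1) := by
  rcases Nat.eq_zero_or_pos k with rfl | hk
  · simp
  have h1 : Nat.ofDigits p (List.replicate k (p - 1)) = p ^ k - 1 := by
    have : ∀ k, Nat.ofDigits p (List.replicate k (p - 1)) + 1 = p ^ k := by
      intro k
      induction k with
      | zero => simp
      | succ k ih =>
        rw [List.replicate_succ, Nat.ofDigits_cons, pow_succ, ← ih]
        obtain ⟨m, rfl⟩ : ∃ m, p = m + 1 := ⟨p - 1, by omega⟩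
        simp only [Nat.add_sub_cancel_right]
        ring
    have := this k
    omega
  have h2 : Nat.ofDigits p (List.replicate M 0 ++ List.replicate k (p - 1))
      = (p ^ k - 1) * p ^ M := by
    rw [Nat.ofDigits_append, h1]
    simp [mul_comm]
  rw [← h2, Nat.digits_ofDigits p hp]
  · simp
  · intro l hl
    simp only [List.mem_append, List.mem_replicate] at hl
    omega
  · intro h
    rw [List.getLast_append_of_ne_nil _ (by simp; omega)]
    simp
    omega

/-- Legendre's formula for multinomial coefficients. -/
lemma padicValNat_multinomial {ι : Type*} (p : ℕ) [hp : Fact p.Prime] (J : Finset ι)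
    (r : ι → ℕ) :
    (p - 1) * padicValNat p (Nat.multinomial J r) + (Nat.digits p (∑ j ∈ J, r j)).sum
      = ∑ j ∈ J, (Nat.digits p (r j)).sum := by
  have h := congrArg (padicValNat p) (Nat.multinomial_spec J r)
  have hne : (∏ j ∈ J, (r j).factorial) ≠ 0 :=
    Finset.prod_ne_zero_iff.2 fun j _ => Nat.factorial_ne_zero _
  rw [padicValNat.mul hne (Nat.multinomial_pos _ _).ne'] at h
  have hprod : padicValNat p (∏ j ∈ J, (r j).factorial)
      = ∑ j ∈ J, padicValNat p (r j).factorial := by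
    classical
    clear h hne
    induction J using Finset.induction_on with
    | empty => simp
    | insert a s ha ih =>
      rw [Finset.prod_insert ha, Finset.sum_insert ha, padicValNat.mul (Nat.factorial_ne_zero _)
        (Finset.prod_ne_zero_iff.2 fun j _ => Nat.factorial_ne_zero _), ih]
  rw [hprod] at h
  have h' := congrArg ((p - 1) * ·) h
  simp only [mul_add, Finset.mul_sum] at h'
  rw [sub_one_mul_padicValNat_factorial] at h'
  have h3 : ∑ j ∈ J, (p - 1) * padicValNat p (r j).factorial
      + ∑ j ∈ J, (Nat.digits p (r j)).sum = ∑ j ∈ J, r j := by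
    rw [← Finset.sum_add_distrib]
    refine Finset.sum_congr rfl fun j _ => ?_
    rw [sub_one_mul_padicValNat_factorial]
    exact Nat.sub_add_cancel (Nat.digit_sum_le _ _)
  have h4 := Nat.digit_sum_le p (∑ j ∈ J, r j)
  omega

/-- The divisibility behind Ax's theorem: if `r` distributes `(q - 1) p ^ M` over monomials of
degree less than the number of variables, so that every variable gets a positive multiple of
`q - 1` as its exponent, then `q` divides the multinomial coefficient. Every cyclic shift of the
digits of `r` again has these properties modulo `q - 1`, so it sums to at least `2 (q - 1)`;
adding up the shifts bounds the digit sum of `r`, hence, by Legendre's formula, the valuation. -/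
theorem pow_dvd_multinomial {ι τ : Type*} [Fintype τ] {p : ℕ} [hp : Fact p.Prime] {k : ℕ}
    (hk : 0 < k) (M d : ℕ) (J : Finset ι) (r : ι → ℕ) (e : ι → τ → ℕ)
    (hd : ∀ j ∈ J, ∑ i, e j i ≤ d) (hdn : d < Fintype.card τ)
    (hr : ∑ j ∈ J, r j = (p ^ k - 1) * p ^ M)
    (hdvd : ∀ i, p ^ k - 1 ∣ ∑ j ∈ J, r j * e j i) (hpos : ∀ i, 0 < ∑ j ∈ J, r j * e j i) :
    p ^ k ∣ Nat.multinomial J r := by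
  have hp1 := hp.out.one_lt
  have hq1 : 0 < p ^ k - 1 := by
    have := Nat.one_lt_pow hk.ne' hp1
    omega
  set R : ℕ → ι → ℕ := fun t j => cyclicDigits p k t (Nat.digits p (r j)) with hR
  have hmod : ∀ t j, R t j ≡ p ^ t * r j [MOD p ^ k - 1] := fun t j => by
    have := cyclicDigits_modEq p k hp.out.pos (Nat.digits p (r j)) t
    rwa [Nat.ofDigits_digits] at this
  have hzero : ∀ t j, R t j = 0 → r j = 0 := fun t j h => by
    have := ofDigits_eq_zero_of_cyclicDigits p k hp.out.pos _ _ h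
    rwa [Nat.ofDigits_digits] at this
  have hmodsum : ∀ (s : Finset ι) (f g : ι → ℕ), (∀ j, f j ≡ g j [MOD p ^ k - 1]) →
      ∑ j ∈ s, f j ≡ ∑ j ∈ s, g j [MOD p ^ k - 1] := by
    classical
    intro s f g h
    induction s using Finset.induction_on with
    | empty => rfl
    | insert a s ha ih => rw [Finset.sum_insert ha, Finset.sum_insert ha]; exact (h a).add ih
  have key : ∀ t, 2 * (p ^ k - 1) ≤ ∑ j ∈ J, R t j := by
    intro t
    have h1 : ∀ i, p ^ k - 1 ≤ ∑ j ∈ J, R t j * e j i := by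
      intro i
      refine Nat.le_of_dvd ?_ ?_
      · obtain ⟨j, hj, hne⟩ := Finset.exists_ne_zero_of_sum_ne_zero (hpos i).ne'
        refine Finset.sum_pos' (fun _ _ => Nat.zero_le _) ⟨j, hj, ?_⟩
        rcases Nat.mul_ne_zero_iff.1 hne with ⟨h1, h2⟩
        exact Nat.mul_pos (Nat.pos_of_ne_zero fun h => h1 (hzero t j h)) (Nat.pos_of_ne_zero h2)
      · have h2 := hmodsum J (fun j => R t j * e j i) (fun j => p ^ t * (r j * e j i))
          (fun j => by rw [← mul_assoc]; exact (hmod t j).mul_right _)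
        rw [← Finset.mul_sum] at h2
        exact (h2.dvd_iff dvd_rfl).2 ((hdvd i).mul_left _)
    have h2 : Fintype.card τ * (p ^ k - 1) ≤ d * ∑ j ∈ J, R t j := by
      calc Fintype.card τ * (p ^ k - 1) = ∑ _i : τ, (p ^ k - 1) := by simp
        _ ≤ ∑ i, ∑ j ∈ J, R t j * e j i := Finset.sum_le_sum fun i _ => h1 i
        _ = ∑ j ∈ J, R t j * ∑ i, e j i := by
            rw [Finset.sum_comm]; simp only [Finset.mul_sum]
        _ ≤ ∑ j ∈ J, R t j * d := Finset.sum_le_sum fun j hj => Nat.mul_le_mul_left _ (hd j hj)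
        _ = d * ∑ j ∈ J, R t j := by rw [← Finset.sum_mul, mul_comm]
    have h3 : p ^ k - 1 ∣ ∑ j ∈ J, R t j := by
      have h2 := hmodsum J (R t) (fun j => p ^ t * r j) (hmod t)
      rw [← Finset.mul_sum, hr] at h2
      exact (h2.dvd_iff dvd_rfl).2 ((Dvd.intro _ rfl).mul_left _)
    obtain ⟨c, hc⟩ := h3
    rw [hc] at h2 ⊢
    have : 2 ≤ c := by
      by_contra hlt
      have h5 : d * ((p ^ k - 1) * c) ≤ d * (p ^ k - 1) := by
        refine Nat.mul_le_mul_left _ ?_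
        calc (p ^ k - 1) * c ≤ (p ^ k - 1) * 1 := Nat.mul_le_mul_left _ (by omega)
          _ = _ := mul_one _
      have h6 : d * (p ^ k - 1) < Fintype.card τ * (p ^ k - 1) :=
          Nat.mul_lt_mul_of_pos_right hdn hq1
      omega
    rw [mul_comm]
    exact Nat.mul_le_mul_left _ this
  set S := ∑ j ∈ J, (Nat.digits p (r j)).sum with hS
  have hgeom : (p - 1) * ∑ t ∈ Finset.range k, p ^ t = p ^ k - 1 := by
    have := Nat.geomSum_eq (m := p) hp1 k
    rw [this]
    exact Nat.mul_div_cancel' (by simpa using Nat.sub_dvd_pow_sub_pow p 1 k)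
  have hsum : k * (2 * (p ^ k - 1)) ≤ S * ∑ t ∈ Finset.range k, p ^ t := by
    calc k * (2 * (p ^ k - 1)) = ∑ _t ∈ Finset.range k, 2 * (p ^ k - 1) := by simp
      _ ≤ ∑ t ∈ Finset.range k, ∑ j ∈ J, R t j := Finset.sum_le_sum fun t _ => key t
      _ = ∑ j ∈ J, ∑ t ∈ Finset.range k, R (t + 0) j := by rw [Finset.sum_comm]; rfl
      _ = _ := by rw [hS, Finset.sum_mul]; exact Finset.sum_congr rfl fun j _ =>
                    sum_cyclicDigits p k 0 _
  have hG : 0 < ∑ t ∈ Finset.range k, p ^ t :=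
    Finset.sum_pos (fun t _ => pow_pos hp.out.pos t) ⟨0, by simpa using hk⟩
  have hS2 : 2 * k * (p - 1) ≤ S := by
    refine Nat.le_of_mul_le_mul_right ?_ hG
    calc 2 * k * (p - 1) * ∑ t ∈ Finset.range k, p ^ t
        = k * (2 * ((p - 1) * ∑ t ∈ Finset.range k, p ^ t)) := by ring
      _ ≤ _ := by rw [hgeom]; exact hsum
  have hv := padicValNat_multinomial p J r
  rw [← hS, hr] at hv
  have hE := digits_sum_pow_sub_one_mul_pow hp1 k M
  have hk' : k ≤ padicValNat p (Nat.multinomial J r) := by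
    refine le_of_mul_le_mul_left ?_ (show 0 < p - 1 by omega)
    have : 2 * k * (p - 1) = k * (p - 1) + k * (p - 1) := by ring
    have h2 : (p - 1) * k = k * (p - 1) := mul_comm _ _
    omega
  exact (pow_dvd_pow p hk').trans pow_padicValNat_dvd

/-! ### Counting -/

open Classical in
/-- The indicator of a proposition, as an integer. -/
noncomputable def ind (P : Prop) : ℤ := if P then 1 else 0

lemma ind_of {P : Prop} (h : P) : ind P = 1 := if_pos h

lemma ind_of_not {P : Prop} (h : ¬ P) : ind P = 0 := if_neg h

lemma ind_congr {P Q : Prop} (h : P ↔ Q) : ind P = ind Q := by rw [propext h]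

lemma ind_not (P : Prop) : ind (¬ P) = 1 - ind P := by
  by_cases h : P <;> simp [ind, h]

/-- The number of elements with a property, as an integer (`0` if there are infinitely many). -/
noncomputable def count {X : Type*} (P : X → Prop) : ℤ := (Nat.card {x // P x} : ℤ)

lemma count_eq_sum {X : Type*} [Fintype X] (P : X → Prop) : count P = ∑ x, ind (P x) := by
  classical
  simp only [count, ind, Finset.sum_boole]
  rw [Nat.card_eq_fintype_card, Fintype.card_subtype]

lemma count_congr {X : Type*} {P Q : X → Prop} (h : ∀ x, P x ↔ Q x) : count P = count Q := by
  rw [funext fun x => propext (h x)]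

lemma count_equiv {X Y : Type*} (e : X ≃ Y) {P : X → Prop} {Q : Y → Prop}
    (h : ∀ x, P x ↔ Q (e x)) : count P = count Q := by
  simp only [count, Nat.card_congr (e.subtypeEquiv h)]

lemma count_not {X : Type*} [Finite X] (P : X → Prop) :
    count (fun x => ¬ P x) = Nat.card X - count P := by
  have := Fintype.ofFinite X
  simp [count_eq_sum, ind_not, Finset.sum_sub_distrib]

lemma count_prod {X Y : Type*} [Fintype X] [Finite Y] (P : X × Y → Prop) :
    count P = ∑ x, count (fun y => P (x, y)) := by
  have := Fintype.ofFinite Y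
  simp only [count_eq_sum, Fintype.sum_prod_type]

lemma count_prod_right {X Y : Type*} [Finite X] [Fintype Y] (P : X × Y → Prop) :
    count P = ∑ y, count (fun x => P (x, y)) := by
  have := Fintype.ofFinite X
  simp only [count_eq_sum, Fintype.sum_prod_type_right]

lemma count_true {X : Type*} {P : X → Prop} (h : ∀ x, P x) : count P = Nat.card X := by
  rw [count, Nat.card_congr (Equiv.subtypeUnivEquiv h)]

lemma count_false {X : Type*} {P : X → Prop} (h : ∀ x, ¬ P x) : count P = 0 := by
  have : IsEmpty {x // P x} := ⟨fun x => h _ x.2⟩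
  simp [count]

lemma count_unique {X : Type*} {P : X → Prop} (x : X) (h : ∀ y, P y ↔ y = x) :
    count P = 1 := by
  rw [count_congr h]
  simp [count]

/-! ### Ax's theorem -/

section Ax

variable {p : ℕ} [Fact p.Prime] {F : Type*} [Field F] [CharP F p]

lemma WittVector.dvd_of_coeff_zero_eq_zero [Finite F] (x : WittVector p F)
    (h : x.coeff 0 = 0) : (p : WittVector p F) ∣ x := by
  by_cases hx : x = 0
  · exact hx ▸ dvd_zero _
  obtain ⟨m, b, hb, rfl⟩ := WittVector.exists_eq_pow_p_mul x hx
  rcases m with _ | m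
  · simp only [pow_zero, one_mul] at h
    exact absurd h hb
  · exact (dvd_pow_self _ (Nat.succ_ne_zero m)).mul_right _

lemma WittVector.coeff_zero_eq_zero_of_dvd {x : WittVector p F} (h : (p : WittVector p F) ∣ x) :
    x.coeff 0 = 0 := by
  obtain ⟨y, rfl⟩ := h
  change WittVector.constantCoeff ((p : WittVector p F) * y) = 0
  rw [map_mul, map_natCast, CharP.cast_eq_zero, zero_mul]

lemma WittVector.pow_dvd_natCast [Finite F] {k N : ℕ}
    (h : (p : WittVector p F) ^ k ∣ (N : WittVector p F)) : p ^ k ∣ N := by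
  induction k generalizing N with
  | zero => simp
  | succ k ih =>
    obtain ⟨m, rfl⟩ := ih ((pow_dvd_pow _ (Nat.le_succ k)).trans h)
    have hp0 : (p : WittVector p F) ^ k ≠ 0 := pow_ne_zero _ (WittVector.p_nonzero p F)
    rw [pow_succ]
    refine Nat.mul_dvd_mul_left _ ?_
    rw [pow_succ, Nat.cast_mul, Nat.cast_pow] at h
    have h1 := WittVector.coeff_zero_eq_zero_of_dvd ((mul_dvd_mul_iff_left hp0).1 h)
    change WittVector.constantCoeff ((m : WittVector p F)) = 0 at h1
    rw [map_natCast] at h1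
    exact (CharP.cast_eq_zero_iff F p m).1 h1

lemma WittVector.sum_teichmuller_pow [Fintype F] {e : ℕ} (he : ¬ (Fintype.card F - 1 ∣ e)) :
    ∑ a : F, WittVector.teichmuller p a ^ e = 0 := by
  classical
  have he0 : e ≠ 0 := fun h => he (h ▸ dvd_zero _)
  rw [← Finset.sum_subset (Finset.subset_univ (Finset.univ.filter fun a : F => a ≠ 0))]
  · let φ : Fˣ →* WittVector p F :=
      (powMonoidHom e).comp ((WittVector.teichmuller p).comp (Units.coeHom F))
    have hφ : φ ≠ 1 := by
      intro h
      apply he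
      obtain ⟨g, hg⟩ := IsCyclic.exists_generator (α := Fˣ)
      rw [← Fintype.card_units, ← Nat.card_eq_fintype_card,
        ← orderOf_eq_card_of_forall_mem_zpowers hg]
      refine orderOf_dvd_of_pow_eq_one ?_
      have h1 := congrArg (fun w : WittVector p F => w.coeff 0) (DFunLike.congr_fun h g)
      have h2 : φ g = WittVector.teichmuller p ((g ^ e : Fˣ) : F) := by
        simp [φ]
      simp only [h2, WittVector.teichmuller_coeff_zero, MonoidHom.one_apply,
        WittVector.one_coeff_zero] at h1
      exact Units.ext h1
    rw [← sum_hom_units_eq_zero φ hφ]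
    symm
    refine Finset.sum_bij (fun u _ => (u : F)) (by simp) (fun a _ b _ h => Units.ext h) ?_ ?_
    · intro b hb
      exact ⟨Units.mk0 b (by simpa using hb), by simp, rfl⟩
    · intro u _
      simp [φ]
  · intro a _ ha
    have : a = 0 := by simpa using ha
    rw [this, WittVector.teichmuller_zero, zero_pow he0]

/-- An exponent `0` contributes a factor `q`, and an exponent that is not divisible by `q - 1` a
factor `0`. -/
lemma WittVector.card_dvd_sum_prod_teichmuller [Fintype F] {τ : Type*} [Fintype τ]
    [DecidableEq τ] (e : τ → ℕ) (h : ∃ i, e i = 0 ∨ ¬ (Fintype.card F - 1 ∣ e i)) :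
    (Fintype.card F : WittVector p F) ∣ ∑ x : τ → F, ∏ i, WittVector.teichmuller p (x i) ^ e i := by
  classical
  obtain ⟨i, hi⟩ := h
  rw [← Fintype.piFinset_univ,
    ← Finset.prod_univ_sum (fun _ => Finset.univ) (fun i a => WittVector.teichmuller p a ^ e i)]
  refine Dvd.dvd.trans ?_ (Finset.dvd_prod_of_mem _ (Finset.mem_univ i))
  rcases hi with hi | hi
  · simp [hi]
  · rw [WittVector.sum_teichmuller_pow hi]
    exact dvd_zero _

end Ax

lemma aeval_pow_eq_sum_multinomial {R : Type*} [CommRing R] {τ : Type*} [Fintype τ]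
    [DecidableEq τ] (f : MvPolynomial τ ℤ) (t : τ → R) (E : ℕ) :
    aeval t f ^ E = ∑ r ∈ Finset.piAntidiag f.support E,
        ((Nat.multinomial f.support r : R) * ∏ m ∈ f.support, ((coeff m f : ℤ) : R) ^ r m) *
          ∏ i, t i ^ (∑ m ∈ f.support, r m * m i) := by
  have : aeval t f = ∑ m ∈ f.support, ((coeff m f : ℤ) : R) * ∏ i, t i ^ m i := by
    simp only [aeval_def, eval₂_eq', eq_intCast]
  rw [this, Finset.sum_pow_eq_sum_piAntidiag]
  refine Finset.sum_congr rfl fun r _ => ?_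
  simp only [mul_pow, Finset.prod_mul_distrib, mul_assoc]
  congr 2
  simp only [← Finset.prod_pow]
  rw [Finset.prod_comm]
  refine Finset.prod_congr rfl fun i _ => ?_
  rw [← Finset.prod_pow_eq_pow_sum]
  refine Finset.prod_congr rfl fun m _ => ?_
  rw [← pow_mul, mul_comm]

/-- Expansion of a power sum into monomials: those with good exponents have multinomial
coefficients divisible by `q`, and for the others the sum over the points is. -/
lemma pow_dvd_sum_aeval_pow {R : Type*} [CommRing R] {F τ : Type*} [Fintype F] [Fintype τ]
    [DecidableEq τ] {p : ℕ} [Fact p.Prime] {k : ℕ} (hk : 0 < k) (M : ℕ) (f : MvPolynomial τ ℤ)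
    (hf : f.totalDegree < Fintype.card τ) (t : F → R)
    (ht : ∀ e : τ → ℕ, (∃ i, e i = 0 ∨ ¬ (p ^ k - 1 ∣ e i)) →
      (p : R) ^ k ∣ ∑ x : τ → F, ∏ i, t (x i) ^ e i) :
    (p : R) ^ k ∣ ∑ x : τ → F, aeval (fun i => t (x i)) f ^ ((p ^ k - 1) * p ^ M) := by
  simp only [aeval_pow_eq_sum_multinomial]
  rw [Finset.sum_comm]
  refine Finset.dvd_sum fun r hr => ?_
  replace hr := (Finset.mem_piAntidiag (μ := ℕ)).1 hr
  rw [← Finset.mul_sum]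
  by_cases hgood : ∃ i, (∑ m ∈ f.support, r m * m i) = 0 ∨
      ¬ (p ^ k - 1 ∣ ∑ m ∈ f.support, r m * m i)
  · exact (ht _ hgood).mul_left _
  · push Not at hgood
    refine Dvd.dvd.mul_right (Dvd.dvd.mul_right ?_ _) _
    have hmult : p ^ k ∣ Nat.multinomial f.support r := by
      refine pow_dvd_multinomial hk M f.totalDegree f.support r (fun m i => m i) ?_ hf
        hr.1 (fun i => (hgood i).2)
        (fun i => Nat.pos_of_ne_zero (hgood i).1)
      intro m hm
      have := le_totalDegree hm
      rwa [Finsupp.sum_fintype _ _ (fun _ => rfl)] at this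
    exact_mod_cast Nat.cast_dvd_cast (α := R) hmult

/-- The indicator of a zero in a finite field, modulo `q`, as a power of any lift to the Witt
vectors. -/
lemma WittVector.card_dvd_ind_sub {p : ℕ} [hp : Fact p.Prime] {F : Type*} [Field F] [Fintype F]
    [CharP F p] {k : ℕ} (hk : Fintype.card F = p ^ k) (t : WittVector p F) :
    (p : WittVector p F) ^ k ∣
      ((ind (t.coeff 0 = 0) : ℤ) : WittVector p F) - (1 - t ^ ((p ^ k - 1) * p ^ k)) := by
  have hq1 : 1 ≤ p ^ k - 1 := hk ▸ Nat.le_sub_one_of_lt Fintype.one_lt_card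
  by_cases hx : t.coeff 0 = 0
  · rw [ind_of hx]
    have h2 := pow_dvd_pow_of_dvd (WittVector.dvd_of_coeff_zero_eq_zero _ hx)
      ((p ^ k - 1) * p ^ k)
    have hE : k ≤ (p ^ k - 1) * p ^ k :=
      (Nat.lt_pow_self hp.out.one_lt).le.trans (Nat.le_mul_of_pos_left _ hq1)
    have h3 : ((1 : ℤ) : WittVector p F) - (1 - t ^ ((p ^ k - 1) * p ^ k))
        = t ^ ((p ^ k - 1) * p ^ k) := by
      rw [Int.cast_one, sub_sub_cancel]
    rw [h3]
    exact (pow_dvd_pow _ hE).trans h2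
  · rw [ind_of_not hx]
    have h2 : (p : WittVector p F) ∣ t ^ (p ^ k - 1) - 1 := by
      refine WittVector.dvd_of_coeff_zero_eq_zero _ ?_
      change WittVector.constantCoeff (t ^ (p ^ k - 1) - 1) = 0
      rw [map_sub, map_pow, map_one, ← hk]
      change t.coeff 0 ^ (Fintype.card F - 1) - 1 = 0
      rw [FiniteField.pow_card_sub_one_eq_one _ hx, sub_self]
    have h3 := dvd_sub_pow_of_dvd_sub h2 k
    rw [one_pow, ← pow_mul] at h3
    have h4 : ((0 : ℤ) : WittVector p F) - (1 - t ^ ((p ^ k - 1) * p ^ k))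
        = t ^ ((p ^ k - 1) * p ^ k) - 1 := by
      rw [Int.cast_zero, zero_sub, neg_sub]
    rw [h4]
    exact (pow_dvd_pow _ (Nat.le_succ _)).trans h3

/-- Ax's theorem for one polynomial with integer coefficients: if the degree is less than the
number of variables, the number of zeros is divisible by the order of the field.
The zeros are counted modulo `q` by a power sum over Teichmüller representatives in the Witt
vectors of `F`; expanding the power, the terms that do not cancel are divisible by `q` by
`pow_dvd_multinomial`. -/
theorem card_dvd_count_zeros {F : Type*} [Field F] [Finite F] {τ : Type*} [Fintype τ]
    (f : MvPolynomial τ ℤ) (hf : f.totalDegree < Fintype.card τ) :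
    (Nat.card F : ℤ) ∣ count (fun a : τ → F => aeval a f = 0) := by
  classical
  have := Fintype.ofFinite F
  obtain ⟨p, hp⟩ := CharP.exists F
  have := Fact.mk (CharP.char_is_prime F p)
  obtain ⟨k, -, hk⟩ := FiniteField.card F p
  have hcard : (p : WittVector p F) ^ (k : ℕ) = (Fintype.card F : WittVector p F) := by
    rw [hk]; push_cast; rfl
  have h2 := pow_dvd_sum_aeval_pow (R := WittVector p F) (F := F) (p := p) k.pos k f hf
    (WittVector.teichmuller p) (fun e he => by
      rw [hcard]
      rw [← hk] at he
      exact WittVector.card_dvd_sum_prod_teichmuller e he)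
  have hT0 : ∀ x : τ → F,
      (aeval (fun i => WittVector.teichmuller p (x i)) f : WittVector p F).coeff 0
        = aeval x f := by
    intro x
    have h := map_aeval (fun i => WittVector.teichmuller p (x i))
      (WittVector.constantCoeff (p := p) (R := F)) f
    refine h.trans ?_
    rw [aeval_def, coe_eval₂Hom]
    congr 2
    exact RingHom.ext_int _ _
  have h1 := Finset.dvd_sum fun (x : τ → F) (_ : x ∈ Finset.univ) =>
    WittVector.card_dvd_ind_sub hk
      (aeval (fun i => WittVector.teichmuller p (x i)) f : WittVector p F)
  simp only [hT0] at h1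
  rw [Finset.sum_sub_distrib, Finset.sum_sub_distrib, ← Int.cast_sum, ← count_eq_sum] at h1
  have h4 : (p : WittVector p F) ^ (k : ℕ) ∣ ∑ x : τ → F, (1 : WittVector p F) := by
    have hτ : Fintype.card τ ≠ 0 := by omega
    rw [hcard]
    simp only [Finset.sum_const, Finset.card_univ, Fintype.card_fun, nsmul_eq_mul, mul_one]
    rw [Nat.cast_pow]
    exact dvd_pow_self _ hτ
  have h6 := dvd_add h1 (dvd_sub h4 h2)
  rw [sub_add_cancel, count, Int.cast_natCast] at h6
  have h7 := WittVector.pow_dvd_natCast (p := p) (F := F) h6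
  rw [count, Nat.card_eq_fintype_card, hk]
  exact_mod_cast h7

/-! ### Point counts modulo `p` as traces -/

lemma exists_isIdempotentElem_pow {M : Type*} [Monoid M] [Finite M] (a : M) :
    ∃ k, 0 < k ∧ IsIdempotentElem (a ^ k) := by
  obtain ⟨i, j, hne, hij⟩ := Finite.exists_ne_map_eq_of_infinite fun n : ℕ => a ^ n
  wlog hlt : i < j generalizing i j
  · exact this j i hne.symm hij.symm (by omega)
  obtain ⟨b, rfl⟩ := Nat.exists_eq_add_of_lt hlt
  have h1 : ∀ m, i ≤ m → a ^ (m + (b + 1)) = a ^ m := by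
    intro m hm
    obtain ⟨c, rfl⟩ := Nat.exists_eq_add_of_le hm
    calc a ^ (i + c + (b + 1)) = a ^ (i + b + 1) * a ^ c := by rw [← pow_add]; congr 1; ring
      _ = a ^ (i + c) := by rw [pow_add a i c]; exact congrArg (· * a ^ c) hij.symm
  have h2 : ∀ c m, i ≤ m → a ^ (m + c * (b + 1)) = a ^ m := by
    intro c
    induction c with
    | zero => simp
    | succ c ih =>
      intro m hm
      rw [show m + (c + 1) * (b + 1) = m + c * (b + 1) + (b + 1) by ring,
        h1 _ (by omega), ih m hm]
  refine ⟨(i + 1) * (b + 1), by positivity, ?_⟩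
  rw [IsIdempotentElem, ← pow_add]
  exact h2 _ _ (by nlinarith)

/-- The trace of an idempotent matrix is its rank. -/
lemma Matrix.exists_trace_eq_natCast {K n : Type*} [Field K] [Fintype n] [DecidableEq n]
    {A : Matrix n n K} (hA : IsIdempotentElem A) :
    ∃ m : ℕ, m ≤ Fintype.card n ∧ A.trace = m := by
  have h1 : IsIdempotentElem (Matrix.toLin' A) := by
    rw [IsIdempotentElem, Module.End.mul_eq_comp, ← Matrix.toLin'_mul, hA.eq]
  refine ⟨Module.finrank K (LinearMap.range (Matrix.toLin' A)), ?_, ?_⟩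
  · simpa using (LinearMap.range (Matrix.toLin' A)).finrank_le
  · rw [← Matrix.trace_toLin'_eq]
    exact ((LinearMap.isProj_range_iff_isIdempotentElem _).2 h1).trace

/-- The exponent vectors with positive entries and sum at most `d`. -/
def positiveVectors (τ : Type*) [Fintype τ] [DecidableEq τ] (d : ℕ) : Finset (τ → ℕ) :=
  (Fintype.piFinset fun _ => Finset.Icc 1 d).filter fun u => ∑ i, u i ≤ d

lemma mem_positiveVectors {τ : Type*} [Fintype τ] [DecidableEq τ] {d : ℕ} {u : τ → ℕ} :
    u ∈ positiveVectors τ d ↔ (∀ i, 1 ≤ u i) ∧ ∑ i, u i ≤ d := by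
  simp only [positiveVectors, Finset.mem_filter, Fintype.mem_piFinset, Finset.mem_Icc]
  refine ⟨fun h => ⟨fun i => (h.1 i).1, h.2⟩, fun h => ⟨fun i => ⟨h.1 i, ?_⟩, h.2⟩⟩
  exact (Finset.single_le_sum (fun _ _ => Nat.zero_le _) (Finset.mem_univ i)).trans h.2

/-- Each vector `u` has weight `∏ 2 ^ (-u i) ≥ 2 ^ (-d)`, and the weights of all positive vectors
with entries at most `d` add up to a power of `1 - 2 ^ (-d)`. -/
lemma card_positiveVectors_lt {τ : Type*} [Fintype τ] [DecidableEq τ] [Nonempty τ] (d : ℕ) :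
    (positiveVectors τ d).card < 2 ^ d := by
  have h1 : ∑ u ∈ positiveVectors τ d, ∏ i, (1 / 2 : ℚ) ^ u i ≤ (1 - (1 / 2 : ℚ) ^ d) := by
    calc ∑ u ∈ positiveVectors τ d, ∏ i, (1 / 2 : ℚ) ^ u i
        ≤ ∑ u ∈ Fintype.piFinset fun _ : τ => Finset.Icc 1 d, ∏ i, (1 / 2 : ℚ) ^ u i :=
          Finset.sum_le_sum_of_subset_of_nonneg (Finset.filter_subset _ _)
            fun _ _ _ => by positivity
      _ = ∏ _i : τ, ∑ j ∈ Finset.Icc 1 d, (1 / 2 : ℚ) ^ j :=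
          (Finset.prod_univ_sum (fun _ => Finset.Icc 1 d) (fun _ j => (1 / 2 : ℚ) ^ j)).symm
      _ = (1 - (1 / 2 : ℚ) ^ d) ^ Fintype.card τ := by
          have : ∑ j ∈ Finset.Icc 1 d, (1 / 2 : ℚ) ^ j = 1 - (1 / 2) ^ d := by
            induction d with
            | zero => simp
            | succ d ih =>
              rw [Finset.sum_Icc_succ_top (by omega), ih]
              ring
          rw [this]
          simp
      _ ≤ _ := by
          have h0 : (0 : ℚ) ≤ 1 - (1 / 2) ^ d := by
            have : (1 / 2 : ℚ) ^ d ≤ 1 := pow_le_one₀ (by norm_num) (by norm_num)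
            linarith
          have h2 : 1 - (1 / 2 : ℚ) ^ d ≤ 1 := by
            have : (0 : ℚ) ≤ (1 / 2) ^ d := by positivity
            linarith
          exact (pow_le_of_le_one h0 h2 Fintype.card_ne_zero)
  have h2 : ((positiveVectors τ d).card : ℚ) * (1 / 2) ^ d
      ≤ ∑ u ∈ positiveVectors τ d, ∏ i, (1 / 2 : ℚ) ^ u i := by
    rw [← nsmul_eq_mul, ← Finset.sum_const]
    refine Finset.sum_le_sum fun u hu => ?_
    rw [Finset.prod_pow_eq_pow_sum]
    exact pow_le_pow_of_le_one (by norm_num) (by norm_num) (mem_positiveVectors.1 hu).2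
  have h3 : ((positiveVectors τ d).card : ℚ) ≤ 2 ^ d - 1 := by
    have h4 : (1 / 2 : ℚ) ^ d * 2 ^ d = 1 := by rw [← mul_pow]; norm_num
    have h5 : (0 : ℚ) < 2 ^ d := by positivity
    have h6 := mul_le_mul_of_nonneg_right (h2.trans h1) h5.le
    rw [mul_assoc, h4, sub_mul, h4] at h6
    linarith
  have h4 : ((positiveVectors τ d).card : ℚ) < 2 ^ d := by linarith
  exact_mod_cast h4

/-- The operator `C_p` that extracts the monomials with exponents divisible by `p` satisfies
`C_p (g(x ^ p) h) = g C_p(h)`; stated for coefficients. -/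
lemma coeff_expand_mul_eq_sum {τ R : Type*} [CommSemiring R] {p : ℕ} (hp : p ≠ 0)
    (g h : MvPolynomial τ R) (e : τ →₀ ℕ) (W : Finset (τ →₀ ℕ))
    (hW : ∀ w, coeff (p • w) h ≠ 0 → w ∈ W) :
    coeff (p • e) (expand p g * h)
      = ∑ w ∈ W, coeff e (g * monomial w 1) * coeff (p • w) h := by
  classical
  induction g using MvPolynomial.induction_on' with
  | add g₁ g₂ h₁ h₂ => simp only [map_add, add_mul, coeff_add, h₁, h₂, Finset.sum_add_distrib]
  | monomial r a =>
    have hle : p • r ≤ p • e ↔ r ≤ e := by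
      simp only [Finsupp.le_def, Finsupp.smul_apply, smul_eq_mul]
      exact forall_congr' fun i => Nat.mul_le_mul_left_iff (Nat.pos_of_ne_zero hp)
    rw [expand_monomial, coeff_monomial_mul']
    simp only [hle, coeff_monomial_mul', coeff_monomial]
    split_ifs with hre
    · have h1 : p • e - p • r = p • (e - r) := by
        ext i; simp [Nat.mul_sub]
      rw [h1]
      simp only [mul_ite, mul_one, mul_zero, ite_mul, zero_mul]
      rw [Finset.sum_ite_eq']
      split_ifs with hmem
      · rfl
      · rw [not_imp_comm.1 (hW _) hmem, mul_zero]
    · simp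

section Trace

variable {p : ℕ} [hp : Fact p.Prime] {τ : Type*} [Fintype τ] [DecidableEq τ]

/-- The Hasse-Witt matrix of `g`, of degree at most `d`: the matrix of the operator
`h ↦ C_p (g ^ (p - 1) h)`, where `C_p` extracts the monomials with exponents divisible by `p`. -/
noncomputable def hasseWitt (d : ℕ) (g : MvPolynomial τ (ZMod p)) :
    Matrix (positiveVectors τ d) (positiveVectors τ d) (ZMod p) :=
  Matrix.of fun u v => coeff (p • Finsupp.equivFunOnFinite.symm u.1)
    (g ^ (p - 1) * monomial (Finsupp.equivFunOnFinite.symm v.1) 1)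

lemma hasseWitt_pow {d : ℕ} {g : MvPolynomial τ (ZMod p)} (hg : g.totalDegree ≤ d) (k : ℕ)
    (u v : positiveVectors τ d) :
    (hasseWitt d g ^ k) u v = coeff (p ^ k • Finsupp.equivFunOnFinite.symm u.1)
      (g ^ (p ^ k - 1) * monomial (Finsupp.equivFunOnFinite.symm v.1) 1) := by
  have hp1 := hp.out.one_lt
  induction k generalizing v with
  | zero =>
    simp only [pow_zero, Matrix.one_apply, one_smul, Nat.sub_self, one_mul, coeff_monomial,
      EmbeddingLike.apply_eq_iff_eq, Subtype.coe_inj, eq_comm]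
  | succ k ih =>
    rw [pow_succ, Matrix.mul_apply]
    simp only [ih]
    have h1 : g ^ (p ^ (k + 1) - 1) = expand p (g ^ (p ^ k - 1)) * g ^ (p - 1) := by
      rw [expand_zmod, ← pow_mul, ← pow_add]
      congr 1
      have := Nat.one_le_pow k p (by omega)
      rw [Nat.sub_mul, pow_succ, one_mul]
      have : p ≤ p ^ k * p := Nat.le_mul_of_pos_left _ (by omega)
      omega
    have h2 : p ^ (k + 1) • Finsupp.equivFunOnFinite.symm u.1
        = p • (p ^ k • Finsupp.equivFunOnFinite.symm u.1) := by
      rw [smul_smul, pow_succ, mul_comm]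
    rw [h1, h2, mul_assoc, coeff_expand_mul_eq_sum hp.out.ne_zero _ _ _
      ((positiveVectors τ d).map Finsupp.equivFunOnFinite.symm.toEmbedding)]
    · rw [Finset.sum_map]
      exact Finset.sum_coe_sort (positiveVectors τ d) fun w =>
        coeff (p ^ k • Finsupp.equivFunOnFinite.symm u.1)
          (g ^ (p ^ k - 1) * monomial (Finsupp.equivFunOnFinite.symm w) 1) *
        coeff (p • Finsupp.equivFunOnFinite.symm w)
          (g ^ (p - 1) * monomial (Finsupp.equivFunOnFinite.symm v.1) 1)
    · intro w hw
      have hvm := mem_positiveVectors.1 v.2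
      rw [coeff_mul_monomial'] at hw
      split_ifs at hw with hle
      swap
      · exact absurd rfl hw
      rw [mul_one] at hw
      refine Finset.mem_map.2 ⟨w, mem_positiveVectors.2 ⟨fun i => ?_, ?_⟩, by simp⟩
      · have := hle i
        simp only [Finsupp.equivFunOnFinite_symm_apply_apply, Finsupp.smul_apply, smul_eq_mul]
          at this
        have h3 := hvm.1 i
        by_contra h0
        have : w i = 0 := by omega
        simp_all
      · have h3 := le_totalDegree (mem_support_iff.2 hw)
        rw [Finsupp.sum_fintype _ _ (fun _ => rfl)] at h3
        have h4 : ∑ i, (p • w - Finsupp.equivFunOnFinite.symm v.1) i + ∑ i, v.1 i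
            = p * ∑ i, w i := by
          rw [← Finset.sum_add_distrib, Finset.mul_sum]
          refine Finset.sum_congr rfl fun i _ => ?_
          have := hle i
          simp only [Finsupp.equivFunOnFinite_symm_apply_apply, Finsupp.smul_apply, smul_eq_mul,
            Finsupp.tsub_apply] at this ⊢
          omega
        have h5 : (g ^ (p - 1)).totalDegree ≤ (p - 1) * d :=
          (totalDegree_pow _ _).trans (Nat.mul_le_mul_left _ hg)
        have h6 : p * ∑ i, w i ≤ p * d := by
          have : (p - 1) * d + d = p * d := by
            rw [← Nat.succ_mul]; congr 1; omega
          have := hvm.2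
          omega
        exact Nat.le_of_mul_le_mul_left h6 (by omega)

lemma sum_pow_eq_ite {F : Type*} [Field F] [Fintype F] (e : ℕ) :
    ∑ a : F, a ^ e = if e ≠ 0 ∧ Fintype.card F - 1 ∣ e then -1 else 0 := by
  classical
  by_cases he : e = 0
  · simp [he]
  simp only [ne_eq, he, not_false_eq_true, true_and]
  rw [← FiniteField.sum_pow_units F e,
    ← Finset.sum_subset (Finset.subset_univ (Finset.univ.filter fun a : F => a ≠ 0))]
  · symm
    refine Finset.sum_bij (fun u _ => (u : F)) (by simp) (fun a _ b _ h => Units.ext h) ?_ ?_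
    · intro b hb
      exact ⟨Units.mk0 b (by simpa using hb), by simp, rfl⟩
    · simp
  · intro a _ ha
    have : a = 0 := by simpa using ha
    rw [this, zero_pow he]

/-- Over the field with `p ^ k` elements, the number of zeros is, up to sign, the trace of the
`k`-th power of the Hasse-Witt matrix. -/
lemma natCast_count_eq_trace {F : Type*} [Field F] [Fintype F] [Algebra (ZMod p) F]
    [Nonempty τ] {k : ℕ} (hk : Fintype.card F = p ^ k) (f : MvPolynomial τ ℤ) {d : ℕ}
    (hf : f.totalDegree ≤ d) :
    ((count (fun a : τ → F => aeval a f = 0) : ℤ) : F) = (-1) ^ (Fintype.card τ + 1) *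
      algebraMap (ZMod p) F ((hasseWitt d (map (Int.castRingHom (ZMod p)) f) ^ k).trace) := by
  set g := map (Int.castRingHom (ZMod p)) f with hg
  have hgd : g.totalDegree ≤ d := (Finset.sup_mono (support_map_subset _ _)).trans hf
  set q := Fintype.card F with hq
  have hq1 : 1 < q := Fintype.one_lt_card
  have hfg : ∀ a : τ → F, aeval a f = aeval a g := by
    intro a
    rw [hg, aeval_def, aeval_def, eval₂_map]
    congr 1
    exact RingHom.ext_int _ _
  have h1 : ∀ a : τ → F, ((ind (aeval a f = 0) : ℤ) : F) = 1 - aeval a (g ^ (q - 1)) := by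
    intro a
    rw [map_pow, ← hfg]
    by_cases h : aeval a f = 0
    · rw [ind_of h, h, zero_pow (by omega)]; simp
    · rw [ind_of_not h, FiniteField.pow_card_sub_one_eq_one _ h]; simp
  have h2 : ∑ a : τ → F, aeval a (g ^ (q - 1)) = ∑ m ∈ (g ^ (q - 1)).support,
      algebraMap (ZMod p) F (coeff m (g ^ (q - 1))) *
        ∏ i, (if m i ≠ 0 ∧ q - 1 ∣ m i then (-1 : F) else 0) := by
    simp only [aeval_def, eval₂_eq']
    rw [Finset.sum_comm]
    refine Finset.sum_congr rfl fun m _ => ?_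
    rw [← Finset.mul_sum, ← Fintype.piFinset_univ,
      ← Finset.prod_univ_sum (fun _ => Finset.univ) (fun i a => a ^ m i)]
    simp only [sum_pow_eq_ite, ← hq]
  have h3 : ∑ m ∈ (g ^ (q - 1)).support, algebraMap (ZMod p) F (coeff m (g ^ (q - 1))) *
        ∏ i, (if m i ≠ 0 ∧ q - 1 ∣ m i then (-1 : F) else 0)
      = ∑ u ∈ positiveVectors τ d, algebraMap (ZMod p) F
          (coeff ((q - 1) • Finsupp.equivFunOnFinite.symm u) (g ^ (q - 1))) *
            (-1) ^ Fintype.card τ := by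
    have hinj : Function.Injective fun u : τ → ℕ => (q - 1) • Finsupp.equivFunOnFinite.symm u := by
      intro u v h
      funext i
      have := DFunLike.congr_fun h i
      simp only [Finsupp.smul_apply, Finsupp.equivFunOnFinite_symm_apply_apply, smul_eq_mul] at this
      exact Nat.eq_of_mul_eq_mul_left (by omega) this
    have hprod : ∀ u ∈ positiveVectors τ d, ∏ i, (if ((q - 1) •
        Finsupp.equivFunOnFinite.symm u) i ≠ 0 ∧ q - 1 ∣ ((q - 1) •
        Finsupp.equivFunOnFinite.symm u) i then (-1 : F) else 0) = (-1) ^ Fintype.card τ := by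
      intro u hu
      rw [Finset.prod_congr rfl fun i _ => if_pos ?_]
      · simp
      · have := (mem_positiveVectors.1 hu).1 i
        simp
        omega
    symm
    rw [Finset.sum_congr rfl fun u hu => by rw [← hprod u hu]]
    rw [← Finset.sum_image (f := fun m => algebraMap (ZMod p) F (coeff m (g ^ (q - 1))) *
        ∏ i, (if m i ≠ 0 ∧ q - 1 ∣ m i then (-1 : F) else 0)) (fun u _ v _ h => hinj h)]
    have hz1 : ∀ m, m ∉ (g ^ (q - 1)).support → algebraMap (ZMod p) F (coeff m (g ^ (q - 1))) *
        ∏ i, (if m i ≠ 0 ∧ q - 1 ∣ m i then (-1 : F) else 0) = 0 := by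
      intro m hm
      rw [notMem_support_iff.1 hm, map_zero, zero_mul]
    refine (Finset.sum_subset Finset.subset_union_left ?_).trans
      (Finset.sum_subset Finset.subset_union_right fun m _ hm => hz1 m hm).symm
    intro m hm hm'
    have hms : m ∈ (g ^ (q - 1)).support := by
      rcases Finset.mem_union.1 hm with h | h
      · exact absurd h hm'
      · exact h
    by_contra hne
    apply hm'
    have hall : ∀ i, m i ≠ 0 ∧ q - 1 ∣ m i := by
      intro i
      by_contra h
      exact hne (by rw [Finset.prod_eq_zero (Finset.mem_univ i) (if_neg h), mul_zero])
    choose c hc using fun i => (hall i).2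
    have hm2 : (q - 1) • Finsupp.equivFunOnFinite.symm c = m := by
      ext i; simp [hc]
    refine Finset.mem_image.2 ⟨c, mem_positiveVectors.2 ⟨fun i => ?_, ?_⟩, hm2⟩
    · refine Nat.pos_of_ne_zero fun h0 => (hall i).1 ?_
      rw [hc, h0, mul_zero]
    · have h4 := le_totalDegree hms
      rw [Finsupp.sum_fintype _ _ (fun _ => rfl)] at h4
      have h5 : (g ^ (q - 1)).totalDegree ≤ (q - 1) * d :=
        (totalDegree_pow _ _).trans (Nat.mul_le_mul_left _ hgd)
      simp only [hc, ← Finset.mul_sum] at h4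
      exact Nat.le_of_mul_le_mul_left (h4.trans h5) (by omega)
  have h4 : (hasseWitt d g ^ k).trace = ∑ u ∈ positiveVectors τ d,
      coeff ((q - 1) • Finsupp.equivFunOnFinite.symm u) (g ^ (q - 1)) := by
    rw [Matrix.trace]
    refine Eq.trans (Finset.sum_congr rfl fun u _ => ?_) (Finset.sum_coe_sort _ _)
    rw [Matrix.diag_apply, hasseWitt_pow hgd, ← hk]
    have : q • Finsupp.equivFunOnFinite.symm u.1 = (q - 1) • Finsupp.equivFunOnFinite.symm u.1
        + Finsupp.equivFunOnFinite.symm u.1 := by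
      rw [← succ_nsmul]; congr 1; omega
    rw [this, coeff_mul_monomial, mul_one]
  rw [count_eq_sum, Int.cast_sum, Finset.sum_congr rfl fun a _ => h1 a, Finset.sum_sub_distrib,
    h2, h3, h4, map_sum, ← Finset.sum_mul]
  have h0 : ∑ _a : τ → F, (1 : F) = 0 := by
    simp [Fintype.card_ne_zero]
  rw [h0]
  ring

end Trace

lemma count_zeros_and {F : Type*} [Field F] [Finite F] {X : Type*} [Finite X] (u v : X → F) :
    count (fun a => u a = 0 ∧ v a = 0)
      = count (fun a => u a = 0) + count (fun a => v a = 0) - count (fun a => u a * v a = 0) := by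
  have := Fintype.ofFinite X
  simp only [count_eq_sum, ← Finset.sum_add_distrib, ← Finset.sum_sub_distrib]
  refine Finset.sum_congr rfl fun a _ => ?_
  by_cases h1 : u a = 0 <;> by_cases h2 : v a = 0 <;> simp [ind, h1, h2]

/-- In every characteristic `p` there is a finite field over which the number of common zeros of
`f` and `g` is small modulo `p`: some power of each Hasse-Witt matrix is idempotent, and then its
trace is its rank. -/
theorem exists_field_count_modEq_le {τ : Type*} [Fintype τ] [Nonempty τ] (f g : MvPolynomial τ ℤ)
    (p : ℕ) [hp : Fact p.Prime] :
    ∃ (F : Type) (_ : Field F) (_ : Finite F), CharP F p ∧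
      ∃ c : ℤ, |c| < 2 ^ (f.totalDegree + g.totalDegree) ∧
        (p : ℤ) ∣ count (fun a : τ → F => aeval a f = 0 ∧ aeval a g = 0) - c := by
  classical
  let H : (d : ℕ) → MvPolynomial τ ℤ →
      Matrix (positiveVectors τ d) (positiveVectors τ d) (ZMod p) := fun d h =>
    hasseWitt d (map (Int.castRingHom (ZMod p)) h)
  set df := f.totalDegree
  set dg := g.totalDegree
  obtain ⟨k₁, hk₁, h₁⟩ := exists_isIdempotentElem_pow (H df f)
  obtain ⟨k₂, hk₂, h₂⟩ := exists_isIdempotentElem_pow (H dg g)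
  obtain ⟨k₃, hk₃, h₃⟩ := exists_isIdempotentElem_pow (H (df + dg) (f * g))
  set k := k₁ * k₂ * k₃ with hk
  have hk0 : k ≠ 0 := by positivity
  have h₁' : IsIdempotentElem (H df f ^ k) := by
    rw [hk, mul_assoc, pow_mul]; exact h₁.pow _
  have h₂' : IsIdempotentElem (H dg g ^ k) := by
    rw [hk, mul_comm k₁, mul_assoc, pow_mul]; exact h₂.pow _
  have h₃' : IsIdempotentElem (H (df + dg) (f * g) ^ k) := by
    rw [hk, mul_comm _ k₃, pow_mul]; exact h₃.pow _
  obtain ⟨m₁, hm₁, ht₁⟩ := Matrix.exists_trace_eq_natCast h₁'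
  obtain ⟨m₂, hm₂, ht₂⟩ := Matrix.exists_trace_eq_natCast h₂'
  obtain ⟨m₃, hm₃, ht₃⟩ := Matrix.exists_trace_eq_natCast h₃'
  rw [Fintype.card_coe] at hm₁ hm₂ hm₃
  have b₁ := card_positiveVectors_lt (τ := τ) df
  have b₂ := card_positiveVectors_lt (τ := τ) dg
  have b₃ := card_positiveVectors_lt (τ := τ) (df + dg)
  have := Fintype.ofFinite (GaloisField p k)
  have hcard : Fintype.card (GaloisField p k) = p ^ k := by
    rw [← Nat.card_eq_fintype_card, GaloisField.card p k hk0]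
  have e₁ := natCast_count_eq_trace (τ := τ) hcard f le_rfl
  have e₂ := natCast_count_eq_trace (τ := τ) hcard g le_rfl
  have e₃ := natCast_count_eq_trace (τ := τ) hcard (f * g) (totalDegree_mul f g)
  change _ = _ * algebraMap _ _ (Matrix.trace (H df f ^ k)) at e₁
  change _ = _ * algebraMap _ _ (Matrix.trace (H dg g ^ k)) at e₂
  change _ = _ * algebraMap _ _ (Matrix.trace (H (df + dg) (f * g) ^ k)) at e₃
  rw [ht₁, map_natCast] at e₁
  rw [ht₂, map_natCast] at e₂
  rw [ht₃, map_natCast] at e₃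
  refine ⟨GaloisField p k, inferInstance, inferInstance, inferInstance,
    (-1) ^ (Fintype.card τ + 1) * ((m₁ : ℤ) + m₂ - m₃), ?_, ?_⟩
  · rw [abs_mul, abs_pow, abs_neg, abs_one, one_pow, one_mul]
    have hp₁ : (m₁ : ℤ) < 2 ^ df := by exact_mod_cast hm₁.trans_lt b₁
    have hp₂ : (m₂ : ℤ) < 2 ^ dg := by exact_mod_cast hm₂.trans_lt b₂
    have hp₃ : (m₃ : ℤ) < 2 ^ (df + dg) := by exact_mod_cast hm₃.trans_lt b₃
    have hq₁ : (1 : ℤ) ≤ 2 ^ df := one_le_pow₀ (by norm_num)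
    have hq₂ : (1 : ℤ) ≤ 2 ^ dg := one_le_pow₀ (by norm_num)
    rw [abs_lt, pow_add] at *
    constructor <;> nlinarith
  · rw [← CharP.intCast_eq_zero_iff (GaloisField p k) p, Int.cast_sub, count_zeros_and]
    simp only [map_mul] at e₃
    push_cast
    rw [e₁, e₂, e₃]
    ring

/-! ### Soundness of semilinear reduction -/

/-- The point `a` lies in the coordinate subspace of the variables `s`. -/
def SupportedOn {σ F : Type*} [Zero F] (s : Finset σ) (a : σ → F) : Prop := ∀ i ∉ s, a i = 0

section Restrict

variable {σ : Type*} [DecidableEq σ] {F : Type*} [Field F]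

/-- A point of `F ^ s`, extended by zero. -/
def extendZero (s : Finset σ) (b : s → F) : σ → F := fun i => if h : i ∈ s then b ⟨i, h⟩ else 0

/-- The polynomial `f` with the variables outside `s` set to zero. -/
noncomputable def restrictVars (s : Finset σ) (f : MvPolynomial σ ℤ) : MvPolynomial s ℤ :=
  aeval (fun i => if h : i ∈ s then X ⟨i, h⟩ else 0) f

lemma aeval_restrictVars (s : Finset σ) (f : MvPolynomial σ ℤ) (b : s → F) :
    aeval b (restrictVars s f) = aeval (extendZero s b) f := by
  rw [restrictVars, comp_aeval_apply]
  congr 2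
  funext i
  by_cases h : i ∈ s <;> simp [extendZero, h]

lemma totalDegree_restrictVars_le (s : Finset σ) (f : MvPolynomial σ ℤ) :
    (restrictVars s f).totalDegree ≤ f.totalDegree := by
  classical
  rw [restrictVars, aeval_def, eval₂_eq]
  refine totalDegree_finsetSum_le fun m hm => (totalDegree_mul _ _).trans ?_
  have h1 : (algebraMap ℤ (MvPolynomial s ℤ) (coeff m f)).totalDegree = 0 := by
    rw [algebraMap_eq, totalDegree_C]
  rw [h1, zero_add]
  refine (totalDegree_finsetProd _ _).trans (le_trans ?_ (le_totalDegree hm))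
  refine Finset.sum_le_sum fun i _ => (totalDegree_pow _ _).trans ?_
  refine (Nat.mul_le_mul_left _ (?_ : _ ≤ 1)).trans (mul_one _).le
  split_ifs <;> simp

lemma count_supportedOn (s : Finset σ) (P : (σ → F) → Prop) :
    count (fun a => SupportedOn s a ∧ P a) = count (fun b : s → F => P (extendZero s b)) := by
  refine congrArg _ (Nat.card_congr ?_)
  refine
    { toFun := fun a => ⟨fun i => a.1 i, ?_⟩
      invFun := fun b => ⟨extendZero s b.1, ?_, b.2⟩
      left_inv := ?_
      right_inv := ?_ }
  · have : extendZero s (fun i : s => a.1 i) = a.1 := by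
      funext i
      by_cases h : i ∈ s
      · simp [extendZero, h]
      · simp [extendZero, h, a.2.1 i h]
    have h2 := a.2.2
    rw [← this] at h2
    exact h2
  · intro i hi
    simp [extendZero, hi]
  · intro a
    ext i
    by_cases h : i ∈ s
    · simp [extendZero, h]
    · simp [extendZero, h, a.2.1 i h]
  · intro b
    ext i
    simp [extendZero]

lemma card_dvd_count_supportedOn [Finite F] {s : Finset σ} (hs : s.Nonempty) :
    (Nat.card F : ℤ) ∣ count (fun a : σ → F => SupportedOn s a) := by
  have h := count_supportedOn s (fun _ : σ → F => True)
  simp only [and_true] at h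
  rw [h, count_true fun _ => trivial, Nat.card_fun]
  push_cast
  exact dvd_pow_self _ (by simpa using hs.ne_empty)

lemma card_dvd_count_zeros_supportedOn [Finite F] {s : Finset σ} {f : MvPolynomial σ ℤ}
    (hf : f.totalDegree < s.card) :
    (Nat.card F : ℤ) ∣ count (fun a : σ → F => SupportedOn s a ∧ aeval a f = 0) := by
  rw [count_supportedOn]
  simp only [← aeval_restrictVars]
  exact card_dvd_count_zeros _ (by
    rw [Fintype.card_coe]
    exact (totalDegree_restrictVars_le s f).trans_lt hf)

lemma count_and_zeros_and [Finite F] [Finite σ] (P : (σ → F) → Prop) (u v : (σ → F) → F) :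
    count (fun a => P a ∧ u a = 0 ∧ v a = 0) = count (fun a => P a ∧ u a = 0)
      + count (fun a => P a ∧ v a = 0) - count (fun a => P a ∧ u a * v a = 0) := by
  have := Fintype.ofFinite σ
  have := Fintype.ofFinite F
  simp only [count_eq_sum, ← Finset.sum_add_distrib, ← Finset.sum_sub_distrib]
  refine Finset.sum_congr rfl fun a _ => ?_
  by_cases h0 : P a <;> by_cases h1 : u a = 0 <;> by_cases h2 : v a = 0 <;>
    simp [ind, h0, h1, h2]

/-- Fibering the points over `s` along the variable `x`. -/
lemma count_supportedOn_erase [Fintype F] [Fintype σ] {s : Finset σ} {x : σ} (hx : x ∈ s)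
    (P : (σ → F) → Prop) :
    count (fun a => SupportedOn s a ∧ P a)
      = ∑ a : σ → F, ind (SupportedOn (s.erase x) a) *
        ∑ t : F, ind (P (Function.update a x t)) := by
  classical
  have h1 : ∀ a : σ → F, ind (SupportedOn (s.erase x) a) *
      ∑ t : F, ind (P (Function.update a x t))
      = ∑ t : F, if SupportedOn (s.erase x) a then ind (P (Function.update a x t)) else 0 := by
    intro a
    by_cases h : SupportedOn (s.erase x) a <;> simp [ind, h]
  simp only [h1]
  rw [count_eq_sum, ← Fintype.sum_prod_type', ← Finset.sum_filter]
  have h2 : ∀ a : σ → F, ind (SupportedOn s a ∧ P a)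
      = if SupportedOn s a then ind (P a) else 0 := by
    intro a
    by_cases h : SupportedOn s a <;> simp [ind, h]
  simp only [h2]
  rw [← Finset.sum_filter]
  refine Finset.sum_bij' (fun a _ => (Function.update a x 0, a x))
    (fun b _ => Function.update b.1 x b.2) ?_ ?_ ?_ ?_ ?_
  · intro a ha
    simp only [Finset.mem_filter, Finset.mem_univ, true_and] at ha ⊢
    intro i hi
    by_cases hix : i = x
    · simp [hix]
    · simp only [ne_eq, hix, not_false_eq_true, Function.update_of_ne]
      exact ha i fun h => hi (Finset.mem_erase.2 ⟨hix, h⟩)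
  · intro b hb
    simp only [Finset.mem_filter, Finset.mem_univ, true_and] at hb ⊢
    intro i hi
    have hix : i ≠ x := fun h => hi (h ▸ hx)
    simp only [ne_eq, hix, not_false_eq_true, Function.update_of_ne]
    exact hb i fun h => hi (Finset.mem_of_mem_erase h)
  · intro a _
    simp
  · intro b hb
    simp only [Finset.mem_filter, Finset.mem_univ, true_and] at hb
    have : b.1 x = 0 := hb x (Finset.notMem_erase x s)
    ext1
    · simp [← this]
    · simp
  · intro a _
    simp

end Restrict

section LinearFibers

variable {F : Type*} [Field F] [Fintype F]

lemma sum_ind_linear (u v : F) :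
    ∑ t : F, ind (u * t + v = 0) = 1 - ind (u = 0) + Nat.card F * ind (u = 0 ∧ v = 0) := by
  classical
  by_cases hu : u = 0
  · by_cases hv : v = 0 <;> simp [hu, hv, ind]
  · have : ∀ t, u * t + v = 0 ↔ t = -v / u := by
      intro t
      rw [eq_div_iff hu, ← sub_eq_zero]
      constructor <;> intro h <;> linear_combination h
    simp [ind, hu, this]

lemma sum_ind_linear_pair (u v w z : F) :
    ∑ t : F, ind (u * t + v = 0 ∧ w * t + z = 0)
      = ind (u * z - v * w = 0) - ind (u = 0 ∧ w = 0)
        + Nat.card F * ind (u = 0 ∧ v = 0 ∧ w = 0 ∧ z = 0) := by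
  classical
  by_cases hu : u = 0
  · subst hu
    by_cases hw : w = 0
    · subst hw
      by_cases hv : v = 0 <;> by_cases hz : z = 0 <;> simp [hv, hz, ind]
    · have : ∀ t, w * t + z = 0 ↔ t = -z / w := by
        intro t
        rw [eq_div_iff hw, ← sub_eq_zero]
        constructor <;> intro h <;> linear_combination h
      by_cases hv : v = 0 <;> simp [ind, hw, hv, this]
  · have h1 : ∀ t, (u * t + v = 0 ∧ w * t + z = 0) ↔ (t = -v / u ∧ u * z - v * w = 0) := by
      intro t
      rw [eq_div_iff hu]
      constructor
      · rintro ⟨h1, h2⟩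
        exact ⟨by linear_combination h1, by linear_combination u * h2 - w * h1⟩
      · rintro ⟨h1, h2⟩
        refine ⟨by linear_combination h1, ?_⟩
        have : u * (w * t + z) = 0 := by linear_combination w * h1 + h2
        exact (mul_eq_zero.1 this).resolve_left hu
    by_cases hR : u * z - v * w = 0
    · simp [h1, hR, ind, hu]
    · simp [h1, hR, ind, hu]

end LinearFibers

namespace PolyEntry

variable {σ : Type} {F : Type*} [Field F]

/-- The point `a` is a zero of all entries. -/
def Vanishes (a : σ → F) : PolyEntry σ → Prop
  | single f => aeval a f = 0
  | pair f g => aeval a f = 0 ∧ aeval a g = 0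

end PolyEntry

/-- The number of zeros of `D` over `F` in the variables `s`. -/
noncomputable def pointsOver {σ : Type} (F : Type*) [Field F] (s : Finset σ)
    (D : PolyEntry σ) : ℤ :=
  count fun a : σ → F => SupportedOn s a ∧ D.Vanishes a

lemma aeval_update_of_notMem_vars {σ F : Type*} [DecidableEq σ] [Field F] {x : σ}
    {f : MvPolynomial σ ℤ} (hx : x ∉ f.vars) (a : σ → F) (t : F) :
    aeval (Function.update a x t) f = aeval a f := by
  rw [aeval_def, aeval_def]
  refine eval₂Hom_congr' rfl (fun i hi _ => ?_) rfl
  rw [Function.update_of_ne]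
  rintro rfl
  exact hx hi

lemma aeval_setZero {σ : Type} {F : Type*} [DecidableEq σ] [Field F] {x : σ}
    (f : MvPolynomial σ ℤ) {a : σ → F} (ha : a x = 0) : aeval a (setZero x f) = aeval a f := by
  rw [setZero, comp_aeval_apply]
  congr 2
  funext i
  by_cases h : i = x
  · simp [h, ha]
  · simp [h]

lemma LinearIn.aeval_update {σ : Type} {F : Type*} [DecidableEq σ] [Field F] {x : σ}
    {f f1 f0 : MvPolynomial σ ℤ} (h : LinearIn x f f1 f0) (a : σ → F) (t : F) :
    aeval (Function.update a x t) f = aeval a f1 * t + aeval a f0 := by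
  rw [h.1, map_add, map_mul, aeval_update_of_notMem_vars h.2.1, aeval_update_of_notMem_vars h.2.2,
    aeval_X, Function.update_self]

lemma SemilinearTree.nonempty {σ : Type} [DecidableEq σ] {s : Finset σ} {D : PolyEntry σ}
    (T : SemilinearTree s D) : s.Nonempty := by
  induction T with
  | linear x => exact Finset.singleton_nonempty x
  | negative s D hD =>
    rw [← Finset.card_pos]
    simp only [PolyEntry.delta] at hD
    omega
  | swap _ _ _ _ ih => exact ih
  | restrict _ x hx => exact ⟨x, hx⟩
  | single _ x hx => exact ⟨x, hx⟩
  | square _ _ _ _ _ _ _ _ _ _ ih => exact ih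
  | pair _ x hx => exact ⟨x, hx⟩
  | factor _ _ _ _ _ _ _ _ _ _ ih => exact ih

lemma intCast_ne_zero_of_notMem_primeFactors {F : Type*} [Field F] [Finite F] {m : ℤ} (hm : m ≠ 0)
    (h : ringChar F ∉ m.natAbs.primeFactors) : (m : F) ≠ 0 := by
  intro h0
  apply h
  have hp : (ringChar F).Prime := CharP.char_is_prime F _
  refine Nat.mem_primeFactors.2 ⟨hp, ?_, Int.natAbs_ne_zero.2 hm⟩
  exact Int.natCast_dvd.1 ((CharP.intCast_eq_zero_iff F (ringChar F) m).1 h0)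

/-- Every rule replaces the number of zeros modulo `q` as its value prescribes. Only the leaves of
negative `δ` are not elementary: these are covered by Ax's theorem. -/
theorem SemilinearTree.card_dvd_pointsOver_sub_value {σ : Type} [Fintype σ] [DecidableEq σ]
    {s : Finset σ} {D : PolyEntry σ} (T : SemilinearTree s D) {F : Type*} [Field F] [Finite F]
    (hF : ringChar F ∉ T.badPrimes) : (Nat.card F : ℤ) ∣ pointsOver F s D - T.value := by
  have := Fintype.ofFinite F
  induction T with
  | linear x m hm f hf =>
    simp only [badPrimes, value] at hF ⊢
    have hm0 := intCast_ne_zero_of_notMem_primeFactors hm hF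
    have : pointsOver F {x} (.single f) = 1 := by
      refine count_unique 0 fun a => ?_
      simp only [PolyEntry.Vanishes, hf, map_mul, aeval_X, eq_intCast, map_intCast, mul_eq_zero,
        hm0, false_or]
      constructor
      · rintro ⟨h1, h2⟩
        funext i
        by_cases hi : i = x
        · rw [hi, h2]; rfl
        · exact h1 i (by simpa using hi)
      · rintro rfl
        exact ⟨fun _ _ => rfl, rfl⟩
    rw [this, sub_self]
    exact dvd_zero _
  | negative s D hD =>
    simp only [value, sub_zero]
    cases D with
    | single f =>
      simp only [PolyEntry.delta, PolyEntry.degTot] at hD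
      exact card_dvd_count_zeros_supportedOn (by omega)
    | pair f g =>
      simp only [PolyEntry.delta, PolyEntry.degTot] at hD
      have h1 : f.totalDegree < s.card := by omega
      have h2 : g.totalDegree < s.card := by omega
      have h3 : (f * g).totalDegree < s.card := (totalDegree_mul f g).trans_lt (by omega)
      have h := count_and_zeros_and (F := F) (SupportedOn s) (fun a => aeval a f)
        (fun a => aeval a g)
      simp only [← map_mul] at h
      refine (congrArg _ h).mpr ?_
      exact dvd_sub (dvd_add (card_dvd_count_zeros_supportedOn h1)
        (card_dvd_count_zeros_supportedOn h2)) (card_dvd_count_zeros_supportedOn h3)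
  | swap s f g T ih =>
    simp only [badPrimes, value] at hF ⊢
    have : pointsOver F s (.pair g f) = pointsOver F s (.pair f g) :=
      count_congr fun a => by simp only [PolyEntry.Vanishes, and_comm]
    rw [this]
    exact ih hF
  | restrict s x hx m hm f g hg T ih =>
    simp only [badPrimes, value, Finset.mem_union, not_or] at hF ⊢
    have hm0 := intCast_ne_zero_of_notMem_primeFactors hm hF.1
    have : pointsOver F s (.pair f g) = pointsOver F (s.erase x) (.single (C m * setZero x f)) := by
      refine count_congr fun a => ?_
      simp only [PolyEntry.Vanishes, hg, map_mul, aeval_X, eq_intCast, map_intCast, mul_eq_zero,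
        hm0, false_or]
      constructor
      · rintro ⟨h1, h2, h3⟩
        refine ⟨fun i hi => ?_, by rw [aeval_setZero f h3, h2]⟩
        by_cases hix : i = x
        · rw [hix, h3]
        · exact h1 i fun h => hi (Finset.mem_erase.2 ⟨hix, h⟩)
      · rintro ⟨h1, h2⟩
        have h3 : a x = 0 := h1 x (Finset.notMem_erase x s)
        exact ⟨fun i hi => h1 i fun h => hi (Finset.mem_of_mem_erase h),
          by rwa [aeval_setZero f h3] at h2, h3⟩
    rw [this]
    exact ih hF.2
  | single s x hx f f1 f0 hf hd T ih =>
    simp only [badPrimes, value] at hF ⊢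
    have h1 : pointsOver F s (.single f)
        = count (fun a : σ → F => SupportedOn (s.erase x) a)
          - pointsOver F (s.erase x) (.single f1)
          + Nat.card F * ∑ a : σ → F, ind (SupportedOn (s.erase x) a) *
              ind (aeval a f1 = 0 ∧ aeval a f0 = 0) := by
      rw [pointsOver, count_supportedOn_erase hx]
      simp only [PolyEntry.Vanishes, hf.aeval_update, sum_ind_linear]
      rw [pointsOver, count_eq_sum, count_eq_sum, ← Finset.sum_sub_distrib, Finset.mul_sum,
        ← Finset.sum_add_distrib]
      refine Finset.sum_congr rfl fun a _ => ?_
      by_cases h1 : SupportedOn (s.erase x) a <;> by_cases h2 : aeval a f1 = 0 <;>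
        simp [ind, h1, h2, PolyEntry.Vanishes]
    obtain ⟨u, hu⟩ := card_dvd_count_supportedOn (F := F) T.nonempty
    obtain ⟨w, hw⟩ := ih hF
    rw [h1]
    exact ⟨u - w + ∑ a : σ → F, ind (SupportedOn (s.erase x) a) *
      ind (aeval a f1 = 0 ∧ aeval a f0 = 0), by linear_combination hu - hw⟩
  | square s h f g hh hfg hs hf hd T ih =>
    simp only [badPrimes, value] at hF ⊢
    have : pointsOver F s (.single h) = pointsOver F s (.single (f * g)) :=
      count_congr fun a => by simp [PolyEntry.Vanishes, hh]
    rw [this]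
    exact ih hF
  | pair s x hx hs f f1 f0 g g1 g0 hf hg hd T₁ T₂ ih₁ ih₂ =>
    simp only [badPrimes, value, Finset.mem_union, not_or] at hF ⊢
    have h1 : pointsOver F s (.pair f g)
        = pointsOver F (s.erase x) (.single (f1 * g0 - f0 * g1))
          - pointsOver F (s.erase x) (.pair f1 g1)
          + Nat.card F * ∑ a : σ → F, ind (SupportedOn (s.erase x) a) *
              ind (aeval a f1 = 0 ∧ aeval a f0 = 0 ∧ aeval a g1 = 0 ∧ aeval a g0 = 0) := by
      rw [pointsOver, count_supportedOn_erase hx]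
      simp only [PolyEntry.Vanishes, hf.aeval_update, hg.aeval_update, sum_ind_linear_pair]
      rw [pointsOver, pointsOver, count_eq_sum, count_eq_sum, ← Finset.sum_sub_distrib,
        Finset.mul_sum, ← Finset.sum_add_distrib]
      refine Finset.sum_congr rfl fun a _ => ?_
      by_cases h1 : SupportedOn (s.erase x) a
      · simp only [h1, ind_of trivial, true_and, PolyEntry.Vanishes, map_sub, map_mul]
        ring
      · simp [ind, h1]
    obtain ⟨u, hu⟩ := ih₁ hF.1
    obtain ⟨w, hw⟩ := ih₂ hF.2
    rw [h1]
    exact ⟨w - u + ∑ a : σ → F, ind (SupportedOn (s.erase x) a) *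
      ind (aeval a f1 = 0 ∧ aeval a f0 = 0 ∧ aeval a g1 = 0 ∧ aeval a g0 = 0),
      by linear_combination hw - hu⟩
  | factor s h f g hh hfg hs T₁ T₂ T₃ ih₁ ih₂ ih₃ =>
    simp only [badPrimes, value, Finset.mem_union, not_or] at hF ⊢
    have h1 := count_and_zeros_and (F := F) (SupportedOn s) (fun a => aeval a f)
        (fun a => aeval a g)
    simp only [← map_mul, ← hh] at h1
    have h2 : pointsOver F s (.pair f g) = pointsOver F s (.single f) + pointsOver F s (.single g)
      - pointsOver F s (.single h) := h1
    obtain ⟨u, hu⟩ := ih₁ hF.1.1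
    obtain ⟨w, hw⟩ := ih₂ hF.1.2
    obtain ⟨z, hz⟩ := ih₃ hF.2
    exact ⟨u + w - z, by linear_combination hu + hw - hz + h2⟩

/-- The value of a reduction of a pair is bounded by the ranks of Hasse-Witt matrices. -/
theorem SemilinearTree.abs_value_lt {σ : Type} [Fintype σ] [DecidableEq σ] {s : Finset σ}
    {f g : MvPolynomial σ ℤ} (T : SemilinearTree s (.pair f g)) :
    |T.value| < 2 ^ (f.totalDegree + g.totalDegree) := by
  set B := 2 ^ (f.totalDegree + g.totalDegree) with hB
  obtain ⟨p, hpB, hp⟩ := Nat.exists_infinite_primes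
    (T.value.natAbs + 2 ^ (f.totalDegree + g.totalDegree) + T.badPrimes.sup id + 1)
  have := Fact.mk hp
  have := T.nonempty.to_subtype
  obtain ⟨F, _, _, hchar, c, hc, hdvd⟩ :=
    exists_field_count_modEq_le (restrictVars s f) (restrictVars s g) p
  have hringChar : ringChar F = p := ringChar.eq_iff.2 hchar
  have hbad : ringChar F ∉ T.badPrimes := by
    rw [hringChar]
    intro h
    exact absurd (Finset.le_sup (f := id) h)
      (Nat.not_le.2 (Nat.lt_of_lt_of_le (Nat.lt_succ_of_le (Nat.le_add_left _ _)) hpB))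
  have h1 := T.card_dvd_pointsOver_sub_value hbad
  have hpF : (p : ℤ) ∣ Nat.card F := by
    have := Fintype.ofFinite F
    obtain ⟨n, -, hn⟩ := FiniteField.card F p
    rw [Nat.card_eq_fintype_card, hn]
    push_cast
    exact dvd_pow_self _ n.pos.ne'
  have h2 : pointsOver F s (.pair f g) = count (fun a : s → F =>
      aeval a (restrictVars s f) = 0 ∧ aeval a (restrictVars s g) = 0) := by
    simp only [aeval_restrictVars]
    exact count_supportedOn s _
  rw [← h2] at hdvd
  have h3 : (p : ℤ) ∣ T.value - c := by
    obtain ⟨u, hu⟩ := hdvd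
    obtain ⟨w, hw⟩ := hpF.trans h1
    exact ⟨u - w, by linear_combination hu - hw⟩
  have hcB : |c| < B := hc.trans_le (pow_le_pow_right₀ (by norm_num)
    (Nat.add_le_add (totalDegree_restrictVars_le _ _) (totalDegree_restrictVars_le _ _)))
  have h4 : T.value - c = 0 := by
    refine Int.eq_zero_of_abs_lt_dvd h3 ?_
    have h5 := abs_sub T.value c
    have h6 : ((T.value.natAbs + 2 ^ (f.totalDegree + g.totalDegree) + T.badPrimes.sup id + 1 : ℕ)
      : ℤ) ≤ p := by exact_mod_cast hpB
    push_cast [Int.natCast_natAbs] at h6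
    have h7 : (0 : ℤ) ≤ ((T.badPrimes.sup id : ℕ) : ℤ) := Int.natCast_nonneg _
    linarith
  rw [sub_eq_zero.1 h4]
  exact hcB

/-! ### Determinants of bordered matrices -/

section Bordered

variable {F : Type*} [Field F] {ι m : Type*} [Fintype ι] [DecidableEq ι] [Fintype m]
  [DecidableEq m]

/-- The matrix `D` bordered by the rows of `X` and, as columns, by the rows of `Y`, with `A` in the
corner. -/
def bordered {ι m F : Type*} (A : Matrix ι ι F) (X Y : Matrix ι m F) (D : Matrix m m F) :
    Matrix (ι ⊕ m) (ι ⊕ m) F :=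
  Matrix.fromBlocks A X Y.transpose D

/-- The determinant of `D` bordered by one row `r` and one column `s`; up to sign this is the
bilinear form of the adjugate of `D`. -/
noncomputable def borderedForm (D : Matrix m m F) (r s : m → F) : F :=
  (bordered (0 : Matrix Unit Unit F) (Matrix.of fun _ => r) (Matrix.of fun _ => s) D).det

lemma det_bordered_reindex {ι' m' : Type*} [Fintype ι'] [DecidableEq ι'] [Fintype m']
    [DecidableEq m'] (e : ι' ≃ ι) (e' : m' ≃ m) (A : Matrix ι ι F) (X Y : Matrix ι m F)
    (D : Matrix m m F) :
    (bordered (A.submatrix e e) (X.submatrix e e') (Y.submatrix e e') (D.submatrix e' e')).det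
      = (bordered A X Y D).det := by
  rw [← Matrix.det_submatrix_equiv_self (Equiv.sumCongr e e') (bordered A X Y D)]
  congr 1
  ext (i | i) (j | j) <;> rfl

lemma Matrix.det_piecewise_diagonal (M : Matrix ι ι F) (d : ι → F) (T : Finset ι) :
    (Matrix.of (T.piecewise M (Matrix.diagonal d))).det
      = (∏ i ∈ Tᶜ, d i) * (M.submatrix (fun i : T => i.1) (fun i : T => i.1)).det := by
  have hA : Matrix.toSquareBlockProp (Matrix.of (T.piecewise M (Matrix.diagonal d)))
      (fun i => i ∈ T) = M.submatrix (fun i : T => i.1) (fun i : T => i.1) := by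
    ext i j
    exact congrFun (Finset.piecewise_eq_of_mem T M _ i.2) j.1
  have hB : Matrix.toSquareBlockProp (Matrix.of (T.piecewise M (Matrix.diagonal d)))
      (fun i => ¬ i ∈ T) = Matrix.diagonal fun i => d i.1 := by
    ext i j
    refine (congrFun (Finset.piecewise_eq_of_notMem T M _ i.2) j.1).trans ?_
    simp [Matrix.diagonal_apply, Subtype.ext_iff]
  have hz : ∀ i, ¬ i ∈ T → ∀ j, j ∈ T →
      (Matrix.of (T.piecewise M (Matrix.diagonal d))) i j = 0 := by
    intro i hi j hj
    refine (congrFun (Finset.piecewise_eq_of_notMem T M _ hi) j).trans ?_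
    exact Matrix.diagonal_apply_ne _ fun h => hi (h ▸ hj)
  have h := Matrix.twoBlockTriangular_det _ (fun i => i ∈ T) hz
  rw [h, hA, hB, Matrix.det_diagonal, mul_comm]
  congr 1
  · exact (Finset.prod_subtype Tᶜ (by simp) d).symm
  · congr!

/-- Expansion of a determinant in the entries added to its diagonal. -/
lemma Matrix.det_add_diagonal (M : Matrix ι ι F) (d : ι → F) :
    (M + Matrix.diagonal d).det = ∑ T : Finset ι,
      (∏ i ∈ Tᶜ, d i) * (M.submatrix (fun i : T => i.1) (fun i : T => i.1)).det := by
  have h := (Matrix.detRowAlternating (n := ι) (R := F)).toMultilinearMap.map_add_univ M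
    (Matrix.diagonal d)
  refine h.trans (Finset.sum_congr rfl fun T _ => ?_)
  exact Matrix.det_piecewise_diagonal M d T

/-- Expansion of a bordered determinant in the entries of a diagonal upper left block. -/
lemma det_bordered_diagonal (d : ι → F) (X Y : Matrix ι m F) (D : Matrix m m F) :
    (bordered (Matrix.diagonal d) X Y D).det = ∑ T : Finset ι, (∏ i ∈ Tᶜ, d i) *
      (bordered (0 : Matrix T T F) (X.submatrix (fun i : T => i.1) id)
        (Y.submatrix (fun i : T => i.1) id) D).det := by
  have h1 : bordered (Matrix.diagonal d) X Y D
      = bordered 0 X Y D + Matrix.diagonal (Sum.elim d 0) := by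
    ext (i | i) (j | j) <;> simp [bordered, Matrix.diagonal_apply]
  rw [h1, Matrix.det_add_diagonal]
  have h2 : ∀ S : Finset (ι ⊕ m), S ∉ Finset.univ.image
      (fun T : Finset ι => T.disjSum (Finset.univ : Finset m)) →
      (∏ i ∈ Sᶜ, Sum.elim d 0 i) * ((bordered 0 X Y D).submatrix
        (fun i : S => i.1) (fun i : S => i.1)).det = 0 := by
    intro S hS
    have : ∃ x : m, Sum.inr x ∉ S := by
      by_contra hcon
      push Not at hcon
      refine hS (Finset.mem_image.2 ⟨S.toLeft, Finset.mem_univ _, ?_⟩)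
      ext (i | i) <;> simp [hcon]
    obtain ⟨x, hx⟩ := this
    rw [Finset.prod_eq_zero (i := Sum.inr x) (by simpa using hx) rfl, zero_mul]
  rw [← Finset.sum_subset (Finset.subset_univ _) (fun S _ hS => h2 S hS), Finset.sum_image]
  · refine Finset.sum_congr rfl fun T _ => ?_
    congr 1
    · have : (T.disjSum (Finset.univ : Finset m))ᶜ = Tᶜ.map Function.Embedding.inl := by
        ext (i | i) <;> simp
      rw [this, Finset.prod_map]
      rfl
    · let e : T ⊕ m ≃ (T.disjSum (Finset.univ : Finset m) : Finset (ι ⊕ m)) :=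
        { toFun := Sum.elim (fun i => ⟨Sum.inl i.1, by simp⟩) (fun j => ⟨Sum.inr j, by simp⟩)
          invFun := fun s => match s with
            | ⟨Sum.inl i, h⟩ => Sum.inl ⟨i, by simpa using h⟩
            | ⟨Sum.inr j, _⟩ => Sum.inr j
          left_inv := by rintro (i | j) <;> rfl
          right_inv := by rintro ⟨i | j, h⟩ <;> rfl }
      rw [← Matrix.det_submatrix_equiv_self e]
      congr 1
      ext (i | i) (j | j) <;> rfl
  · intro S _ T _ h
    simpa using congrArg Finset.toLeft h

/-- A bordered matrix with fewer border rows than independent kernel vectors of `D` is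
singular. -/
lemma det_bordered_eq_zero {n : ℕ} (A : Matrix ι ι F) (X Y : Matrix ι m F) {D : Matrix m m F}
    (w : Fin n → m → F) (hw : LinearIndependent F w) (hD : ∀ i, D.mulVec (w i) = 0)
    (hn : Fintype.card ι < n) : (bordered A X Y D).det = 0 := by
  let φ : (Fin n → F) →ₗ[F] (m → F) := Fintype.linearCombination F w
  let ψ : (Fin n → F) →ₗ[F] (ι → F) := X.mulVecLin.comp φ
  have hker : LinearMap.ker ψ ≠ ⊥ := LinearMap.ker_ne_bot_of_finrank_lt (by simpa using hn)
  obtain ⟨c, hc, hc0⟩ := (Submodule.ne_bot_iff _).1 hker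
  have hφ : φ c ≠ 0 := by
    intro h
    apply hc0
    have := (Fintype.linearIndependent_iff.1 hw) c (by simpa [φ, Fintype.linearCombination_apply]
      using h)
    exact funext this
  have hDφ : D.mulVec (φ c) = 0 := by
    simp only [φ, Fintype.linearCombination_apply, Matrix.mulVec_sum, Matrix.mulVec_smul, hD,
      smul_zero, Finset.sum_const_zero]
  refine Matrix.exists_mulVec_eq_zero_iff.1 ⟨Sum.elim 0 (φ c), ?_, ?_⟩
  · intro h
    exact hφ (funext fun i => congrFun h (Sum.inr i))
  · rw [bordered, Matrix.fromBlocks_mulVec]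
    have : X.mulVec (φ c) = 0 := hc
    have h0 : (Sum.elim (0 : ι → F) (φ c)) ∘ Sum.inl = 0 := rfl
    have h1 : (Sum.elim (0 : ι → F) (φ c)) ∘ Sum.inr = φ c := rfl
    rw [h0, h1, this, hDφ, Matrix.mulVec_zero, Matrix.mulVec_zero, add_zero, add_zero]
    exact Sum.elim_zero_zero

/-- Schur's formula for a bordered invertible matrix. -/
lemma det_bordered_of_det_ne_zero (A : Matrix ι ι F) (X Y : Matrix ι m F) {D : Matrix m m F}
    (hD : D.det ≠ 0) :
    (bordered A X Y D).det = D.det * (A - X * D⁻¹ * Y.transpose).det := by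
  have : Invertible D := D.invertibleOfIsUnitDet (isUnit_iff_ne_zero.2 hD)
  rw [bordered, Matrix.det_fromBlocks₂₂, Matrix.invOf_eq_nonsing_inv]

lemma borderedForm_of_det_ne_zero {D : Matrix m m F} (hD : D.det ≠ 0) (r s : m → F) :
    borderedForm D r s = -(D.det * (r ⬝ᵥ D⁻¹.mulVec s)) := by
  rw [borderedForm, det_bordered_of_det_ne_zero _ _ _ hD, Matrix.det_unique (n := Unit)]
  simp only [Matrix.sub_apply, Matrix.zero_apply, zero_sub, mul_neg]
  rw [Matrix.mul_assoc, Matrix.mul_apply]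
  simp only [Matrix.mul_apply, dotProduct, Matrix.mulVec, Matrix.transpose_apply, Matrix.of_apply]

/-- The normal form of the border of a matrix `D` of corank one: up to the factor `κ` and a
correction `Γ` of the upper left block, only the products with a kernel vector `z` matter. The
border is indexed by an arbitrary finite type in `Type`. -/
structure CorankOne (D : Matrix m m F) (κ : F) (z : m → F) (Γ : Matrix m m F) : Prop where
  ne_zero : κ ≠ 0
  transpose_eq : Γ.transpose = Γ
  det_bordered : ∀ (ι : Type) [Fintype ι] [DecidableEq ι] (A : Matrix ι ι F) (X Y : Matrix ι m F),
    (bordered A X Y D).det = κ * (bordered (A - X * Γ * Y.transpose)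
      (Matrix.of fun i (_ : Unit) => X.mulVec z i) (Matrix.of fun i (_ : Unit) => Y.mulVec z i)
      0).det

end Bordered

section Trichotomy

variable {F : Type*} [Field F] {m : Type*} [Fintype m] [DecidableEq m]

lemma CorankOne.of_submatrix {m' : Type*} [Fintype m'] [DecidableEq m'] (e : m' ≃ m)
    {D : Matrix m m F} {κ : F} {z : m' → F} {Γ : Matrix m' m' F}
    (h : CorankOne (D.submatrix e e) κ z Γ) :
    CorankOne D κ (z ∘ e.symm) (Γ.submatrix e.symm e.symm) := by
  refine ⟨h.ne_zero, ?_, fun ι _ _ A X Y => ?_⟩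
  · rw [Matrix.transpose_submatrix, h.transpose_eq]
  · have h1 := h.det_bordered ι A (X.submatrix id e) (Y.submatrix id e)
    have h2 := det_bordered_reindex (Equiv.refl ι) e A X Y D
    have hz : ∀ Z : Matrix ι m F,
        (Z.submatrix id e).mulVec z = Z.mulVec (z ∘ e.symm) := fun Z => by
      rw [Matrix.submatrix_mulVec_equiv]; rfl
    have hΓ : X.submatrix id e * Γ * (Y.submatrix id e).transpose
        = X * Γ.submatrix e.symm e.symm * Y.transpose := by
      have : Γ = (Γ.submatrix e.symm e.symm).submatrix e e := by
        ext i j; simp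
      rw [this, Matrix.submatrix_mul_equiv, Matrix.transpose_submatrix,
        Matrix.submatrix_mul_equiv]
      simp
    rw [hz, hz, hΓ] at h1
    exact h2.symm.trans h1

/-- A singular symmetric matrix with an invertible principal minor of codimension one. -/
lemma corankOne_of_minor {p : Type*} [Fintype p] [DecidableEq p] (d : F) (c : p → F)
    {D : Matrix p p F} (hsymm : D.transpose = D) (hD : D.det ≠ 0)
    (h0 : (bordered (Matrix.of fun _ _ : Unit => d) (Matrix.of fun _ => c)
      (Matrix.of fun _ => c) D).det = 0) :
    CorankOne (bordered (Matrix.of fun _ _ : Unit => d) (Matrix.of fun _ => c)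
      (Matrix.of fun _ => c) D) D.det (Sum.elim (fun _ => 1) (-(D⁻¹.mulVec c)))
      (Matrix.fromBlocks 0 0 0 D⁻¹) := by
  have hinv : D⁻¹.transpose = D⁻¹ := by rw [Matrix.transpose_nonsing_inv, hsymm]
  have hcorner : d - c ⬝ᵥ D⁻¹.mulVec c = 0 := by
    rw [det_bordered_of_det_ne_zero _ _ _ hD, Matrix.det_unique (n := Unit)] at h0
    have := (mul_eq_zero.1 h0).resolve_left hD
    rw [Matrix.mul_assoc] at this
    simpa [Matrix.mul_apply, dotProduct, Matrix.mulVec] using this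
  refine ⟨hD, ?_, fun ι _ _ A X Y => ?_⟩
  · rw [Matrix.fromBlocks_transpose, hinv]; simp
  · have h1 := Matrix.det_submatrix_equiv_self (Equiv.sumAssoc ι Unit p)
      (bordered A X Y (bordered (Matrix.of fun _ _ : Unit => d) (Matrix.of fun _ => c)
        (Matrix.of fun _ => c) D))
    have h2 : (bordered A X Y (bordered (Matrix.of fun _ _ : Unit => d) (Matrix.of fun _ => c)
        (Matrix.of fun _ => c) D)).submatrix (Equiv.sumAssoc ι Unit p)
          (Equiv.sumAssoc ι Unit p)
        = bordered (bordered A (X.submatrix id Sum.inl) (Y.submatrix id Sum.inl)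
            (Matrix.of fun _ _ => d))
          (Matrix.of (Sum.elim (fun i j => X i (Sum.inr j)) fun _ => c))
          (Matrix.of (Sum.elim (fun i j => Y i (Sum.inr j)) fun _ => c)) D := by
      ext ((i | i) | i) ((j | j) | j) <;> rfl
    rw [← h1, h2, det_bordered_of_det_ne_zero _ _ _ hD]
    congr 2
    have hsum : ∀ u : p → F, ∑ x, (∑ y, c y * D⁻¹ y x) * u x
        = ∑ x, u x * D⁻¹.mulVec c x := by
      intro u
      refine Finset.sum_congr rfl fun x _ => ?_
      rw [mul_comm, Matrix.mulVec, dotProduct]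
      congr 1
      refine Finset.sum_congr rfl fun y _ => ?_
      rw [mul_comm, ← congrFun (congrFun hinv x) y]
      rfl
    have hsum' : ∀ u : p → F, ∑ x, (∑ y, u y * D⁻¹ y x) * c x
        = ∑ x, u x * D⁻¹.mulVec c x := by
      intro u
      simp only [Matrix.mulVec, dotProduct, Finset.mul_sum, Finset.sum_mul, mul_assoc]
      exact Finset.sum_comm
    ext (i | i) (j | j)
    · simp [bordered, Matrix.mul_apply, Matrix.fromBlocks]
    · simp [bordered, Matrix.mul_apply, Matrix.fromBlocks, Matrix.mulVec, dotProduct]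
      have := hsum' fun x => X i (Sum.inr x)
      simp [Matrix.mulVec, dotProduct] at this
      rw [this]; ring
    · simp [bordered, Matrix.mul_apply, Matrix.fromBlocks, Matrix.mulVec, dotProduct]
      have := hsum fun x => Y j (Sum.inr x)
      simp [Matrix.mulVec, dotProduct] at this
      rw [this]; ring
    · have := hsum' c
      simp only [bordered, Matrix.mul_apply, Matrix.sub_apply, Matrix.fromBlocks_apply₂₂,
        Matrix.of_apply, Sum.elim_inr, Matrix.transpose_apply, Matrix.zero_apply]
      rw [this]
      exact hcorner

/-- A symmetric matrix is invertible, or has corank one in normal form, or has two independent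
kernel vectors. -/
lemma symmetric_trichotomy {D : Matrix m m F} (hsymm : D.transpose = D) :
    D.det ≠ 0 ∨ (D.det = 0 ∧ ∃ κ z Γ, CorankOne D κ z Γ) ∨
      (D.det = 0 ∧ ∃ w : Fin 2 → m → F, LinearIndependent F w ∧ ∀ i, D.mulVec (w i) = 0) := by
  by_cases hD : D.det = 0
  swap
  · exact Or.inl hD
  obtain ⟨z, hz, hDz⟩ := Matrix.exists_mulVec_eq_zero_iff.2 hD
  obtain ⟨i₀, hi₀⟩ := Function.ne_iff.1 hz
  right
  let e : Unit ⊕ {i // i ≠ i₀} ≃ m :=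
    (Equiv.sumCongr (Equiv.ofUnique Unit {i // i = i₀}) (Equiv.refl _)).trans
      (Equiv.sumCompl fun i => i = i₀)
  have el : ∀ u, e (Sum.inl u) = i₀ := fun u => rfl
  have er : ∀ i, e (Sum.inr i) = i.1 := fun i => rfl
  set D' : Matrix {i // i ≠ i₀} {i // i ≠ i₀} F := D.submatrix (fun i => i.1) fun i => i.1 with hD'
  have hsymm' : D'.transpose = D' := by rw [hD', Matrix.transpose_submatrix, hsymm]
  have hDe : D.submatrix e e = bordered (Matrix.of fun _ _ : Unit => D i₀ i₀)
      (Matrix.of fun _ j => D i₀ j.1) (Matrix.of fun _ j => D i₀ j.1) D' := by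
    ext (i | i) (j | j)
    · rfl
    · rfl
    · exact congrFun (congrFun hsymm i₀) i.1
    · rfl
  by_cases hdet : D'.det = 0
  · right
    refine ⟨hD, ?_⟩
    obtain ⟨y, hy, hDy⟩ := Matrix.exists_mulVec_eq_zero_iff.2 hdet
    let y' : m → F := fun i => if h : i = i₀ then 0 else y ⟨i, h⟩
    have hy' : ∀ i : {i // i ≠ i₀}, y' i.1 = y i := fun i => by simp [y', i.2]
    have hy0 : y' i₀ = 0 := by simp [y']
    have hsplit : ∀ u : m → F, ∑ i, u i * y' i = ∑ i : {i // i ≠ i₀}, u i.1 * y i := by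
      intro u
      rw [← e.sum_comp, Fintype.sum_sum_type]
      simp [el, er, hy0, hy']
    have hne : ∀ i, i ≠ i₀ → D.mulVec y' i = 0 := by
      intro i hi
      have := congrFun hDy ⟨i, hi⟩
      rw [Matrix.mulVec, dotProduct, hsplit]
      exact this
    -- the remaining entry of `D y'` vanishes because `z` is a kernel vector with `z i₀ ≠ 0`
    have h0 : z i₀ * D.mulVec y' i₀ = 0 := by
      have h1 : z ⬝ᵥ D.mulVec y' = 0 := by
        rw [Matrix.dotProduct_mulVec, ← Matrix.mulVec_transpose, hsymm, hDz, zero_dotProduct]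
      rw [dotProduct, Finset.sum_eq_single i₀ (fun i _ hi => by rw [hne i hi, mul_zero])
        (by simp)] at h1
      exact h1
    have hDy' : D.mulVec y' = 0 := by
      funext i
      by_cases hi : i = i₀
      · rw [hi]; exact (mul_eq_zero.1 h0).resolve_left hi₀
      · exact hne i hi
    refine ⟨![z, y'], LinearIndependent.pair_iff.2 ?_, fun i => ?_⟩
    · intro s t hst
      have hs : s = 0 := by
        have := congrFun hst i₀
        simp only [Pi.add_apply, Pi.smul_apply, smul_eq_mul, hy0, mul_zero, add_zero,
          Pi.zero_apply] at this
        exact (mul_eq_zero.1 this).resolve_right hi₀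
      refine ⟨hs, ?_⟩
      rw [hs, zero_smul, zero_add] at hst
      by_contra ht
      apply hy
      funext i
      have := congrFun hst i.1
      simp only [Pi.smul_apply, smul_eq_mul, Pi.zero_apply, hy'] at this
      exact (mul_eq_zero.1 this).resolve_left ht
    · fin_cases i
      · exact hDz
      · exact hDy'
  · left
    have h := corankOne_of_minor (D i₀ i₀) (fun j : {i // i ≠ i₀} => D i₀ j.1) hsymm' hdet
      (by rw [← hDe, Matrix.det_submatrix_equiv_self, hD])
    rw [← hDe] at h
    exact ⟨hD, _, _, _, CorankOne.of_submatrix e h⟩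

lemma det_fromBlocks_unit (A B C D : Matrix Unit Unit F) :
    (Matrix.fromBlocks A B C D).det = A () () * D () () - B () () * C () () := by
  let e : Fin 2 ≃ Unit ⊕ Unit := finTwoEquiv.trans Equiv.boolEquivPUnitSumPUnit
  rw [← Matrix.det_submatrix_equiv_self e, Matrix.det_fin_two]
  rfl

lemma CorankOne.borderedForm_eq {D : Matrix m m F} {κ : F} {z : m → F} {Γ : Matrix m m F}
    (h : CorankOne D κ z Γ) (r s : m → F) :
    borderedForm D r s = -(κ * ((r ⬝ᵥ z) * (s ⬝ᵥ z))) := by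
  rw [borderedForm, h.det_bordered Unit, bordered, det_fromBlocks_unit]
  simp [Matrix.mulVec]

lemma borderedForm_eq_zero {D : Matrix m m F} {w : Fin 2 → m → F} (hw : LinearIndependent F w)
    (hD : ∀ i, D.mulVec (w i) = 0) (r s : m → F) : borderedForm D r s = 0 :=
  det_bordered_eq_zero _ _ _ w hw hD (by simp)

end Trichotomy

section Star

variable {F : Type*} [Field F] {m : Type*} [Fintype m] [DecidableEq m]

/-- The matrix of a graph whose edges at a vertex are the rows indexed by `ρ`: the column `Unit`
belongs to the vertex, and `C` is the matrix of the rest of the graph. -/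
def starMatrix {ρ m F : Type*} [Zero F] [One F] (A : Matrix ρ ρ F) (X Y : Matrix ρ m F)
    (C : Matrix m m F) : Matrix (ρ ⊕ (Unit ⊕ m)) (ρ ⊕ (Unit ⊕ m)) F :=
  bordered A (Matrix.of fun i => Sum.elim (fun _ => 1) (X i))
    (Matrix.of fun i => Sum.elim (fun _ => 1) (Y i)) (Matrix.fromBlocks 0 0 0 C)

/-- The differences of the rows of `X` with its first row. -/
def rowDiff {m F : Type*} [Sub F] {k : ℕ} (X : Matrix (Fin (k + 1)) m F) : Matrix (Fin k) m F :=
  Matrix.of fun i j => X i.succ j - X 0 j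

/-- The entries of `A` restricted to vectors with coordinate sum zero, in the basis of the
differences `e_{i+1} - e_0`. -/
def sumZeroPart {F : Type*} [Ring F] {k : ℕ} (A : Matrix (Fin (k + 1)) (Fin (k + 1)) F) :
    Matrix (Fin k) (Fin k) F :=
  Matrix.of fun i j => A i.succ j.succ - A i.succ 0 - A 0 j.succ + A 0 0

/-- Elimination of the vertex column and of one of its edges. -/
lemma det_starMatrix {k : ℕ} (A : Matrix (Fin (k + 1)) (Fin (k + 1)) F)
    (X Y : Matrix (Fin (k + 1)) m F) (C : Matrix m m F) :
    (starMatrix A X Y C).det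
      = -(bordered (sumZeroPart A) (rowDiff X) (rowDiff Y) C).det := by
  let g : (Fin k ⊕ m) ⊕ (Unit ⊕ Unit) → Fin (k + 1) ⊕ (Unit ⊕ m) :=
    Sum.elim (Sum.elim (fun i => Sum.inl i.succ) fun j => Sum.inr (Sum.inr j))
      (Sum.elim (fun _ => Sum.inl 0) fun u => Sum.inr (Sum.inl u))
  have hg : Function.Bijective g := by
    constructor
    · rintro ((i | i) | (i | i)) ((j | j) | (j | j)) h <;> simp_all [g, Fin.succ_ne_zero]
      exact (Fin.succ_ne_zero _ h.symm).elim
    · rintro (i | (i | i))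
      · refine Fin.cases ⟨Sum.inr (Sum.inl ()), rfl⟩ (fun i => ⟨Sum.inl (Sum.inl i), rfl⟩) i
      · exact ⟨Sum.inr (Sum.inr i), rfl⟩
      · exact ⟨Sum.inl (Sum.inr i), rfl⟩
  let e := Equiv.ofBijective g hg
  let P : Matrix (Unit ⊕ Unit) (Unit ⊕ Unit) F :=
    Matrix.fromBlocks (Matrix.of fun _ _ => A 0 0) 1 1 0
  let Q : Matrix (Unit ⊕ Unit) (Unit ⊕ Unit) F :=
    Matrix.fromBlocks 0 1 1 (Matrix.of fun _ _ => -A 0 0)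
  have hPQ : P * Q = 1 := by
    ext (i | i) (j | j) <;> simp [P, Q, Matrix.mul_apply]
  have hP : P.det = -1 := by rw [det_fromBlocks_unit]; simp
  let _ : Invertible P := ⟨Q, mul_eq_one_comm.1 hPQ, hPQ⟩
  have hinv : ⅟P = Q := rfl
  rw [← Matrix.det_submatrix_equiv_self e]
  have hblocks : (starMatrix A X Y C).submatrix e e = Matrix.fromBlocks
      (bordered (Matrix.of fun i j => A i.succ j.succ) (Matrix.of fun i => X i.succ)
        (Matrix.of fun i => Y i.succ) C)
      (Matrix.of (Sum.elim (fun i => Sum.elim (fun _ => A i.succ 0) fun _ => 1)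
        fun j => Sum.elim (fun _ => Y 0 j) fun _ => 0))
      (Matrix.of (Sum.elim (fun _ => Sum.elim (fun i => A 0 i.succ) fun j => X 0 j)
        (fun _ => Sum.elim (fun _ => 1) fun _ => 0))) P := by
    ext ((i | i) | (i | i)) ((j | j) | (j | j)) <;> rfl
  rw [hblocks, Matrix.det_fromBlocks₂₂, hP, hinv, neg_one_mul]
  congr 2
  ext (i | i) (j | j)
  all_goals
    simp [Q, bordered, sumZeroPart, rowDiff, Matrix.mul_apply]
  all_goals ring

lemma det_starMatrix_two (X Y : Matrix (Fin 2) m F) (C : Matrix m m F) :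
    (starMatrix 0 X Y C).det = -borderedForm C (X 1 - X 0) (Y 1 - Y 0) := by
  rw [det_starMatrix, borderedForm, ← det_bordered_reindex (Equiv.ofUnique Unit (Fin 1))
    (Equiv.refl m)]
  congr 2
  ext (i | i) (j | j) <;> simp [bordered, sumZeroPart, rowDiff]

lemma det_starMatrix_one (A : Matrix (Fin 1) (Fin 1) F) (X Y : Matrix (Fin 1) m F)
    (C : Matrix m m F) : (starMatrix A X Y C).det = -C.det := by
  rw [det_starMatrix, bordered]
  have : (rowDiff Y).transpose = 0 := by ext i j; exact j.elim0
  rw [this, Matrix.det_fromBlocks_zero₂₁, Matrix.det_isEmpty, one_mul]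

lemma det_bordered_unit (t : F) (r s : m → F) (D : Matrix m m F) :
    (bordered (Matrix.of fun _ _ : Unit => t) (Matrix.of fun _ => r) (Matrix.of fun _ => s) D).det
      = t * D.det + borderedForm D r s := by
  have h1 : bordered (Matrix.of fun _ _ : Unit => t) (Matrix.of fun _ => r)
      (Matrix.of fun _ => s) D = (bordered (0 : Matrix Unit Unit F) (Matrix.of fun _ => r)
      (Matrix.of fun _ => s) D).updateRow (Sum.inl ())
        (t • Sum.elim (fun _ => 1) (fun _ => 0) + Sum.elim (fun _ => 0) r) := by
    ext (i | i) (j | j) <;> simp [bordered, Matrix.updateRow_apply]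
  have h2 : (bordered (0 : Matrix Unit Unit F) (Matrix.of fun _ => r)
      (Matrix.of fun _ => s) D).updateRow (Sum.inl ()) (Sum.elim (fun _ => 0) r)
      = bordered 0 (Matrix.of fun _ => r) (Matrix.of fun _ => s) D := by
    ext (i | i) (j | j) <;> simp [bordered, Matrix.updateRow_apply]
  have h3 : (bordered (0 : Matrix Unit Unit F) (Matrix.of fun _ => r)
      (Matrix.of fun _ => s) D).updateRow (Sum.inl ()) (Sum.elim (fun _ => 1) fun _ => 0)
      = Matrix.fromBlocks 1 0 (Matrix.of fun _ => s).transpose D := by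
    ext (i | i) (j | j) <;> simp [bordered, Matrix.updateRow_apply]
  rw [h1, Matrix.det_updateRow_add, Matrix.det_updateRow_smul, h2, h3,
    Matrix.det_fromBlocks_zero₁₂, Matrix.det_one, one_mul, borderedForm]

end Star

section Shift

variable {F : Type*} [Field F]

/-- A set on which the additive group of `F` acts freely, freeness being witnessed by an
equivariant map `φ` to `F`, is the product of `F` and of the fibre of `φ` over `0`. -/
lemma count_eq_card_mul_of_shift {X : Type*} (P : X → Prop) (φ : X → F)
    (τ : F → X → X) (hφ : ∀ t x, φ (τ t x) = φ x + t) (hzero : ∀ x, τ 0 x = x)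
    (hadd : ∀ s t x, τ s (τ t x) = τ (s + t) x) (hP : ∀ t x, P x → P (τ t x)) :
    count P = Nat.card F * count fun x => P x ∧ φ x = 0 := by
  let e : {x // P x} ≃ F × {x // P x ∧ φ x = 0} :=
    { toFun := fun x => (φ x.1, ⟨τ (-φ x.1) x.1, hP _ _ x.2, by rw [hφ]; ring⟩)
      invFun := fun y => ⟨τ y.1 y.2.1, hP _ _ y.2.2.1⟩
      left_inv := fun x => by
        ext1
        simp only [hadd]
        rw [add_neg_cancel, hzero]
      right_inv := fun y => by
        obtain ⟨t, x, hx, h0⟩ := y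
        have : φ (τ t x) = t := by rw [hφ, h0, zero_add]
        refine Prod.ext this (Subtype.ext ?_)
        simp only [this, hadd]
        rw [neg_add_cancel, hzero] }
  rw [count, Nat.card_congr e, Nat.card_prod, Nat.cast_mul, count]

lemma card_dvd_count_of_shift {X : Type*} (P : X → Prop) (φ : X → F)
    (τ : F → X → X) (hφ : ∀ t x, φ (τ t x) = φ x + t) (hzero : ∀ x, τ 0 x = x)
    (hadd : ∀ s t x, τ s (τ t x) = τ (s + t) x) (hP : ∀ t x, P x → P (τ t x)) :
    (Nat.card F : ℤ) ∣ count P :=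
  ⟨_, count_eq_card_mul_of_shift P φ τ hφ hzero hadd hP⟩

/-- The case of translations by the multiples of a vector `k ≠ 0`. -/
lemma card_dvd_count_of_add {ι : Type*} (P : (ι → F) → Prop) {k : ι → F}
    (hk : k ≠ 0) (hP : ∀ (t : F) x, P x → P (x + t • k)) : (Nat.card F : ℤ) ∣ count P := by
  obtain ⟨i, hi⟩ := Function.ne_iff.1 hk
  have hi : k i ≠ 0 := hi
  refine card_dvd_count_of_shift P (fun x => x i / k i) (fun t x => x + t • k) ?_ ?_ ?_ hP
  · intro t x
    simp only [Pi.add_apply, Pi.smul_apply, smul_eq_mul]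
    field_simp
  · intro x; simp
  · intro s t x; rw [add_assoc, ← add_smul, add_comm t s]

/-- For fixed `x`, the equations `a e * x e + u y e = 0` in `a` and `y ∈ Y` have a number of
solutions divisible by `q` if `q` divides `|Y|`. -/
lemma card_dvd_count_scale {ε Y : Type*} (P : Y → Prop)
    (hY : (Nat.card F : ℤ) ∣ count P) (x : ε → F) (u : Y → ε → F) :
    (Nat.card F : ℤ) ∣ count fun p : (ε → F) × Y => P p.2 ∧ ∀ e, p.1 e * x e + u p.2 e = 0 := by
  classical
  by_cases hx : ∃ e, x e = 0
  · obtain ⟨e, he⟩ := hx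
    refine card_dvd_count_of_shift _ (fun p => p.1 e)
      (fun t p => (p.1 + t • Pi.single e 1, p.2)) ?_ ?_ ?_ ?_
    · intro t p; simp
    · intro p; simp
    · intro s t p; simp only [add_assoc, ← add_smul, add_comm t s]
    · rintro t p ⟨h1, h2⟩
      refine ⟨h1, fun e' => ?_⟩
      by_cases h : e' = e
      · have := h2 e'
        subst h
        simpa [he] using this
      · simpa [h] using h2 e'
  · push Not at hx
    have e : {p : (ε → F) × Y // P p.2 ∧ ∀ e, p.1 e * x e + u p.2 e = 0} ≃ {y // P y} :=
      { toFun := fun p => ⟨p.1.2, p.2.1⟩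
        invFun := fun y => ⟨(fun e => -u y.1 e / x e, y.1), y.2, fun e => by
          have := hx e
          field_simp
          ring⟩
        left_inv := fun p => by
          obtain ⟨⟨a, y⟩, h1, h2⟩ := p
          ext1
          refine Prod.ext (funext fun e => ?_) rfl
          have h3 := hx e
          have := h2 e
          simp only at this ⊢
          field_simp
          linear_combination -this
        right_inv := fun y => rfl }
    rw [count, Nat.card_congr e]
    exact hY

end Shift

/-! ### Configuration matrices -/

section Configuration

variable {F : Type*} [Field F] {ε ν : Type*} [Fintype ε] [DecidableEq ε] [Fintype ν]
  [DecidableEq ν]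

/-- The symmetric matrix of the configuration with rows `E e`, at the point `a`. -/
def configMatrix {ε ν F : Type*} [DecidableEq ε] [Zero F] (E : Matrix ε ν F) (a : ε → F) :
    Matrix (ε ⊕ ν) (ε ⊕ ν) F :=
  bordered (Matrix.diagonal a) E E 0

lemma transpose_configMatrix {ε ν F : Type*} [DecidableEq ε] [Zero F] (E : Matrix ε ν F)
    (a : ε → F) : (configMatrix E a).transpose = configMatrix E a := by
  simp [configMatrix, bordered, Matrix.fromBlocks_transpose]

lemma configMatrix_mulVec_eq {F ε ν : Type*} [Field F] [Fintype ε] [DecidableEq ε] [Fintype ν]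
    (E : Matrix ε ν F) (a : ε → F) (v : ε ⊕ ν → F) (s : ν → F) :
    (configMatrix E a).mulVec v = Sum.elim (fun _ => 0) s ↔
      (∀ e, a e * v (Sum.inl e) + E.mulVec (v ∘ Sum.inr) e = 0) ∧
        E.transpose.mulVec (v ∘ Sum.inl) = s := by
  rw [configMatrix, bordered, Matrix.fromBlocks_mulVec, Matrix.zero_mulVec, add_zero]
  constructor
  · intro h
    refine ⟨fun e => ?_, funext fun i => congrFun h (Sum.inr i)⟩
    have := congrFun h (Sum.inl e)
    simpa [Matrix.mulVec_diagonal] using this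
  · rintro ⟨h1, h2⟩
    funext i
    rcases i with e | i
    · simpa [Matrix.mulVec_diagonal] using h1 e
    · exact congrFun h2 i

omit [DecidableEq ν] in
/-- Counting solutions of `C(a) v = (0, s)` whose `ν`-part lies in a set of cardinality divisible
by `q`. -/
lemma card_dvd_count_configMatrix [Finite F] (E : Matrix ε ν F) (s : ν → F) (P : (ν → F) → Prop)
    (hP : (Nat.card F : ℤ) ∣ count P) :
    (Nat.card F : ℤ) ∣ count fun p : (ε → F) × (ε ⊕ ν → F) =>
      (configMatrix E p.1).mulVec p.2 = Sum.elim (fun _ => 0) s ∧ P (p.2 ∘ Sum.inr) := by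
  have := Fintype.ofFinite F
  let e : (ε → F) × (ε ⊕ ν → F) ≃ (ε → F) × ((ε → F) × (ν → F)) :=
    { toFun := fun p => (p.2 ∘ Sum.inl, (p.1, p.2 ∘ Sum.inr))
      invFun := fun p => (p.2.1, Sum.elim p.1 p.2.2)
      left_inv := fun p => by simp
      right_inv := fun p => by simp }
  rw [count_equiv e (Q := fun p => E.transpose.mulVec p.1 = s ∧ (P p.2.2 ∧
    ∀ e, p.2.1 e * p.1 e + E.mulVec p.2.2 e = 0))]
  · rw [count_prod]
    refine Finset.dvd_sum fun x _ => ?_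
    by_cases hx : E.transpose.mulVec x = s
    · simp only [hx, true_and]
      exact card_dvd_count_scale P hP x fun y => E.mulVec y
    · simp [hx, count_false]
  · intro p
    rw [configMatrix_mulVec_eq]
    simp only [e, Equiv.coe_fn_mk]
    tauto

/-- A matrix over a finite field has `1` kernel vector if it is invertible, and a multiple of `q`
otherwise. -/
lemma card_dvd_count_kernel_sub [Finite F] {m : Type*} [Fintype m] [DecidableEq m]
    (M : Matrix m m F) :
    (Nat.card F : ℤ) ∣ count (fun v : m → F => M.mulVec v = 0) - ind (M.det ≠ 0) := by
  by_cases h : M.det = 0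
  · rw [ind_of_not (by simpa using h), sub_zero]
    obtain ⟨k, hk, hMk⟩ := Matrix.exists_mulVec_eq_zero_iff.2 h
    refine card_dvd_count_of_add _ hk fun t x hx => ?_
    rw [Matrix.mulVec_add, Matrix.mulVec_smul, hx, hMk, smul_zero, add_zero]
  · rw [ind_of h, count_unique 0, sub_self]
    · exact dvd_zero _
    · intro y
      refine ⟨fun hy => Matrix.eq_zero_of_mulVec_eq_zero h hy, fun hy => ?_⟩
      rw [hy, Matrix.mulVec_zero]

lemma card_dvd_count_true {F ν : Type*} [Finite F] [Nonempty F] [Finite ν] [Nonempty ν] :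
    (Nat.card F : ℤ) ∣ count fun _ : ν → F => True := by
  rw [count_true fun _ => trivial, Nat.card_fun, Nat.cast_pow]
  exact dvd_pow_self _ Nat.card_pos.ne'

lemma card_dvd_count_det_ne_zero [Finite F] [Nonempty ν] (E : Matrix ε ν F) :
    (Nat.card F : ℤ) ∣ count fun a : ε → F => (configMatrix E a).det ≠ 0 := by
  have := Fintype.ofFinite F
  have h := card_dvd_count_configMatrix E 0 (fun _ => True) card_dvd_count_true
  have h0 : (Sum.elim (fun _ => 0) 0 : ε ⊕ ν → F) = 0 := Sum.elim_zero_zero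
  simp only [and_true, h0] at h
  rw [count_prod] at h
  have h2 := Finset.dvd_sum fun (a : ε → F) (_ : a ∈ Finset.univ) =>
    card_dvd_count_kernel_sub (configMatrix E a)
  rw [Finset.sum_sub_distrib, ← count_eq_sum] at h2
  exact (dvd_sub_right h).1 h2

lemma exists_dotProduct_eq_zero {F ν : Type*} [Field F] [Fintype ν] (hν : 2 ≤ Fintype.card ν)
    (r : ν → F) : ∃ k : ν → F, k ≠ 0 ∧ r ⬝ᵥ k = 0 := by
  let ψ : (ν → F) →ₗ[F] (Unit → F) := (Matrix.of fun _ : Unit => r).mulVecLin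
  have hker : LinearMap.ker ψ ≠ ⊥ := LinearMap.ker_ne_bot_of_finrank_lt (by simp; omega)
  obtain ⟨k, hk, hk0⟩ := (Submodule.ne_bot_iff _).1 hker
  exact ⟨k, hk0, congrFun hk ()⟩

lemma card_dvd_count_dotProduct {F ν : Type*} [Field F] [Fintype ν] (hν : 2 ≤ Fintype.card ν)
    (r : ν → F) (P : F → Prop) :
    (Nat.card F : ℤ) ∣ count fun y : ν → F => P (r ⬝ᵥ y) := by
  obtain ⟨k, hk, hrk⟩ := exists_dotProduct_eq_zero hν r
  refine card_dvd_count_of_add _ hk fun t x hx => ?_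
  rwa [dotProduct_add, dotProduct_smul, hrk, smul_zero, add_zero]

/-- The row `r` of vertex coordinates, as a border of the configuration matrix. -/
def vertexRow {ε ν F : Type*} [Zero F] (r : ν → F) : ε ⊕ ν → F := Sum.elim (fun _ => 0) r

/-- Kernel vectors of the bordered matrix are counted, over all `a`. -/
lemma card_dvd_count_borderedForm_ne_zero [Finite F] (hν : 2 ≤ Fintype.card ν) (E : Matrix ε ν F)
    (r : ν → F) : (Nat.card F : ℤ) ∣ count fun a : ε → F =>
      borderedForm (configMatrix E a) (vertexRow r) (vertexRow r) ≠ 0 := by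
  have := Fintype.ofFinite F
  obtain ⟨M, hM⟩ : ∃ M : (ε → F) → Matrix (Unit ⊕ (ε ⊕ ν)) (Unit ⊕ (ε ⊕ ν)) F, ∀ a, M a =
    bordered 0 (Matrix.of fun _ => vertexRow r) (Matrix.of fun _ => vertexRow r)
      (configMatrix E a) := ⟨_, fun _ => rfl⟩
  let e : (ε → F) × (Unit ⊕ (ε ⊕ ν) → F) ≃ F × ((ε → F) × (ε ⊕ ν → F)) :=
    { toFun := fun p => (p.2 (Sum.inl ()), (p.1, p.2 ∘ Sum.inr))
      invFun := fun p => (p.2.1, Sum.elim (fun _ => p.1) p.2.2)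
      left_inv := fun p => by
        refine Prod.ext rfl (funext fun i => ?_)
        rcases i with i | i <;> rfl
      right_inv := fun p => rfl }
  have h1 : ∀ p : (ε → F) × (Unit ⊕ (ε ⊕ ν) → F), (M p.1).mulVec p.2 = 0 ↔
      (configMatrix E p.1).mulVec (p.2 ∘ Sum.inr)
        = Sum.elim (fun _ => 0) (-(p.2 (Sum.inl ()) • r)) ∧ r ⬝ᵥ (p.2 ∘ Sum.inr) ∘ Sum.inr = 0 := by
    intro p
    have h0 : (M p.1).mulVec p.2 = Sum.elim (fun _ => r ⬝ᵥ (p.2 ∘ Sum.inr) ∘ Sum.inr)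
        (p.2 (Sum.inl ()) • vertexRow r + (configMatrix E p.1).mulVec (p.2 ∘ Sum.inr)) := by
      funext i
      rcases i with i | i
      · simp [hM, bordered, Matrix.mulVec, dotProduct, vertexRow]
      · simp [hM, bordered, Matrix.mulVec, dotProduct, mul_comm]
    have h3 : (Sum.elim (fun _ => 0) (-(p.2 (Sum.inl ()) • r)) : ε ⊕ ν → F)
        = -(p.2 (Sum.inl ()) • vertexRow r) := by
      funext i
      rcases i with i | i <;> simp [vertexRow]
    rw [h0, h3]
    constructor
    · intro h
      refine ⟨?_, congrFun h (Sum.inl ())⟩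
      funext i
      exact eq_neg_of_add_eq_zero_right (congrFun h (Sum.inr i))
    · rintro ⟨h, h'⟩
      funext i
      rcases i with i | i
      · exact h'
      · simp [h]
  have h2 : (Nat.card F : ℤ) ∣ count fun p : (ε → F) × (Unit ⊕ (ε ⊕ ν) → F) =>
      (M p.1).mulVec p.2 = 0 := by
    rw [count_equiv e (Q := fun p => (configMatrix E p.2.1).mulVec p.2.2
        = Sum.elim (fun _ => 0) (-(p.1 • r)) ∧ r ⬝ᵥ p.2.2 ∘ Sum.inr = 0) h1, count_prod]
    refine Finset.dvd_sum fun t _ => ?_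
    have h4 := card_dvd_count_configMatrix E (-(t • r)) (fun y => r ⬝ᵥ y = 0)
      (card_dvd_count_dotProduct hν r fun c => c = 0)
    exact h4
  rw [count_prod] at h2
  have h3 := Finset.dvd_sum fun (a : ε → F) (_ : a ∈ Finset.univ) =>
    card_dvd_count_kernel_sub (M a)
  rw [Finset.sum_sub_distrib, ← count_eq_sum] at h3
  have h5 := (dvd_sub_right h2).1 h3
  simp only [hM] at h5
  exact h5

/-- Solutions of `C(a) v = (0, r)` with `r ⬝ᵥ v ≠ 0` are counted, over all `a`. For singular `C(a)`
they are stable under translation by the kernel; for invertible `C(a)` the unique solution has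
`r ⬝ᵥ v ≠ 0` exactly if the bordered determinant is not zero. -/
lemma card_dvd_count_both_ne_zero [Finite F] (hν : 2 ≤ Fintype.card ν) (E : Matrix ε ν F)
    (r : ν → F) : (Nat.card F : ℤ) ∣ count fun a : ε → F => (configMatrix E a).det ≠ 0 ∧
      borderedForm (configMatrix E a) (vertexRow r) (vertexRow r) ≠ 0 := by
  have := Fintype.ofFinite F
  have h2 := card_dvd_count_configMatrix E r (fun y => r ⬝ᵥ y ≠ 0)
    (card_dvd_count_dotProduct hν r fun c => c ≠ 0)
  rw [count_prod] at h2
  have hr : ∀ v : ε ⊕ ν → F, vertexRow r ⬝ᵥ v = r ⬝ᵥ v ∘ Sum.inr := by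
    intro v
    simp [dotProduct, vertexRow]
  have h3 : ∀ a : ε → F, (Nat.card F : ℤ) ∣
      count (fun v : ε ⊕ ν → F => (configMatrix E a).mulVec v = Sum.elim (fun _ => 0) r ∧
        r ⬝ᵥ v ∘ Sum.inr ≠ 0) - ind ((configMatrix E a).det ≠ 0 ∧
          borderedForm (configMatrix E a) (vertexRow r) (vertexRow r) ≠ 0) := by
    intro a
    have hr' : (Sum.elim (fun _ => 0) r : ε ⊕ ν → F) = vertexRow r := rfl
    simp only [← hr, hr']
    set M := configMatrix E a with hM
    by_cases h : M.det = 0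
    · rw [ind_of_not (by simp [h]), sub_zero]
      obtain ⟨k, hk, hMk⟩ := Matrix.exists_mulVec_eq_zero_iff.2 h
      refine card_dvd_count_of_add _ hk fun t x hx => ⟨?_, ?_⟩
      · rw [Matrix.mulVec_add, Matrix.mulVec_smul, hx.1, hMk, smul_zero, add_zero]
      · -- the right hand side is orthogonal to the kernel, by symmetry
        have : vertexRow r ⬝ᵥ k = 0 := by
          rw [← hx.1, dotProduct_comm, Matrix.dotProduct_mulVec, ← Matrix.mulVec_transpose,
            hM, transpose_configMatrix, ← hM, hMk, zero_dotProduct]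
        rw [dotProduct_add, dotProduct_smul, this, smul_zero, add_zero]
        exact hx.2
    · have hu : IsUnit M.det := isUnit_iff_ne_zero.2 h
      have huniq : ∀ v, M.mulVec v = vertexRow r ↔ v = M⁻¹.mulVec (vertexRow r) := by
        intro v
        constructor
        · intro hv
          rw [← hv, Matrix.mulVec_mulVec, Matrix.nonsing_inv_mul _ hu, Matrix.one_mulVec]
        · intro hv
          rw [hv, Matrix.mulVec_mulVec, Matrix.mul_nonsing_inv _ hu, Matrix.one_mulVec]
      have hb := borderedForm_of_det_ne_zero h (vertexRow r) (vertexRow r)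
      by_cases h0 : vertexRow r ⬝ᵥ M⁻¹.mulVec (vertexRow r) = 0
      · rw [ind_of_not, count_false, sub_zero]
        · exact dvd_zero _
        · rintro v ⟨h1, h2⟩
          rw [(huniq v).1 h1] at h2
          exact h2 h0
        · rw [hb, h0]; simp
      · rw [ind_of, count_unique (M⁻¹.mulVec (vertexRow r)), sub_self]
        · exact dvd_zero _
        · intro v
          rw [huniq]
          exact ⟨fun h => h.1, fun h => ⟨h, h ▸ h0⟩⟩
        · rw [hb]
          exact ⟨h, neg_ne_zero.2 (mul_ne_zero h h0)⟩
  have h4 := Finset.dvd_sum fun (a : ε → F) (_ : a ∈ Finset.univ) => h3 a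
  rw [Finset.sum_sub_distrib, ← count_eq_sum] at h4
  exact (dvd_sub_right h2).1 h4

/-- The number of points at which the configuration polynomial or its border do not vanish. -/
lemma card_dvd_count_ne_zero_or [Finite F] (hν : 2 ≤ Fintype.card ν) (E : Matrix ε ν F)
    (r : ν → F) : (Nat.card F : ℤ) ∣ count fun a : ε → F => (configMatrix E a).det ≠ 0 ∨
      borderedForm (configMatrix E a) (vertexRow r) (vertexRow r) ≠ 0 := by
  have := Fintype.ofFinite F
  have : Nonempty ν := Fintype.card_pos_iff.1 (by omega)
  have h : count (fun a : ε → F => (configMatrix E a).det ≠ 0 ∨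
      borderedForm (configMatrix E a) (vertexRow r) (vertexRow r) ≠ 0)
      = count (fun a : ε → F => (configMatrix E a).det ≠ 0)
      + count (fun a : ε → F => borderedForm (configMatrix E a) (vertexRow r) (vertexRow r) ≠ 0)
      - count (fun a : ε → F => (configMatrix E a).det ≠ 0 ∧
        borderedForm (configMatrix E a) (vertexRow r) (vertexRow r) ≠ 0) := by
    simp only [count_eq_sum, ← Finset.sum_add_distrib, ← Finset.sum_sub_distrib]
    refine Finset.sum_congr rfl fun a _ => ?_
    by_cases h1 : (configMatrix E a).det ≠ 0 <;>
      by_cases h2 : borderedForm (configMatrix E a) (vertexRow r) (vertexRow r) ≠ 0 <;>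
      simp [ind, h1, h2]
  rw [h]
  exact dvd_sub (dvd_add (card_dvd_count_det_ne_zero E)
    (card_dvd_count_borderedForm_ne_zero hν E r)) (card_dvd_count_both_ne_zero hν E r)

lemma card_dvd_count_both_eq_zero [Finite F] [Nonempty ε] (hν : 2 ≤ Fintype.card ν)
    (E : Matrix ε ν F) (r : ν → F) :
    (Nat.card F : ℤ) ∣ count fun a : ε → F => (configMatrix E a).det = 0 ∧
      borderedForm (configMatrix E a) (vertexRow r) (vertexRow r) = 0 := by
  have h := count_not fun a : ε → F => (configMatrix E a).det ≠ 0 ∨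
      borderedForm (configMatrix E a) (vertexRow r) (vertexRow r) ≠ 0
  simp only [not_or, not_not] at h
  rw [h, Nat.card_fun, Nat.cast_pow]
  exact dvd_sub (dvd_pow_self _ Nat.card_pos.ne') (card_dvd_count_ne_zero_or hν E r)

/-- With at least two vertices, the number of points where the configuration polynomial does not
vanish is divisible by `q²`. By induction on `ε`: the polynomial is affine in each variable, with
constant coefficient a border of the remaining configuration. -/
lemma card_sq_dvd_count_det_ne_zero [Finite F] (hν : 2 ≤ Fintype.card ν) (E : Matrix ε ν F) :
    (Nat.card F : ℤ) ^ 2 ∣ count fun a : ε → F => (configMatrix E a).det ≠ 0 := by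
  classical
  have := Fintype.ofFinite F
  revert E
  refine Fintype.induction_empty_option (P := fun α _ => ∀ [DecidableEq α] (E : Matrix α ν F),
    (Nat.card F : ℤ) ^ 2 ∣ count fun a : α → F => (configMatrix E a).det ≠ 0) ?_ ?_ ?_ ε
  · intro α β _ e ih _ E
    have : DecidableEq α := Classical.decEq α
    let _ : Fintype α := Fintype.ofEquiv β e.symm
    have h := ih (E.submatrix e id)
    convert h using 1
    refine count_equiv (Equiv.arrowCongr e.symm (Equiv.refl F)) fun a => ?_
    have h2 := det_bordered_reindex e (Equiv.refl ν) (Matrix.diagonal a) E E 0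
    have h3 : (Matrix.diagonal a).submatrix e e = Matrix.diagonal (a ∘ e) := by
      ext i j; simp [Matrix.diagonal_apply]
    rw [h3] at h2
    rw [configMatrix, ← h2]
    exact Iff.rfl
  · intro _ E
    have : Nonempty ν := Fintype.card_pos_iff.1 (by omega)
    rw [count_false]
    · exact dvd_zero _
    · intro a h
      obtain ⟨i⟩ := this
      refine h (Matrix.det_eq_zero_of_row_eq_zero (Sum.inr i) ?_)
      rintro (j | j)
      · exact j.elim
      · rfl
  · intro α _ ih _ E
    have : DecidableEq α := Classical.decEq α
    let E' : Matrix α ν F := E.submatrix some id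
    have h1 : ∀ a : Option α → F, (configMatrix E a).det = a none * (configMatrix E' (a ∘ some)).det
        + borderedForm (configMatrix E' (a ∘ some)) (vertexRow (E none)) (vertexRow (E none)) := by
      intro a
      rw [← det_bordered_unit]
      let e : Unit ⊕ (α ⊕ ν) ≃ Option α ⊕ ν := (Equiv.sumAssoc Unit α ν).symm.trans
        (Equiv.sumCongr ((Equiv.sumComm Unit α).trans (Equiv.optionEquivSumPUnit α).symm)
          (Equiv.refl ν))
      rw [← Matrix.det_submatrix_equiv_self e]
      congr 1
      ext (i | i | i) (j | j | j) <;>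
        simp [configMatrix, bordered, e, vertexRow, E', Matrix.diagonal_apply]
    rw [count_equiv (Equiv.piOptionEquivProd (β := fun _ : Option α => F))
      (Q := fun p => p.1 * (configMatrix E' p.2).det
        + borderedForm (configMatrix E' p.2) (vertexRow (E none)) (vertexRow (E none)) ≠ 0)
      fun a => by rw [h1]; rfl, count_prod_right]
    have h2 : ∀ a : α → F, count (fun t : F => t * (configMatrix E' a).det
        + borderedForm (configMatrix E' a) (vertexRow (E none)) (vertexRow (E none)) ≠ 0)
        = Nat.card F * ind ((configMatrix E' a).det ≠ 0 ∨
          borderedForm (configMatrix E' a) (vertexRow (E none)) (vertexRow (E none)) ≠ 0)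
          - ind ((configMatrix E' a).det ≠ 0) := by
      intro a
      rw [count_not, count_eq_sum]
      simp only [mul_comm _ (configMatrix E' a).det, sum_ind_linear]
      rw [ind_not, ← not_and_or, ind_not]
      ring
    simp only [h2, Finset.sum_sub_distrib, ← Finset.mul_sum, ← count_eq_sum]
    refine dvd_sub ?_ (ih E')
    rw [sq]
    exact mul_dvd_mul_left _ (card_dvd_count_ne_zero_or hν E' _)

end Configuration

/-! ### Counting zeros in few variables -/

section FewVariables

variable {F : Type*} [Field F] [Fintype F]

lemma sum_add_right {M : Type*} [AddCommMonoid M] (g : F → M) (c : F) :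
    ∑ x, g (x + c) = ∑ x, g x :=
  Equiv.sum_comp (Equiv.addRight c) g

omit [Field F] in
lemma sum_ind_eq (c : F) : ∑ x : F, ind (x = c) = 1 := by
  rw [← count_eq_sum, count_unique c fun _ => Iff.rfl]

omit [Field F] in
lemma sum_ind_of_iff {P : F → Prop} (c : F) (h : ∀ x, P x ↔ x = c) : ∑ x : F, ind (P x) = 1 := by
  rw [← sum_ind_eq c]
  exact Finset.sum_congr rfl fun x _ => ind_congr (h x)

omit [Field F] in
/-- A sum whose terms are multiples of a condition that holds at a single point. -/
lemma sum_ind_and_of_iff {P Q : F → Prop} (c : F) (h : ∀ x, P x ↔ x = c) :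
    ∑ x : F, ind (P x ∧ Q x) = ind (Q c) := by
  classical
  simp only [h]
  rw [Finset.sum_eq_single c]
  · exact ind_congr (by simp)
  · intro x _ hx
    exact ind_of_not fun h => hx h.1
  · simp

omit [Field F] in
lemma sum_one : ∑ _x : F, (1 : ℤ) = Nat.card F := by
  simp [Nat.card_eq_fintype_card]

omit [Field F] in
lemma sum_const_card (c : ℤ) : ∑ _x : F, c = Nat.card F * c := by
  simp [Nat.card_eq_fintype_card]

omit [Field F] in
lemma count_fin_three (P : (Fin 3 → F) → Prop) :
    count P = ∑ x, ∑ y, ∑ z, ind (P ![x, y, z]) := by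
  rw [count_eq_sum, ← (Fin.consEquiv fun _ => F).sum_comp, Fintype.sum_prod_type]
  refine Finset.sum_congr rfl fun x _ => ?_
  rw [← (Fin.consEquiv fun _ => F).sum_comp, Fintype.sum_prod_type]
  refine Finset.sum_congr rfl fun y _ => ?_
  rw [← (Equiv.funUnique (Fin 1) F).symm.sum_comp]
  refine Finset.sum_congr rfl fun z _ => ind_congr (iff_of_eq (congrArg P ?_))
  ext i
  fin_cases i <;> rfl

omit [Field F] in
lemma count_fin_four (P : (Fin 4 → F) → Prop) :
    count P = ∑ w, ∑ x, ∑ y, ∑ z, ind (P ![w, x, y, z]) := by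
  rw [count_eq_sum, ← (Fin.consEquiv fun _ => F).sum_comp, Fintype.sum_prod_type]
  refine Finset.sum_congr rfl fun x _ => ?_
  rw [← count_eq_sum, count_fin_three]
  rfl

omit [Fintype F] in
/-- The number of zeros of a non-constant affine form. -/
lemma card_mul_count_affine {κ : Type*} [Finite κ] [Fintype κ] {p : κ → F} (hp : p ≠ 0) (c : F) :
    Nat.card F * count (fun a : κ → F => p ⬝ᵥ a + c = 0) = (Nat.card F : ℤ) ^ Nat.card κ := by
  classical
  obtain ⟨i, hi⟩ := Function.ne_iff.1 hp
  have hi : p i ≠ 0 := hi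
  have h := count_eq_card_mul_of_shift (fun _ : κ → F => True) (fun a => p ⬝ᵥ a + c)
    (fun t a => a + t • Pi.single i (p i)⁻¹) ?_ ?_ ?_ ?_
  · simp only [true_and] at h
    rw [← h, count_true fun _ => trivial, Nat.card_fun, Nat.cast_pow]
  · intro t x
    rw [dotProduct_add, dotProduct_smul, dotProduct_single, mul_inv_cancel₀ hi, smul_eq_mul]
    ring
  · intro x; simp
  · intro s t x; rw [add_assoc, ← add_smul, add_comm t s]
  · exact fun _ _ _ => trivial

lemma count_affine_of_ne_zero {k : ℕ} {p : Fin (k + 1) → F} (hp : p ≠ 0) (c : F) :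
    count (fun a : Fin (k + 1) → F => p ⬝ᵥ a + c = 0) = (Nat.card F : ℤ) ^ k := by
  have hq : (Nat.card F : ℤ) ≠ 0 := by exact_mod_cast Nat.card_pos.ne'
  refine mul_left_cancel₀ hq ?_
  rw [card_mul_count_affine hp, Nat.card_fin, pow_succ']

lemma card_pow_dvd_count_affine {k : ℕ} (p : Fin (k + 1) → F) (c : F) :
    (Nat.card F : ℤ) ^ k ∣ count (fun a : Fin (k + 1) → F => p ⬝ᵥ a + c = 0) := by
  by_cases hp : p = 0
  · by_cases hc : c = 0
    · rw [count_true (by simp [hp, hc]), Nat.card_fun, Nat.cast_pow, Nat.card_fin]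
      exact pow_dvd_pow _ (Nat.le_succ k)
    · rw [count_false (by simp [hp, hc])]
      exact dvd_zero _
  · rw [count_affine_of_ne_zero hp]

/-- The quadric `x y = w²` in the variables `x`, `y`. -/
lemma sum_ind_mul_eq_sq (w : F) :
    ∑ x : F, ∑ y : F, ind (x * y - w ^ 2 = 0) = Nat.card F - 1 + Nat.card F * ind (w = 0) := by
  have h : ∀ x : F, ∑ y : F, ind (x * y - w ^ 2 = 0)
      = 1 - ind (x = 0) + Nat.card F * ind (x = 0 ∧ w = 0) := by
    intro x
    rw [← ind_congr (and_congr_right fun _ => (neg_eq_zero.trans (pow_eq_zero_iff two_ne_zero) :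
      -w ^ 2 = 0 ↔ w = 0)), ← sum_ind_linear]
    simp only [sub_eq_add_neg]
  simp only [h, Finset.sum_add_distrib, Finset.sum_sub_distrib, ← Finset.mul_sum, sum_one,
    sum_ind_eq]
  rw [sum_ind_and_of_iff 0 fun _ => Iff.rfl]

/-- Zeros of the determinant of a symmetric `2 × 2` matrix whose entries are `z` plus constants
and free variables on the diagonal. -/
lemma sum_ind_det_two (c : F) :
    ∑ x : F, ∑ y : F, ∑ z : F, ind ((x + z) * (y + z) - (c + z) ^ 2 = 0)
      = (Nat.card F : ℤ) ^ 2 := by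
  have h : ∀ x y : F, ∑ z : F, ind ((x + z) * (y + z) - (c + z) ^ 2 = 0)
      = 1 - ind (y = 2 * c - x) + Nat.card F * ind (y = 2 * c - x ∧ x * y - c ^ 2 = 0) := by
    intro x y
    have h1 := sum_ind_linear (x + y - 2 * c) (x * y - c ^ 2)
    have h2 : x + y - 2 * c = 0 ↔ y = 2 * c - x :=
      ⟨fun h => by linear_combination h, fun h => by rw [h]; ring⟩
    rw [h2] at h1
    rw [← h1]
    refine Finset.sum_congr rfl fun z _ => ind_congr (iff_of_eq (congrArg (· = 0) ?_))
    ring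
  have h3 : ∑ x : F, ind (x * (2 * c - x) - c ^ 2 = 0) = 1 := by
    refine sum_ind_of_iff c fun x => ?_
    rw [show x * (2 * c - x) - c ^ 2 = -(x - c) ^ 2 by ring, neg_eq_zero,
      pow_eq_zero_iff two_ne_zero, sub_eq_zero]
  simp only [h, Finset.sum_add_distrib, Finset.sum_sub_distrib, ← Finset.mul_sum, sum_one,
    sum_const_card, sum_ind_eq, sum_ind_and_of_iff _ fun _ => Iff.rfl, h3]
  ring

/-- Zeros of the determinant of a symmetric `3 × 3` matrix whose entries are `w` plus constants
and free variables on the diagonal. -/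
lemma sum_ind_det_three (a b c : F) :
    ∑ x : F, ∑ y : F, ∑ z : F, ∑ w : F,
      ind ((x + w) * (y + w) * (z + w) + 2 * (a + w) * (b + w) * (c + w) - (x + w) * (c + w) ^ 2
        - (y + w) * (b + w) ^ 2 - (z + w) * (a + w) ^ 2 = 0)
      = (Nat.card F : ℤ) ^ 3 - 2 * Nat.card F
        + Nat.card F ^ 2 * (ind ((a - b) * (a - c) = 0) + ind (b = c)) := by
  -- the determinant is `u w + v` with `u = U z + W`, `v = V z + Z`
  let U : F → F → F := fun x y => x + y - 2 * a
  let V : F → F → F := fun x y => x * y - a ^ 2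
  let W : F → F → F := fun x y => x * y - a ^ 2 - b ^ 2 - c ^ 2
    + 2 * (b * c + a * c - b * y + a * b - c * x)
  let Z : F → F → F := fun x y => 2 * a * b * c - x * c ^ 2 - y * b ^ 2
  have h1 : ∀ x y z : F, ∑ w : F,
      ind ((x + w) * (y + w) * (z + w) + 2 * (a + w) * (b + w) * (c + w) - (x + w) * (c + w) ^ 2
        - (y + w) * (b + w) ^ 2 - (z + w) * (a + w) ^ 2 = 0)
      = 1 - ind (U x y * z + W x y = 0)
        + Nat.card F * ind (U x y * z + W x y = 0 ∧ V x y * z + Z x y = 0) := by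
    intro x y z
    rw [← sum_ind_linear]
    refine Finset.sum_congr rfl fun w _ => ind_congr (iff_of_eq (congrArg (· = 0) ?_))
    simp only [U, V, W, Z]
    ring
  have hU : ∀ x y, U x y = 0 ↔ y = 2 * a - x := fun x y =>
    ⟨fun h => by simp only [U] at h; linear_combination h, fun h => by simp only [U]; rw [h]; ring⟩
  have h2 : ∑ x : F, ∑ y : F, ∑ z : F, ind (U x y * z + W x y = 0) = (Nat.card F : ℤ) ^ 2 := by
    have h3 : ∑ x : F, ind (W x (2 * a - x) = 0) = 1 := by
      refine sum_ind_of_iff (a + b - c) fun x => ?_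
      rw [show W x (2 * a - x) = -(x - (a + b - c)) ^ 2 by simp only [W]; ring, neg_eq_zero,
        pow_eq_zero_iff two_ne_zero, sub_eq_zero]
    simp only [sum_ind_linear, hU, Finset.sum_add_distrib, Finset.sum_sub_distrib,
      ← Finset.mul_sum, sum_one, sum_const_card, sum_ind_eq,
      sum_ind_and_of_iff _ fun _ => Iff.rfl, h3]
    ring
  have h3 : ∑ x : F, ∑ y : F, ∑ z : F, ind (U x y * z + W x y = 0 ∧ V x y * z + Z x y = 0)
      = Nat.card F - 2 + Nat.card F * (ind ((a - b) * (a - c) = 0) + ind (b = c)) := by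
    have hres : ∀ x y, U x y * Z x y - W x y * V x y = 0 ↔
        (x - b) * y + (-(x - b) * c - (a - b) * (a - c)) = 0 := by
      intro x y
      rw [show U x y * Z x y - W x y * V x y
        = -((x - b) * y + (-(x - b) * c - (a - b) * (a - c))) ^ 2 by
          simp only [U, V, W, Z]; ring, neg_eq_zero, pow_eq_zero_iff two_ne_zero]
    have hV : ∀ x, V x (2 * a - x) = 0 ↔ x = a := by
      intro x
      rw [show V x (2 * a - x) = -(x - a) ^ 2 by simp only [V]; ring, neg_eq_zero,
        pow_eq_zero_iff two_ne_zero, sub_eq_zero]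
    have hUV : ∑ x : F, ∑ y : F, ind (U x y = 0 ∧ V x y = 0) = 1 := by
      simp only [hU, sum_ind_and_of_iff _ fun _ => Iff.rfl]
      exact sum_ind_of_iff a hV
    have hall : ∑ x : F, ∑ y : F, ind (U x y = 0 ∧ W x y = 0 ∧ V x y = 0 ∧ Z x y = 0)
        = ind (b = c) := by
      simp only [hU, sum_ind_and_of_iff _ fun _ => Iff.rfl]
      have : ∀ x, (W x (2 * a - x) = 0 ∧ V x (2 * a - x) = 0 ∧ Z x (2 * a - x) = 0) ↔
          (x = a ∧ b = c) := by
        intro x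
        rw [hV]
        constructor
        · rintro ⟨h1, rfl, -⟩
          refine ⟨rfl, ?_⟩
          have : (b - c) ^ 2 = 0 := by simp only [W] at h1; linear_combination -h1
          exact sub_eq_zero.1 (pow_eq_zero_iff two_ne_zero |>.1 this)
        · rintro ⟨rfl, rfl⟩
          refine ⟨?_, rfl, ?_⟩ <;> simp only [W, Z] <;> ring
      simp only [this, sum_ind_and_of_iff _ fun _ => Iff.rfl]
    have hmain : ∑ x : F, ∑ y : F, ind (U x y * Z x y - W x y * V x y = 0)
        = Nat.card F - 1 + Nat.card F * ind ((a - b) * (a - c) = 0) := by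
      simp only [hres, sum_ind_linear, sub_eq_zero (b := b), Finset.sum_add_distrib,
        Finset.sum_sub_distrib, ← Finset.mul_sum, sum_one, sum_ind_eq,
        sum_ind_and_of_iff _ fun _ => Iff.rfl]
      congr 2
      refine ind_congr ?_
      rw [sub_self, neg_zero, zero_mul, zero_sub, neg_eq_zero]
    simp only [sum_ind_linear_pair, Finset.sum_add_distrib, Finset.sum_sub_distrib,
      ← Finset.mul_sum, hUV, hall, hmain]
    ring
  simp only [h1, Finset.sum_add_distrib, Finset.sum_sub_distrib, ← Finset.mul_sum, h2, h3,
    sum_one, sum_const_card]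
  ring

end FewVariables

/-! ### The fibres over the edges at a vertex -/

section StarCount

variable {F : Type*} [Field F] [Fintype F] {m : Type*} [Fintype m] [DecidableEq m]

/-- The number of values of the variables of the edges at a vertex at which the determinant of
the matrix of the graph vanishes, for given values of the other variables. -/
noncomputable def starCount {k : ℕ} (X : Matrix (Fin k) m F) (C : Matrix m m F) : ℤ :=
  count fun α : Fin k → F => (starMatrix (Matrix.diagonal α) X X C).det = 0

omit [Fintype F] in
lemma sumZeroPart_diagonal {k : ℕ} (α : Fin (k + 1) → F) (i j : Fin k) :
    sumZeroPart (Matrix.diagonal α) i j = (if i = j then α i.succ else 0) + α 0 := by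
  simp [sumZeroPart, Matrix.diagonal_apply, Fin.succ_ne_zero, (Fin.succ_ne_zero _).symm]

omit [Fintype F] in
lemma det_starMatrix_diagonal_of_det_ne_zero {k : ℕ} {C : Matrix m m F} (hC : C.det ≠ 0)
    (X : Matrix (Fin (k + 1)) m F) (α : Fin (k + 1) → F) :
    (starMatrix (Matrix.diagonal α) X X C).det = 0 ↔
      (Matrix.of fun i j => (if i = j then α i.succ else 0) + α 0
        - rowDiff X i ⬝ᵥ C⁻¹.mulVec (rowDiff X j)).det = 0 := by
  rw [det_starMatrix, neg_eq_zero, det_bordered_of_det_ne_zero _ _ _ hC, mul_eq_zero,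
    or_iff_right hC]
  refine iff_of_eq (congrArg (fun M => Matrix.det M = 0) ?_)
  ext i j
  rw [Matrix.sub_apply, sumZeroPart_diagonal, Matrix.of_apply]
  congr 1
  rw [Matrix.mul_assoc, Matrix.mul_apply]
  simp only [Matrix.mul_apply, dotProduct, Matrix.mulVec, Matrix.transpose_apply]

omit [Fintype F] in
lemma det_starMatrix_diagonal_of_corankOne {k : ℕ} {C Γ : Matrix m m F} {κ : F} {z : m → F}
    (hC : CorankOne C κ z Γ) (X : Matrix (Fin (k + 1)) m F) (α : Fin (k + 1) → F) :
    (starMatrix (Matrix.diagonal α) X X C).det = 0 ↔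
      (bordered (Matrix.of fun i j => (if i = j then α i.succ else 0) + α 0
        - rowDiff X i ⬝ᵥ Γ.mulVec (rowDiff X j))
        (Matrix.of fun i (_ : Unit) => X i.succ ⬝ᵥ z - X 0 ⬝ᵥ z)
        (Matrix.of fun i (_ : Unit) => X i.succ ⬝ᵥ z - X 0 ⬝ᵥ z) 0).det = 0 := by
  rw [det_starMatrix, neg_eq_zero, hC.det_bordered, mul_eq_zero, or_iff_right hC.ne_zero]
  have h1 : ∀ i, (rowDiff X).mulVec z i = X i.succ ⬝ᵥ z - X 0 ⬝ᵥ z := by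
    intro i
    rw [← sub_dotProduct]
    rfl
  simp only [h1]
  refine iff_of_eq (congrArg (fun M => (bordered M _ _ _).det = 0) ?_)
  ext i j
  rw [Matrix.sub_apply, sumZeroPart_diagonal, Matrix.of_apply]
  congr 1
  rw [Matrix.mul_assoc, Matrix.mul_apply]
  simp only [Matrix.mul_apply, dotProduct, Matrix.mulVec, Matrix.transpose_apply]

omit [Fintype F] [DecidableEq m] in
lemma dotProduct_mulVec_comm {M : Matrix m m F} (hM : M.transpose = M) (r s : m → F) :
    r ⬝ᵥ M.mulVec s = s ⬝ᵥ M.mulVec r := by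
  rw [Matrix.dotProduct_mulVec, ← Matrix.mulVec_transpose, hM, dotProduct_comm]

omit [Fintype F] in
lemma sum_finset_of_card_le_one {ρ : Type*} [Fintype ρ] [DecidableEq ρ] (h : Finset ρ → F)
    (h0 : ∀ S : Finset ρ, 1 < S.card → h S = 0) : ∑ S, h S = h ∅ + ∑ i, h {i} := by
  have hinj : Set.InjOn (fun i : ρ => ({i} : Finset ρ)) (Finset.univ : Finset ρ) :=
    fun i _ j _ hij => Finset.singleton_injective hij
  rw [← Finset.sum_image (f := h) hinj, ← Finset.sum_insert]
  · symm
    refine Finset.sum_subset (Finset.subset_univ _) fun S _ hS => h0 S ?_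
    by_contra hcard
    apply hS
    rcases Nat.le_one_iff_eq_zero_or_eq_one.1 (not_lt.1 hcard) with h1 | h1
    · rw [Finset.card_eq_zero.1 h1]; exact Finset.mem_insert_self _ _
    · obtain ⟨i, rfl⟩ := Finset.card_eq_one.1 h1
      exact Finset.mem_insert_of_mem (Finset.mem_image_of_mem _ (Finset.mem_univ i))
  · simp

omit [Fintype F] in
/-- If `C` has two independent kernel vectors, the determinant is affine in up to four
variables. -/
lemma exists_affine_of_kernel {k : ℕ} (hk : k ≤ 4) (X : Matrix (Fin k) m F) {C : Matrix m m F}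
    {w : Fin 2 → m → F} (hw : LinearIndependent F w) (hC : ∀ i, C.mulVec (w i) = 0) :
    ∃ (p : Fin k → F) (c : F), (∀ α : Fin k → F,
      (starMatrix (Matrix.diagonal α) X X C).det = p ⬝ᵥ α + c) ∧ (k ≤ 3 → p = 0) := by
  let D : Matrix (Unit ⊕ m) (Unit ⊕ m) F := Matrix.fromBlocks 0 0 0 C
  let Z : Matrix (Fin k) (Unit ⊕ m) F := Matrix.of fun i => Sum.elim (fun _ => 1) (X i)
  let w' : Fin 3 → Unit ⊕ m → F :=
    ![Sum.elim (fun _ => 1) 0, Sum.elim (fun _ => 0) (w 0), Sum.elim (fun _ => 0) (w 1)]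
  have hw' : LinearIndependent F w' := by
    rw [Fintype.linearIndependent_iff] at hw ⊢
    intro g hg
    rw [Fin.sum_univ_three] at hg
    have h0 : g 0 = 0 := by
      have := congrFun hg (Sum.inl ())
      simpa [w'] using this
    have h12 := hw ![g 1, g 2] (by
      rw [Fin.sum_univ_two]
      funext i
      have := congrFun hg (Sum.inr i)
      simpa [w'] using this)
    intro i
    fin_cases i
    · exact h0
    · exact h12 0
    · exact h12 1
  have hD : ∀ i, D.mulVec (w' i) = 0 := by
    have h : ∀ (s : F) (u : m → F), C.mulVec u = 0 → D.mulVec (Sum.elim (fun _ => s) u) = 0 := by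
      intro s u hu
      rw [Matrix.fromBlocks_mulVec]
      funext i
      rcases i with i | i
      · simp
      · simpa using congrFun hu i
    intro i
    fin_cases i
    · exact h 1 0 (Matrix.mulVec_zero C)
    · exact h 0 _ (hC 0)
    · exact h 0 _ (hC 1)
  let d : Finset (Fin k) → F := fun T => (bordered (0 : Matrix T T F)
    (Z.submatrix (fun i : T => i.1) id) (Z.submatrix (fun i : T => i.1) id) D).det
  have hd : ∀ T, T.card < 3 → d T = 0 := fun T hT =>
    det_bordered_eq_zero _ _ _ w' hw' hD (by simpa using hT)
  refine ⟨fun i => d {i}ᶜ, d Finset.univ, fun α => ?_, fun hk3 => ?_⟩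
  · have h1 : (starMatrix (Matrix.diagonal α) X X C).det = ∑ T, (∏ i ∈ Tᶜ, α i) * d T :=
      det_bordered_diagonal α Z Z D
    rw [h1, ← Equiv.sum_comp (compl_involutive.toPerm compl)]
    have h2 := sum_finset_of_card_le_one (fun S : Finset (Fin k) => (∏ i ∈ S, α i) * d Sᶜ)
      fun S hS => by
        rw [hd Sᶜ (by rw [Finset.card_compl, Fintype.card_fin]; omega), mul_zero]
    simp only [Function.Involutive.coe_toPerm, compl_compl]
    rw [h2, add_comm, dotProduct]
    simp [mul_comm]
  · funext i
    exact hd _ (by rw [Finset.card_compl, Fintype.card_fin, Finset.card_singleton]; omega)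

omit [Fintype F] in
lemma det_bordered_fin_two (A : Matrix (Fin 2) (Fin 2) F) (x y : Fin 2 → F) :
    (bordered A (Matrix.of fun i (_ : Unit) => x i) (Matrix.of fun i (_ : Unit) => y i) 0).det
      = -(x 0 * y 0 * A 1 1 - x 0 * y 1 * A 1 0 - x 1 * y 0 * A 0 1 + x 1 * y 1 * A 0 0) := by
  let e : Fin 3 ≃ Fin 2 ⊕ Unit := ⟨![Sum.inl 0, Sum.inl 1, Sum.inr ()],
    Sum.elim ![0, 1] fun _ => 2, by intro i; fin_cases i <;> rfl,
    by rintro (i | i) <;> [fin_cases i; skip] <;> rfl⟩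
  rw [← Matrix.det_submatrix_equiv_self e, Matrix.det_fin_three]
  simp [e, bordered]
  ring

omit [Fintype F] in
lemma det_bordered_fin_three (A : Matrix (Fin 3) (Fin 3) F) (hA : A.transpose = A)
    (x : Fin 3 → F) :
    (bordered A (Matrix.of fun i (_ : Unit) => x i) (Matrix.of fun i (_ : Unit) => x i) 0).det
      = -(x 0 ^ 2 * (A 1 1 * A 2 2 - A 1 2 ^ 2) + x 1 ^ 2 * (A 0 0 * A 2 2 - A 0 2 ^ 2)
        + x 2 ^ 2 * (A 0 0 * A 1 1 - A 0 1 ^ 2) + 2 * x 0 * x 1 * (A 0 2 * A 1 2 - A 0 1 * A 2 2)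
        + 2 * x 0 * x 2 * (A 0 1 * A 1 2 - A 0 2 * A 1 1)
        + 2 * x 1 * x 2 * (A 0 1 * A 0 2 - A 0 0 * A 1 2)) := by
  let e : Fin 4 ≃ Fin 3 ⊕ Unit := ⟨![Sum.inl 0, Sum.inl 1, Sum.inl 2, Sum.inr ()],
    Sum.elim ![0, 1, 2] fun _ => 3, by intro i; fin_cases i <;> rfl,
    by rintro (i | i) <;> [fin_cases i; skip] <;> rfl⟩
  have h10 : A 1 0 = A 0 1 := congrFun (congrFun hA 0) 1
  have h20 : A 2 0 = A 0 2 := congrFun (congrFun hA 0) 2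
  have h21 : A 2 1 = A 1 2 := congrFun (congrFun hA 1) 2
  have h : (bordered A (Matrix.of fun i (_ : Unit) => x i)
      (Matrix.of fun i (_ : Unit) => x i) 0).submatrix e e
      = !![A 0 0, A 0 1, A 0 2, x 0; A 1 0, A 1 1, A 1 2, x 1; A 2 0, A 2 1, A 2 2, x 2;
          x 0, x 1, x 2, 0] := by
    ext i j
    fin_cases i <;> fin_cases j <;> rfl
  rw [← Matrix.det_submatrix_equiv_self e, h, h10, h20, h21]
  simp [Matrix.det_succ_row_zero, Fin.sum_univ_succ, Fin.succAbove]
  ring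

end StarCount

section LocalCounts

variable {F : Type*} [Field F] [Fintype F] {m : Type*} [Fintype m] [DecidableEq m]

omit [Fintype F] in
lemma starCount_submatrix {k : ℕ} (π : Equiv.Perm (Fin k)) (X : Matrix (Fin k) m F)
    (C : Matrix m m F) : starCount (X.submatrix π id) C = starCount X C := by
  refine count_equiv (Equiv.arrowCongr π (Equiv.refl F)) fun α => ?_
  have h := det_bordered_reindex π (Equiv.refl (Unit ⊕ m))
    (Matrix.diagonal (Equiv.arrowCongr π (Equiv.refl F) α))
    (Matrix.of fun i => Sum.elim (fun _ => 1) (X i))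
    (Matrix.of fun i => Sum.elim (fun _ => 1) (X i)) (Matrix.fromBlocks 0 0 0 C)
  have h2 : (Matrix.diagonal (Equiv.arrowCongr π (Equiv.refl F) α)).submatrix π π
      = Matrix.diagonal α := by
    ext i j
    simp [Matrix.diagonal_apply, Equiv.arrowCongr]
  rw [h2] at h
  exact iff_of_eq (congrArg (· = 0) h)

omit [Fintype F] in
lemma borderedForm_eq_zero_iff {C : Matrix m m F} (hC : C.det ≠ 0) (r s : m → F) :
    borderedForm C r s = 0 ↔ r ⬝ᵥ C⁻¹.mulVec s = 0 := by
  rw [borderedForm_of_det_ne_zero hC, neg_eq_zero, mul_eq_zero, or_iff_right hC]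

omit [Fintype F] in
lemma CorankOne.borderedForm_eq_zero_iff {C Γ : Matrix m m F} {κ : F} {z : m → F}
    (hC : CorankOne C κ z Γ) (r s : m → F) :
    borderedForm C r s = 0 ↔ r ⬝ᵥ z = 0 ∨ s ⬝ᵥ z = 0 := by
  rw [hC.borderedForm_eq, neg_eq_zero, mul_eq_zero, or_iff_right hC.ne_zero, mul_eq_zero]

lemma starCount_three_of_det_ne_zero {C : Matrix m m F} (hsymm : C.transpose = C)
    (hC : C.det ≠ 0) (X : Matrix (Fin 3) m F) : starCount X C = (Nat.card F : ℤ) ^ 2 := by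
  have hinv : C⁻¹.transpose = C⁻¹ := by rw [Matrix.transpose_nonsing_inv, hsymm]
  set ρ : Fin 2 → Fin 2 → F := fun i j => rowDiff X i ⬝ᵥ C⁻¹.mulVec (rowDiff X j) with hρ
  have h10 : ρ 1 0 = ρ 0 1 := dotProduct_mulVec_comm hinv _ _
  have h : ∀ α : Fin 3 → F, (starMatrix (Matrix.diagonal α) X X C).det = 0 ↔
      (α 1 + -ρ 0 0 + α 0) * (α 2 + -ρ 1 1 + α 0) - (-ρ 0 1 + α 0) ^ 2 = 0 := by
    intro α
    rw [det_starMatrix_diagonal_of_det_ne_zero hC, Matrix.det_fin_two]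
    refine iff_of_eq (congrArg (· = 0) ?_)
    change (α 1 + α 0 - ρ 0 0) * (α 2 + α 0 - ρ 1 1) - (0 + α 0 - ρ 0 1) * (0 + α 0 - ρ 1 0) = _
    rw [h10]
    ring
  rw [starCount, count_congr h, count_fin_three, Finset.sum_comm]
  refine (Finset.sum_congr rfl fun x _ => Finset.sum_comm).trans ?_
  refine (sum_add_right (fun x => ∑ y : F, ∑ z : F,
    ind ((x + z) * (y + -ρ 1 1 + z) - (-ρ 0 1 + z) ^ 2 = 0)) (-ρ 0 0)).trans ?_
  refine (Finset.sum_congr rfl fun x _ => sum_add_right (fun y => ∑ z : F,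
    ind ((x + z) * (y + z) - (-ρ 0 1 + z) ^ 2 = 0)) (-ρ 1 1)).trans ?_
  exact sum_ind_det_two _

/-- The fibres over the variables of the edges at a 3-valent vertex. For invertible `C` the
determinant is one of a symmetric `2 × 2` matrix; in corank one it is an affine form in the three
variables, and in corank two or more it is constant. -/
lemma card_cube_dvd_starCount_three {C : Matrix m m F} (hsymm : C.transpose = C)
    (X : Matrix (Fin 3) m F) :
    (Nat.card F : ℤ) ^ 3 ∣ starCount X C - Nat.card F ^ 2 * (1
      + ind (C.det = 0 ∧ borderedForm C (X 1 - X 2) (X 0 - X 2) = 0)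
      - ind (C.det = 0 ∧ borderedForm C (X 1 - X 2) (X 1 - X 2) = 0)
      - ind (C.det = 0 ∧ borderedForm C (X 0 - X 2) (X 0 - X 2) = 0)) := by
  rcases symmetric_trichotomy hsymm with hC | ⟨hC, κ, z, Γ, h1⟩ | ⟨hC, w, hw, hCw⟩
  · rw [starCount_three_of_det_ne_zero hsymm hC, ind_of_not fun h => hC h.1,
      ind_of_not fun h => hC h.1, ind_of_not fun h => hC h.1]
    simp
  · set β : Fin 3 → F := fun i => X i ⬝ᵥ z with hβ
    set ρ : Fin 2 → Fin 2 → F := fun i j => rowDiff X i ⬝ᵥ Γ.mulVec (rowDiff X j) with hρ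
    have h10 : ρ 1 0 = ρ 0 1 := dotProduct_mulVec_comm h1.transpose_eq _ _
    have h : ∀ α : Fin 3 → F, (starMatrix (Matrix.diagonal α) X X C).det = 0 ↔
        ![(β 1 - β 2) ^ 2, (β 0 - β 2) ^ 2, (β 0 - β 1) ^ 2] ⬝ᵥ α
          + -((β 1 - β 0) ^ 2 * ρ 1 1 - 2 * (β 1 - β 0) * (β 2 - β 0) * ρ 0 1
            + (β 2 - β 0) ^ 2 * ρ 0 0) = 0 := by
      intro α
      rw [det_starMatrix_diagonal_of_corankOne h1, det_bordered_fin_two, neg_eq_zero]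
      refine iff_of_eq (congrArg (· = 0) ?_)
      change (β 1 - β 0) * (β 1 - β 0) * (α 2 + α 0 - ρ 1 1)
        - (β 1 - β 0) * (β 2 - β 0) * (0 + α 0 - ρ 1 0)
        - (β 2 - β 0) * (β 1 - β 0) * (0 + α 0 - ρ 0 1)
        + (β 2 - β 0) * (β 2 - β 0) * (α 1 + α 0 - ρ 0 0) = _
      rw [h10, dotProduct, Fin.sum_univ_three]
      simp only [Matrix.cons_val]
      ring
    rw [starCount, count_congr h]
    simp only [h1.borderedForm_eq_zero_iff, hC, true_and, sub_dotProduct, sub_eq_zero, or_self]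
    change _ ∣ _ - _ * (1 + ind (β 1 = β 2 ∨ β 0 = β 2) - ind (β 1 = β 2) - ind (β 0 = β 2))
    by_cases hall : β 1 = β 2 ∧ β 0 = β 2
    · rw [count_true, Nat.card_fun, Nat.card_fin, ind_of (Or.inl hall.1), ind_of hall.1,
        ind_of hall.2]
      · simp
      · intro α
        simp [hall, dotProduct, Fin.sum_univ_three]
    · have hp : ![(β 1 - β 2) ^ 2, (β 0 - β 2) ^ 2, (β 0 - β 1) ^ 2] ≠ 0 := by
        intro h0
        refine hall ⟨?_, ?_⟩
        · have := congrFun h0 0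
          simpa [sub_eq_zero] using this
        · have := congrFun h0 1
          simpa [sub_eq_zero] using this
      rw [count_affine_of_ne_zero hp]
      have h3 : 1 + ind (β 1 = β 2 ∨ β 0 = β 2) - ind (β 1 = β 2) - ind (β 0 = β 2) = 1 := by
        by_cases h12 : β 1 = β 2 <;> by_cases h02 : β 0 = β 2
        · exact absurd ⟨h12, h02⟩ hall
        all_goals simp [ind, h12, h02]
      rw [h3]
      simp
  · obtain ⟨p, c, h, hp⟩ := exists_affine_of_kernel (by norm_num) X hw hCw
    rw [starCount, count_congr fun α => by rw [h α, hp le_rfl, zero_dotProduct, zero_add]]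
    simp only [borderedForm_eq_zero hw hCw, hC, and_self, ind_of]
    by_cases hc : c = 0
    · rw [count_true fun _ => hc, Nat.card_fun, Nat.card_fin]
      simp
    · rw [count_false fun _ => hc]
      simp

lemma starCount_four_of_det_ne_zero {C : Matrix m m F} (hsymm : C.transpose = C)
    (hC : C.det ≠ 0) (X : Matrix (Fin 4) m F) :
    starCount X C = (Nat.card F : ℤ) ^ 3 - 2 * Nat.card F + Nat.card F ^ 2 *
      (ind (borderedForm C (X 1 - X 3) (X 0 - X 2) = 0)
        + ind (borderedForm C (X 1 - X 2) (X 0 - X 3) = 0)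
        + ind (borderedForm C (X 2 - X 3) (X 0 - X 1) = 0)
        - ind (borderedForm C (X 1 - X 3) (X 0 - X 2) = 0 ∧
          borderedForm C (X 1 - X 2) (X 0 - X 3) = 0)) := by
  have hinv : C⁻¹.transpose = C⁻¹ := by rw [Matrix.transpose_nonsing_inv, hsymm]
  set ρ : Fin 3 → Fin 3 → F := fun i j => rowDiff X i ⬝ᵥ C⁻¹.mulVec (rowDiff X j) with hρ
  have hcomm : ∀ i j, ρ i j = ρ j i := fun i j => dotProduct_mulVec_comm hinv _ _
  have h : ∀ α : Fin 4 → F, (starMatrix (Matrix.diagonal α) X X C).det = 0 ↔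
      (α 1 + -ρ 0 0 + α 0) * (α 2 + -ρ 1 1 + α 0) * (α 3 + -ρ 2 2 + α 0)
        + 2 * (-ρ 0 1 + α 0) * (-ρ 0 2 + α 0) * (-ρ 1 2 + α 0)
        - (α 1 + -ρ 0 0 + α 0) * (-ρ 1 2 + α 0) ^ 2 - (α 2 + -ρ 1 1 + α 0) * (-ρ 0 2 + α 0) ^ 2
        - (α 3 + -ρ 2 2 + α 0) * (-ρ 0 1 + α 0) ^ 2 = 0 := by
    intro α
    rw [det_starMatrix_diagonal_of_det_ne_zero hC, Matrix.det_fin_three]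
    refine iff_of_eq (congrArg (· = 0) ?_)
    change (α 1 + α 0 - ρ 0 0) * (α 2 + α 0 - ρ 1 1) * (α 3 + α 0 - ρ 2 2)
      - (α 1 + α 0 - ρ 0 0) * (0 + α 0 - ρ 1 2) * (0 + α 0 - ρ 2 1)
      - (0 + α 0 - ρ 0 1) * (0 + α 0 - ρ 1 0) * (α 3 + α 0 - ρ 2 2)
      + (0 + α 0 - ρ 0 1) * (0 + α 0 - ρ 1 2) * (0 + α 0 - ρ 2 0)
      + (0 + α 0 - ρ 0 2) * (0 + α 0 - ρ 1 0) * (0 + α 0 - ρ 2 1)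
      - (0 + α 0 - ρ 0 2) * (α 2 + α 0 - ρ 1 1) * (0 + α 0 - ρ 2 0) = _
    rw [hcomm 1 0, hcomm 2 0, hcomm 2 1]
    ring
  have hcount : starCount X C = (Nat.card F : ℤ) ^ 3 - 2 * Nat.card F
      + Nat.card F ^ 2 * (ind ((-ρ 0 1 - -ρ 0 2) * (-ρ 0 1 - -ρ 1 2) = 0)
        + ind (-ρ 0 2 = -ρ 1 2)) := by
    rw [starCount, count_congr h, count_fin_four, Finset.sum_comm]
    refine (Finset.sum_congr rfl fun x _ => Finset.sum_comm.trans
      (Finset.sum_congr rfl fun y _ => Finset.sum_comm)).trans ?_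
    rw [← sum_ind_det_three]
    refine (sum_add_right (fun x => ∑ y : F, ∑ z : F, ∑ w : F,
      ind ((x + w) * (y + -ρ 1 1 + w) * (z + -ρ 2 2 + w)
        + 2 * (-ρ 0 1 + w) * (-ρ 0 2 + w) * (-ρ 1 2 + w) - (x + w) * (-ρ 1 2 + w) ^ 2
        - (y + -ρ 1 1 + w) * (-ρ 0 2 + w) ^ 2 - (z + -ρ 2 2 + w) * (-ρ 0 1 + w) ^ 2 = 0))
      (-ρ 0 0)).trans ?_
    refine Finset.sum_congr rfl fun x _ => ?_
    refine (sum_add_right (fun y => ∑ z : F, ∑ w : F,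
      ind ((x + w) * (y + w) * (z + -ρ 2 2 + w)
        + 2 * (-ρ 0 1 + w) * (-ρ 0 2 + w) * (-ρ 1 2 + w) - (x + w) * (-ρ 1 2 + w) ^ 2
        - (y + w) * (-ρ 0 2 + w) ^ 2 - (z + -ρ 2 2 + w) * (-ρ 0 1 + w) ^ 2 = 0))
      (-ρ 1 1)).trans ?_
    refine Finset.sum_congr rfl fun y _ => ?_
    exact sum_add_right (fun z => ∑ w : F,
      ind ((x + w) * (y + w) * (z + w)
        + 2 * (-ρ 0 1 + w) * (-ρ 0 2 + w) * (-ρ 1 2 + w) - (x + w) * (-ρ 1 2 + w) ^ 2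
        - (y + w) * (-ρ 0 2 + w) ^ 2 - (z + w) * (-ρ 0 1 + w) ^ 2 = 0)) (-ρ 2 2)
  -- the three forms in terms of the entries of `ρ`
  have hrow : ∀ i : Fin 3, rowDiff X i = X i.succ - X 0 := fun i => rfl
  have e1 : X 1 = rowDiff X 0 + X 0 := by rw [hrow]; exact (sub_add_cancel _ _).symm
  have e2 : X 2 = rowDiff X 1 + X 0 := by rw [hrow]; exact (sub_add_cancel _ _).symm
  have e3 : X 3 = rowDiff X 2 + X 0 := by rw [hrow]; exact (sub_add_cancel _ _).symm
  have hA : borderedForm C (X 1 - X 3) (X 0 - X 2) = 0 ↔ ρ 0 1 = ρ 1 2 := by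
    rw [borderedForm_eq_zero_iff hC, hcomm 1 2, ← sub_eq_zero (a := ρ 0 1), ← neg_eq_zero,
      e1, e2, e3, add_sub_add_right_eq_sub, sub_add_cancel_right, Matrix.mulVec_neg,
      dotProduct_neg, neg_neg, sub_dotProduct]
  have hB : borderedForm C (X 1 - X 2) (X 0 - X 3) = 0 ↔ ρ 0 2 = ρ 1 2 := by
    rw [borderedForm_eq_zero_iff hC, ← sub_eq_zero (a := ρ 0 2), ← neg_eq_zero,
      e1, e2, e3, add_sub_add_right_eq_sub, sub_add_cancel_right, Matrix.mulVec_neg,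
      dotProduct_neg, neg_neg, sub_dotProduct]
  have hD : borderedForm C (X 2 - X 3) (X 0 - X 1) = 0 ↔ ρ 0 1 = ρ 0 2 := by
    rw [borderedForm_eq_zero_iff hC, hcomm 0 1, hcomm 0 2, ← sub_eq_zero (a := ρ 1 0),
      ← neg_eq_zero, e1, e2, e3, add_sub_add_right_eq_sub, sub_add_cancel_right,
      Matrix.mulVec_neg, dotProduct_neg, neg_neg, sub_dotProduct]
  rw [hcount, ind_congr hA, ind_congr hB, ind_congr hD, ind_congr (and_congr hA hB)]
  congr 2
  by_cases hac : ρ 0 1 = ρ 1 2 <;> by_cases hab : ρ 0 1 = ρ 0 2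
  · simp [ind, hac, ← hab]
  · have hbc : ¬ ρ 0 2 = ρ 1 2 := fun h => hab (hac.trans h.symm)
    simp [ind, hac, hbc, Ne.symm hbc]
  · have hbc : ¬ ρ 0 2 = ρ 1 2 := fun h => hac (hab.trans h)
    simp [ind, hab, hbc]
  · have h0 : ¬ (-ρ 0 1 - -ρ 0 2) * (-ρ 0 1 - -ρ 1 2) = 0 := by
      rw [mul_eq_zero, sub_eq_zero, sub_eq_zero, neg_inj, neg_inj]
      tauto
    rw [ind_congr (neg_inj (a := ρ 0 2)), ind_of_not h0, ind_of_not hac, ind_of_not hab,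
      ind_of_not (P := _ ∧ _) fun h => hac h.1]
    ring

omit [Fintype F] in
/-- The border `x` of a symmetric `3 × 3` matrix restricts its quadratic form to the plane
orthogonal to `x`, spanned by `(1, 0, s)` and `(0, 1, t)`. -/
lemma det_bordered_fin_three_eq (A : Matrix (Fin 3) (Fin 3) F) (hA : A.transpose = A)
    (s t u : F) :
    (bordered A (Matrix.of fun i (_ : Unit) => ![-s * u, -t * u, u] i)
      (Matrix.of fun i (_ : Unit) => ![-s * u, -t * u, u] i) 0).det
      = -u ^ 2 * ((A 0 0 + 2 * s * A 0 2 + s ^ 2 * A 2 2) * (A 1 1 + 2 * t * A 1 2 + t ^ 2 * A 2 2)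
        - (A 0 1 + t * A 0 2 + s * A 1 2 + s * t * A 2 2) ^ 2) := by
  rw [det_bordered_fin_three A hA]
  simp only [Matrix.cons_val]
  ring

lemma card_cube_dvd_sum_ind_linear_form (p₁ p₂ c : F) :
    (Nat.card F : ℤ) ^ 3 ∣ Nat.card F * ∑ x : F, ∑ y : F, ind (p₁ * x + p₂ * y + c = 0)
      + Nat.card F ^ 2 * (ind (p₁ = 0 ∧ p₂ = 0) - 1) := by
  have h1 : ∀ x, ∑ y : F, ind (p₁ * x + p₂ * y + c = 0)
      = 1 - ind (p₂ = 0) + Nat.card F * (ind (p₂ = 0) * ind (p₁ * x + c = 0)) := by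
    intro x
    have : ind (p₂ = 0) * ind (p₁ * x + c = 0) = ind (p₂ = 0 ∧ p₁ * x + c = 0) := by
      by_cases h : p₂ = 0
      · rw [ind_of h, one_mul, ind_congr (and_iff_right h)]
      · rw [ind_of_not h, zero_mul, ind_of_not fun h' => h h'.1]
    rw [this, ← sum_ind_linear]
    refine Finset.sum_congr rfl fun y _ => ind_congr (iff_of_eq (congrArg (· = 0) ?_))
    ring
  simp only [h1, Finset.sum_add_distrib, ← Finset.mul_sum, sum_const_card, sum_ind_linear]
  by_cases hp2 : p₂ = 0
  · by_cases hp1 : p₁ = 0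
    · refine ⟨ind (p₁ = 0 ∧ c = 0), ?_⟩
      rw [ind_of (P := p₁ = 0 ∧ p₂ = 0) ⟨hp1, hp2⟩, ind_of hp2, ind_of hp1]
      ring
    · refine ⟨0, ?_⟩
      rw [ind_of hp2, ind_of_not hp1, ind_of_not fun h : p₁ = 0 ∧ c = 0 => hp1 h.1,
        ind_of_not fun h : p₁ = 0 ∧ p₂ = 0 => hp1 h.1]
      ring
  · refine ⟨0, ?_⟩
    rw [ind_of_not hp2, ind_of_not fun h : p₁ = 0 ∧ p₂ = 0 => hp2 h.2]
    ring

lemma sum_ind_add_mul_add_eq_sq (c d w : F) :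
    ∑ x : F, ∑ y : F, ind ((x + c) * (y + d) - w ^ 2 = 0)
      = Nat.card F - 1 + Nat.card F * ind (w = 0) := by
  rw [← sum_ind_mul_eq_sq]
  refine (sum_add_right (fun x : F => ∑ y : F, ind (x * (y + d) - w ^ 2 = 0)) c).trans ?_
  exact Finset.sum_congr rfl fun x _ => sum_add_right (fun y : F => ind (x * y - w ^ 2 = 0)) d

omit [Field F] [Fintype F] in
/-- The coincidences among four elements which are not all equal: the contribution of two pairs of
equal elements cancels against those of the forms in corank one. -/
lemma sum_ind_coincidences {a b c d : F} (h : ¬ (b = a ∧ c = a ∧ d = a)) :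
    ind ((a = b ∧ c = d) ∨ (a = c ∧ b = d) ∨ (a = d ∧ b = c))
      + (ind (b = d ∨ a = c) + ind (b = c ∨ a = d) + ind (c = d ∨ a = b) + ind (b = d) + ind (a = c)
        - ind ((b = d ∨ a = c) ∧ (b = c ∨ a = d))
        - (ind (b = c ∨ a = c) + ind (c = d ∨ b = d) + ind (d = a ∨ c = a) + ind (a = b ∨ d = b)))
      = 0 := by
  by_cases h1 : a = b
  · subst h1
    by_cases h2 : a = c
    · subst h2
      have h3 : ¬ a = d := fun h3 => h ⟨rfl, rfl, h3.symm⟩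
      simp [ind, h3, Ne.symm h3]
    · by_cases h3 : a = d
      · subst h3
        simp [ind, h2, Ne.symm h2]
      · by_cases h4 : c = d
        · subst h4
          simp [ind, h2, Ne.symm h2]
        · simp [ind, h2, h3, h4, Ne.symm h2, Ne.symm h3]
  · by_cases h2 : a = c
    · subst h2
      by_cases h3 : a = d
      · subst h3
        simp [ind, h1, Ne.symm h1]
      · by_cases h4 : b = d
        · subst h4
          simp [ind, h1, Ne.symm h1]
        · simp [ind, h1, h3, h4, Ne.symm h1, Ne.symm h3, Ne.symm h4]
    · by_cases h3 : a = d
      · subst h3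
        by_cases h4 : b = c
        · subst h4
          simp [ind, h1, Ne.symm h1]
        · simp [ind, h1, h2, h4, Ne.symm h1, Ne.symm h2]
      · by_cases h4 : b = c
        · subst h4
          by_cases h5 : b = d
          · subst h5
            simp [ind, h1, Ne.symm h1]
          · simp [ind, h1, h3, h5, Ne.symm h1, Ne.symm h3, Ne.symm h5]
        · by_cases h5 : b = d
          · subst h5
            simp [ind, h1, h2, h4, Ne.symm h1, Ne.symm h2, Ne.symm h4]
          · by_cases h6 : c = d
            · subst h6
              simp [ind, h1, h2, h4, Ne.symm h2, Ne.symm h4]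
            · simp [ind, h1, h2, h3, h4, h5, h6, Ne.symm h2, Ne.symm h3, Ne.symm h5]

/-- The border of the `3 × 3` matrix is the vector of the differences `X i ⬝ᵥ z - X 0 ⬝ᵥ z`. As the
last one is not zero, the determinant is a unit times `x y - w²` with free `x` and `y`, and `w`
affine in the two other variables. -/
lemma card_cube_dvd_starCount_four_of_corankOne {C Γ : Matrix m m F} {κ : F} {z : m → F}
    (h1 : CorankOne C κ z Γ) (X : Matrix (Fin 4) m F) (h03 : X 0 ⬝ᵥ z ≠ X 3 ⬝ᵥ z) :
    (Nat.card F : ℤ) ^ 3 ∣ starCount X C + Nat.card F ^ 2 *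
      ind ((X 0 ⬝ᵥ z = X 1 ⬝ᵥ z ∧ X 2 ⬝ᵥ z = X 3 ⬝ᵥ z) ∨
        (X 0 ⬝ᵥ z = X 2 ⬝ᵥ z ∧ X 1 ⬝ᵥ z = X 3 ⬝ᵥ z)) := by
  obtain ⟨β, hβ⟩ : ∃ β : Fin 4 → F, ∀ i, X i ⬝ᵥ z = β i := ⟨_, fun _ => rfl⟩
  obtain ⟨ρ, hρ⟩ : ∃ ρ : Fin 3 → Fin 3 → F, ∀ i j, rowDiff X i ⬝ᵥ Γ.mulVec (rowDiff X j) = ρ i j :=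
    ⟨_, fun _ _ => rfl⟩
  have hcomm : ∀ i j, ρ i j = ρ j i := fun i j => by
    rw [← hρ, ← hρ]; exact dotProduct_mulVec_comm h1.transpose_eq _ _
  simp only [hβ] at h03 ⊢
  obtain ⟨u, hu⟩ : ∃ u, u = β 3 - β 0 := ⟨_, rfl⟩
  have hu0 : u ≠ 0 := by rw [hu]; exact sub_ne_zero.2 (Ne.symm h03)
  obtain ⟨s, hs⟩ : ∃ s, s = -(β 1 - β 0) / u := ⟨_, rfl⟩
  obtain ⟨t, ht⟩ : ∃ t, t = -(β 2 - β 0) / u := ⟨_, rfl⟩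
  have hx : (fun i : Fin 3 => β i.succ - β 0) = ![-s * u, -t * u, u] := by
    funext i
    fin_cases i
    · simp only [hs]; simp [hu0]
    · simp only [ht]; simp [hu0]
    · exact hu.symm
  have h : ∀ α : Fin 4 → F, (starMatrix (Matrix.diagonal α) X X C).det = 0 ↔
      (α 1 + (α 0 - ρ 0 0 + 2 * s * (α 0 - ρ 0 2) + s ^ 2 * (α 3 + α 0 - ρ 2 2)))
        * (α 2 + (α 0 - ρ 1 1 + 2 * t * (α 0 - ρ 1 2) + t ^ 2 * (α 3 + α 0 - ρ 2 2)))
        - (s * t * α 3 + (1 + s) * (1 + t) * α 0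
          + -(ρ 0 1 + t * ρ 0 2 + s * ρ 1 2 + s * t * ρ 2 2)) ^ 2 = 0 := by
    intro α
    rw [det_starMatrix_diagonal_of_corankOne h1]
    simp only [hβ, hρ]
    have hx' : ∀ i : Fin 3, β i.succ - β 0 = ![-s * u, -t * u, u] i := congrFun hx
    simp only [hx']
    rw [det_bordered_fin_three_eq, mul_eq_zero, or_iff_right (neg_ne_zero.2 (pow_ne_zero 2 hu0))]
    · refine iff_of_eq (congrArg (· = 0) ?_)
      change (α 1 + α 0 - ρ 0 0 + 2 * s * (0 + α 0 - ρ 0 2) + s ^ 2 * (α 3 + α 0 - ρ 2 2))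
        * (α 2 + α 0 - ρ 1 1 + 2 * t * (0 + α 0 - ρ 1 2) + t ^ 2 * (α 3 + α 0 - ρ 2 2))
        - (0 + α 0 - ρ 0 1 + t * (0 + α 0 - ρ 0 2) + s * (0 + α 0 - ρ 1 2)
          + s * t * (α 3 + α 0 - ρ 2 2)) ^ 2 = _
      ring
    · ext i j
      simp only [Matrix.transpose_apply, Matrix.of_apply, hcomm j i]
      by_cases hij : i = j
      · subst hij; rfl
      · rw [if_neg hij, if_neg (Ne.symm hij)]
  have hcount : starCount X C = ∑ w : F, ∑ x : F, ((Nat.card F : ℤ) - 1 + Nat.card F *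
      ind (s * t * w + (1 + s) * (1 + t) * x
        + -(ρ 0 1 + t * ρ 0 2 + s * ρ 1 2 + s * t * ρ 2 2) = 0)) := by
    rw [starCount, count_congr h, count_fin_four]
    simp only [Matrix.cons_val]
    refine (Finset.sum_congr rfl fun x _ => (Finset.sum_congr rfl fun y _ =>
      Finset.sum_comm).trans Finset.sum_comm).trans (Finset.sum_comm.trans ?_)
    refine Finset.sum_congr rfl fun w _ => Finset.sum_congr rfl fun x _ => ?_
    exact sum_ind_add_mul_add_eq_sq _ _ _
  have htype : (s * t = 0 ∧ (1 + s) * (1 + t) = 0) ↔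
      ((β 0 = β 1 ∧ β 2 = β 3) ∨ (β 0 = β 2 ∧ β 1 = β 3)) := by
    have e1 : s = 0 ↔ β 0 = β 1 := by
      rw [hs, div_eq_zero_iff, or_iff_left hu0, neg_eq_zero, sub_eq_zero, eq_comm]
    have e2 : t = 0 ↔ β 0 = β 2 := by
      rw [ht, div_eq_zero_iff, or_iff_left hu0, neg_eq_zero, sub_eq_zero, eq_comm]
    have e3 : 1 + s = 0 ↔ β 1 = β 3 := by
      rw [hs, neg_div, ← sub_eq_add_neg, sub_eq_zero, eq_div_iff hu0, one_mul, hu, sub_left_inj,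
        eq_comm]
    have e4 : 1 + t = 0 ↔ β 2 = β 3 := by
      rw [ht, neg_div, ← sub_eq_add_neg, sub_eq_zero, eq_div_iff hu0, one_mul, hu, sub_left_inj,
        eq_comm]
    rw [mul_eq_zero, mul_eq_zero, e1, e2, e3, e4]
    constructor
    · rintro ⟨h | h, h' | h'⟩
      · exact absurd (h.trans h') h03
      · exact Or.inl ⟨h, h'⟩
      · exact Or.inr ⟨h, h'⟩
      · exact absurd (h.trans h') h03
    · rintro (⟨h, h'⟩ | ⟨h, h'⟩)
      · exact ⟨Or.inl h, Or.inr h'⟩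
      · exact ⟨Or.inr h, Or.inl h'⟩
  obtain ⟨d, hd⟩ := card_cube_dvd_sum_ind_linear_form (s * t) ((1 + s) * (1 + t))
    (-(ρ 0 1 + t * ρ 0 2 + s * ρ 1 2 + s * t * ρ 2 2))
  rw [hcount, ← ind_congr htype]
  simp only [Finset.sum_add_distrib, ← Finset.mul_sum, sum_const_card]
  exact ⟨1 + d, by linear_combination hd⟩

/-- The fibres over the variables of the edges at a 4-valent vertex. For invertible `C` the
determinant is one of a symmetric `3 × 3` matrix; in corank one it is a bordered one, which depends
on the coincidences among the numbers `X i ⬝ᵥ z`, and in corank two or more it is an affine form. -/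
lemma card_cube_dvd_starCount_four {C : Matrix m m F} (hsymm : C.transpose = C)
    (X : Matrix (Fin 4) m F) :
    (Nat.card F : ℤ) ^ 3 ∣ starCount X C - (-2 * Nat.card F * ind (C.det ≠ 0) + Nat.card F ^ 2 *
      (ind (borderedForm C (X 1 - X 3) (X 0 - X 2) = 0)
        + ind (borderedForm C (X 1 - X 2) (X 0 - X 3) = 0)
        + ind (borderedForm C (X 2 - X 3) (X 0 - X 1) = 0)
        + ind (C.det = 0 ∧ borderedForm C (X 1 - X 3) (X 1 - X 3) = 0)
        + ind (C.det = 0 ∧ borderedForm C (X 0 - X 2) (X 0 - X 2) = 0)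
        - ind (borderedForm C (X 1 - X 3) (X 0 - X 2) = 0 ∧
          borderedForm C (X 1 - X 2) (X 0 - X 3) = 0)
        - ∑ i : Fin 4, ind (C.det = 0 ∧
          borderedForm C (X (i + 1) - X (i + 2)) (X i - X (i + 2)) = 0))) := by
  rcases symmetric_trichotomy hsymm with hC | ⟨hC, κ, z, Γ, h1⟩ | ⟨hC, w, hw, hCw⟩
  · have hn : ∀ P : Prop, ind (C.det = 0 ∧ P) = 0 := fun P => ind_of_not fun h => hC h.1
    simp only [hn, Finset.sum_const_zero]
    rw [starCount_four_of_det_ne_zero hsymm hC, ind_of hC]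
    exact ⟨1, by ring⟩
  · -- the claim for an arbitrary nonconstant `β`, by exchanging two edges
    have hmain : ¬ (X 1 ⬝ᵥ z = X 0 ⬝ᵥ z ∧ X 2 ⬝ᵥ z = X 0 ⬝ᵥ z ∧ X 3 ⬝ᵥ z = X 0 ⬝ᵥ z) →
        (Nat.card F : ℤ) ^ 3 ∣ starCount X C + Nat.card F ^ 2 *
          ind ((X 0 ⬝ᵥ z = X 1 ⬝ᵥ z ∧ X 2 ⬝ᵥ z = X 3 ⬝ᵥ z) ∨
            (X 0 ⬝ᵥ z = X 2 ⬝ᵥ z ∧ X 1 ⬝ᵥ z = X 3 ⬝ᵥ z) ∨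
            (X 0 ⬝ᵥ z = X 3 ⬝ᵥ z ∧ X 1 ⬝ᵥ z = X 2 ⬝ᵥ z)) := by
      intro hne
      by_cases h3 : X 0 ⬝ᵥ z = X 3 ⬝ᵥ z
      · by_cases h2 : X 0 ⬝ᵥ z = X 2 ⬝ᵥ z
        · have h1' : X 0 ⬝ᵥ z ≠ X 1 ⬝ᵥ z := fun h => hne ⟨h.symm, h2.symm, h3.symm⟩
          have := card_cube_dvd_starCount_four_of_corankOne h1
            (X.submatrix (Equiv.swap 1 3) id) h1'
          rw [starCount_submatrix] at this
          convert this using 3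
          refine ind_congr ?_
          change _ ↔ ((X 0 ⬝ᵥ z = X 3 ⬝ᵥ z ∧ X 2 ⬝ᵥ z = X 1 ⬝ᵥ z) ∨
            (X 0 ⬝ᵥ z = X 2 ⬝ᵥ z ∧ X 3 ⬝ᵥ z = X 1 ⬝ᵥ z))
          rw [eq_comm (a := X 2 ⬝ᵥ z) (b := X 1 ⬝ᵥ z), eq_comm (a := X 3 ⬝ᵥ z) (b := X 1 ⬝ᵥ z)]
          tauto
        · have := card_cube_dvd_starCount_four_of_corankOne h1
            (X.submatrix (Equiv.swap 2 3) id) h2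
          rw [starCount_submatrix] at this
          convert this using 3
          refine ind_congr ?_
          change _ ↔ ((X 0 ⬝ᵥ z = X 1 ⬝ᵥ z ∧ X 3 ⬝ᵥ z = X 2 ⬝ᵥ z) ∨
            (X 0 ⬝ᵥ z = X 3 ⬝ᵥ z ∧ X 1 ⬝ᵥ z = X 2 ⬝ᵥ z))
          rw [eq_comm (a := X 3 ⬝ᵥ z) (b := X 2 ⬝ᵥ z)]
          tauto
      · have := card_cube_dvd_starCount_four_of_corankOne h1 X h3
        convert this using 3
        refine ind_congr ?_
        tauto
    have hb : ∀ i j k l : Fin 4, borderedForm C (X i - X j) (X k - X l) = 0 ↔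
        X i ⬝ᵥ z = X j ⬝ᵥ z ∨ X k ⬝ᵥ z = X l ⬝ᵥ z := by
      intro i j k l
      rw [h1.borderedForm_eq_zero_iff, sub_dotProduct, sub_dotProduct, sub_eq_zero, sub_eq_zero]
    have hidx : (0 + 1 : Fin 4) = 1 ∧ (0 + 2 : Fin 4) = 2 ∧ (1 + 1 : Fin 4) = 2 ∧
        (1 + 2 : Fin 4) = 3 ∧ (2 + 1 : Fin 4) = 3 ∧ (2 + 2 : Fin 4) = 0 ∧ (3 + 1 : Fin 4) = 0 ∧
        (3 + 2 : Fin 4) = 1 := by decide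
    simp only [Fin.sum_univ_four, hidx, hb, hC, true_and, or_self, ne_eq, not_true_eq_false]
    obtain ⟨β, hβ⟩ : ∃ β : Fin 4 → F, ∀ i, X i ⬝ᵥ z = β i := ⟨_, fun _ => rfl⟩
    simp only [hβ] at hmain ⊢
    by_cases hall : β 1 = β 0 ∧ β 2 = β 0 ∧ β 3 = β 0
    · obtain ⟨e1, e2, e3⟩ := hall
      have hconst : ∀ i j, β i = β j := by
        intro i j
        fin_cases i <;> fin_cases j <;> simp [e1, e2, e3]
      have hz : ∀ α : Fin 4 → F, (starMatrix (Matrix.diagonal α) X X C).det = 0 := by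
        intro α
        rw [det_starMatrix_diagonal_of_corankOne h1]
        simp only [hβ, hconst _ 0, sub_self]
        refine Matrix.det_eq_zero_of_row_eq_zero (Sum.inr ()) ?_
        rintro (j | j) <;> rfl
      rw [starCount, count_true hz, Nat.card_fun, Nat.card_fin]
      have hi : ∀ i j, ind (β i = β j) = 1 := fun i j => ind_of (hconst i j)
      have hii : ∀ i j k l, ind (β i = β j ∨ β k = β l) = 1 := fun i j k l =>
        ind_of (Or.inl (hconst i j))
      have hf : ind False = 0 := ind_of_not id
      simp only [hi, hii, hf]
      rw [ind_of ⟨Or.inl (hconst _ _), Or.inl (hconst _ _)⟩]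
      exact ⟨Nat.card F, by push_cast; ring⟩
    · obtain ⟨d, hd⟩ := hmain hall
      refine ⟨d, ?_⟩
      rw [← hd]
      have hf : ind False = 0 := ind_of_not id
      rw [hf]
      linear_combination (-(Nat.card F : ℤ) ^ 2) * sum_ind_coincidences hall
  · obtain ⟨p, c, h, -⟩ := exists_affine_of_kernel le_rfl X hw hCw
    simp only [borderedForm_eq_zero hw hCw, hC, and_self, Finset.sum_const]
    rw [starCount, count_congr fun α => by rw [h α], ind_of trivial, ind_of_not (by simp)]
    simpa using card_pow_dvd_count_affine p c

end LocalCounts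

section TotalCounts

variable {F : Type*} [Field F] [Fintype F] {ε ν : Type*} [Fintype ε] [DecidableEq ε] [Fintype ν]
  [DecidableEq ν]

lemma vertexRow_sub {ε ν F : Type*} [Field F] (r s : ν → F) :
    (vertexRow r - vertexRow s : ε ⊕ ν → F) = vertexRow (r - s) := by
  funext i
  rcases i with i | i <;> simp [vertexRow]

/-- The rows of the edges at a vertex. -/
def vertexRows {ρ ε ν F : Type*} [Zero F] (R : Matrix ρ ν F) : Matrix ρ (ε ⊕ ν) F :=
  Matrix.of fun i => vertexRow (R i)

lemma vertexRows_sub {ρ ε ν F : Type*} [Field F] (R : Matrix ρ ν F) (i j : ρ) :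
    (vertexRows R i - vertexRows R j : ε ⊕ ν → F) = vertexRow (R i - R j) :=
  vertexRow_sub (R i) (R j)

/-- Of the contributions of `card_cube_dvd_starCount_three`, only the form with two different
arguments survives the summation. -/
lemma card_cube_dvd_sum_starCount_three [Nonempty ε] (hν : 2 ≤ Fintype.card ν)
    (E : Matrix ε ν F) (R : Matrix (Fin 3) ν F) :
    (Nat.card F : ℤ) ^ 3 ∣ ∑ a : ε → F, starCount (vertexRows R) (configMatrix E a)
      - Nat.card F ^ 2 * count fun a : ε → F => (configMatrix E a).det = 0 ∧
        borderedForm (configMatrix E a) (vertexRow (R 1 - R 2)) (vertexRow (R 0 - R 2)) = 0 := by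
  have h := Finset.dvd_sum fun (a : ε → F) (_ : a ∈ Finset.univ) =>
    card_cube_dvd_starCount_three (transpose_configMatrix E a) (vertexRows R)
  simp only [vertexRows_sub, Finset.sum_sub_distrib, ← Finset.mul_sum, Finset.sum_add_distrib,
    ← count_eq_sum] at h
  have h1 : (∑ _a : ε → F, (1 : ℤ)) = (Nat.card F : ℤ) ^ Fintype.card ε := by
    simp [Nat.card_eq_fintype_card]
  rw [h1] at h
  obtain ⟨d, hd⟩ := h
  obtain ⟨d1, hd1⟩ := card_dvd_count_both_eq_zero hν E (R 1 - R 2)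
  obtain ⟨d2, hd2⟩ := card_dvd_count_both_eq_zero hν E (R 0 - R 2)
  obtain ⟨d3, hd3⟩ := dvd_pow_self (Nat.card F : ℤ) (Fintype.card_ne_zero (α := ε))
  rw [hd1, hd2, hd3] at hd
  exact ⟨d + d3 - d1 - d2, by linear_combination hd⟩

/-- The contributions of `card_cube_dvd_starCount_four` with a form of equal arguments vanish after
summation, and so do those of the single forms, by the hypotheses. -/
lemma card_cube_dvd_sum_starCount_four [Nonempty ε] (hν : 2 ≤ Fintype.card ν)
    (E : Matrix ε ν F) (R : Matrix (Fin 4) ν F)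
    (h1 : (Nat.card F : ℤ) ∣ count fun a : ε → F =>
      borderedForm (configMatrix E a) (vertexRow (R 1 - R 3)) (vertexRow (R 0 - R 2)) = 0)
    (h2 : (Nat.card F : ℤ) ∣ count fun a : ε → F =>
      borderedForm (configMatrix E a) (vertexRow (R 1 - R 2)) (vertexRow (R 0 - R 3)) = 0)
    (h3 : (Nat.card F : ℤ) ∣ count fun a : ε → F =>
      borderedForm (configMatrix E a) (vertexRow (R 2 - R 3)) (vertexRow (R 0 - R 1)) = 0) :
    (Nat.card F : ℤ) ^ 3 ∣ ∑ a : ε → F, starCount (vertexRows R) (configMatrix E a)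
      + Nat.card F ^ 2 * ((count fun a : ε → F =>
          borderedForm (configMatrix E a) (vertexRow (R 1 - R 3)) (vertexRow (R 0 - R 2)) = 0 ∧
          borderedForm (configMatrix E a) (vertexRow (R 1 - R 2)) (vertexRow (R 0 - R 3)) = 0)
        + ∑ i : Fin 4, count fun a : ε → F => (configMatrix E a).det = 0 ∧
          borderedForm (configMatrix E a) (vertexRow (R (i + 1) - R (i + 2)))
            (vertexRow (R i - R (i + 2))) = 0) := by
  have h := Finset.dvd_sum fun (a : ε → F) (_ : a ∈ Finset.univ) =>
    card_cube_dvd_starCount_four (transpose_configMatrix E a) (vertexRows R)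
  simp only [vertexRows_sub, Finset.sum_sub_distrib, ← Finset.mul_sum, Finset.sum_add_distrib]
    at h
  rw [Finset.sum_comm] at h
  simp only [← count_eq_sum] at h
  obtain ⟨d, hd⟩ := h
  obtain ⟨d1, hd1⟩ := h1
  obtain ⟨d2, hd2⟩ := h2
  obtain ⟨d3, hd3⟩ := h3
  obtain ⟨d4, hd4⟩ := card_dvd_count_both_eq_zero hν E (R 1 - R 3)
  obtain ⟨d5, hd5⟩ := card_dvd_count_both_eq_zero hν E (R 0 - R 2)
  obtain ⟨d6, hd6⟩ := card_sq_dvd_count_det_ne_zero hν E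
  rw [hd1, hd2, hd3, hd4, hd5, hd6] at hd
  exact ⟨d - 2 * d6 + d1 + d2 + d3 + d4 + d5, by linear_combination hd⟩

end TotalCounts

/-! ### Dodgson polynomials and kernels -/

lemma det_submatrix_eq_zero_iff {F p ι : Type*} [Field F] [Fintype p] [Fintype ι] [DecidableEq ι]
    (M : Matrix p p F) (f : ι → p) {g : ι → p} (hg : Function.Injective g) :
    (M.submatrix f g).det = 0 ↔
      ∃ v : p → F, v ≠ 0 ∧ (∀ j, j ∉ Set.range g → v j = 0) ∧ ∀ i, M.mulVec v (f i) = 0 := by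
  classical
  have hsum : ∀ (v : p → F), (∀ j, j ∉ Set.range g → v j = 0) → ∀ i,
      M.mulVec v (f i) = (M.submatrix f g).mulVec (v ∘ g) i := by
    intro v hv i
    symm
    refine Fintype.sum_of_injective g hg _ _ (fun j hj => ?_) fun j => rfl
    rw [hv j hj, mul_zero]
  rw [← Matrix.exists_mulVec_eq_zero_iff]
  constructor
  · rintro ⟨v, hv, hMv⟩
    have hext : ∀ j, j ∉ Set.range g → Function.extend g v 0 j = 0 := fun j hj =>
      Function.extend_apply' _ _ _ hj
    have hcomp : Function.extend g v 0 ∘ g = v := Function.extend_comp hg v 0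
    refine ⟨Function.extend g v 0, ?_, hext, fun i => ?_⟩
    · intro h
      apply hv
      rw [← hcomp, h]
      rfl
    · rw [hsum _ hext, hcomp, hMv]
      rfl
  · rintro ⟨v, hv, hv0, hMv⟩
    refine ⟨v ∘ g, ?_, funext fun i => by rw [← hsum v hv0, hMv]; rfl⟩
    intro h
    apply hv
    funext j
    by_cases hj : j ∈ Set.range g
    · obtain ⟨i, rfl⟩ := hj
      exact congrFun h i
    · exact hv0 j hj

namespace FeynmanGraph

variable {n N : ℕ} (G : FeynmanGraph n N)

/-- The entries of the incidence matrix of the graph, including the column of the last vertex. -/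
def inc (F : Type*) [Ring F] (d : Fin N) (u : Fin (n + 1)) : F :=
  (if G.src d = u then 1 else 0) - (if G.tgt d = u then 1 else 0)

/-- The matrix of the graph at the point `a`, without deletion of a vertex. -/
def fullMatrix {F : Type*} [Ring F] (K : Finset (Fin N)) (a : Fin N → F) :
    Matrix (Fin N ⊕ Fin (n + 1)) (Fin N ⊕ Fin (n + 1)) F :=
  Matrix.fromBlocks (Matrix.diagonal fun d => if d ∈ K then 0 else a d) (Matrix.of (G.inc F))
    (Matrix.of fun u d => -G.inc F d u) 0

variable {F : Type*} [Field F]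

lemma fullMatrix_mulVec_inl (K : Finset (Fin N)) (a : Fin N → F) (v : Fin N ⊕ Fin (n + 1) → F)
    (d : Fin N) :
    (G.fullMatrix K a).mulVec v (Sum.inl d) = (if d ∈ K then 0 else a d) * v (Sum.inl d)
      + (v (Sum.inr (G.src d)) - v (Sum.inr (G.tgt d))) := by
  rw [fullMatrix, Matrix.fromBlocks_mulVec, Sum.elim_inl, Pi.add_apply, Matrix.mulVec_diagonal]
  congr 1
  simp [Matrix.mulVec, dotProduct, inc, sub_mul, Finset.sum_sub_distrib]

lemma fullMatrix_mulVec_inr (K : Finset (Fin N)) (a : Fin N → F) (v : Fin N ⊕ Fin (n + 1) → F)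
    (u : Fin (n + 1)) : (G.fullMatrix K a).mulVec v (Sum.inr u)
      = -∑ d, G.inc F d u * v (Sum.inl d) := by
  rw [fullMatrix, Matrix.fromBlocks_mulVec, Sum.elim_inr, Matrix.zero_mulVec, add_zero]
  simp [Matrix.mulVec, dotProduct]

lemma sum_inc (d : Fin N) : ∑ u, G.inc F d u = 0 := by
  simp [inc]

/-- `v` is a nonzero kernel vector of the matrix with rows `I`, columns `J` and the vertex `w`
removed, extended by zero to the removed columns. -/
def MinorKernel (I J K : Finset (Fin N)) (w : Fin (n + 1)) (a : Fin N → F)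
    (v : Fin N ⊕ Fin (n + 1) → F) : Prop :=
  v ≠ 0 ∧ (∀ d ∈ J, v (Sum.inl d) = 0) ∧ v (Sum.inr w) = 0 ∧
    (∀ d ∉ I, (G.fullMatrix K a).mulVec v (Sum.inl d) = 0) ∧
    ∀ u, u ≠ w → (G.fullMatrix K a).mulVec v (Sum.inr u) = 0

/-- The choice of the removed vertex does not matter: vectors can be shifted by the vector that is
constant on the vertices, and the vertex rows add up to zero. -/
lemma MinorKernel.change_vertex {I J K : Finset (Fin N)} {w : Fin (n + 1)} {a : Fin N → F}
    {v : Fin N ⊕ Fin (n + 1) → F} (h : G.MinorKernel I J K w a v) (w' : Fin (n + 1)) :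
    ∃ v', G.MinorKernel I J K w' a v' := by
  obtain ⟨hv, hJ, hw, hI, hu⟩ := h
  have hall : ∀ u, (G.fullMatrix K a).mulVec v (Sum.inr u) = 0 := by
    intro u
    by_cases huw : u = w
    · have hsum : ∑ u, (G.fullMatrix K a).mulVec v (Sum.inr u) = 0 := by
        simp only [fullMatrix_mulVec_inr, Finset.sum_neg_distrib, neg_eq_zero]
        rw [Finset.sum_comm]
        simp only [← Finset.sum_mul, sum_inc, zero_mul, Finset.sum_const_zero]
      rw [Finset.sum_eq_single w (fun u _ h => hu u h) (by simp)] at hsum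
      rw [huw, hsum]
    · exact hu u huw
  let c := v (Sum.inr w')
  let v' : Fin N ⊕ Fin (n + 1) → F :=
    Sum.elim (fun d => v (Sum.inl d)) fun u => v (Sum.inr u) - c
  refine ⟨v', ?_, hJ, sub_self _, fun d hd => ?_, fun u _ => ?_⟩
  · intro h0
    have hc : c = 0 := by
      have := congrFun h0 (Sum.inr w)
      simpa [v', hw] using this
    apply hv
    funext i
    have := congrFun h0 i
    rcases i with i | i
    · exact this
    · simpa [v', hc] using this
  · have := hI d hd
    rw [fullMatrix_mulVec_inl] at this ⊢
    simpa [v'] using this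
  · have := hall u
    rw [fullMatrix_mulVec_inr] at this ⊢
    exact this

lemma det_submatrix_fullMatrix_eq_zero_iff {ι : Type*} [Fintype ι] [DecidableEq ι]
    {I J : Finset (Fin N)} (K : Finset (Fin N)) {w : Fin (n + 1)} (a : Fin N → F)
    {f g : ι → Fin N ⊕ Fin (n + 1)} (hg : Function.Injective g)
    (hfl : ∀ d, Sum.inl d ∈ Set.range f ↔ d ∉ I) (hfr : ∀ u, Sum.inr u ∈ Set.range f ↔ u ≠ w)
    (hgl : ∀ d, Sum.inl d ∈ Set.range g ↔ d ∉ J) (hgr : ∀ u, Sum.inr u ∈ Set.range g ↔ u ≠ w) :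
    ((G.fullMatrix K a).submatrix f g).det = 0 ↔ ∃ v, G.MinorKernel I J K w a v := by
  rw [det_submatrix_eq_zero_iff _ _ hg]
  refine exists_congr fun v => and_congr_right fun _ => ?_
  constructor
  · rintro ⟨h1, h2⟩
    refine ⟨fun d hd => h1 _ fun h => (hgl d).1 h hd, h1 _ fun h => (hgr w).1 h rfl,
      fun d hd => ?_, fun u hu => ?_⟩
    · obtain ⟨i, hi⟩ := (hfl d).2 hd
      rw [← hi]; exact h2 i
    · obtain ⟨i, hi⟩ := (hfr u).2 hu
      rw [← hi]; exact h2 i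
  · rintro ⟨h1, h2, h3, h4⟩
    refine ⟨?_, fun i => ?_⟩
    · rintro (d | u) h
      · exact h1 d (by by_contra hd; exact h ((hgl d).2 hd))
      · have : u = w := by by_contra hu; exact h ((hgr u).2 hu)
        rw [this, h2]
    · have hi : f i ∈ Set.range f := ⟨i, rfl⟩
      rcases hfi : f i with d | u
      · exact h3 d ((hfl d).1 (hfi ▸ hi))
      · exact h4 u ((hfr u).1 (hfi ▸ hi))

lemma aeval_graphMatrix (K : Finset (Fin N)) (a : Fin N → F) :
    (G.graphMatrix K).map (aeval a) = (G.fullMatrix K a).submatrix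
      (Sum.map id Fin.castSucc) (Sum.map id Fin.castSucc) := by
  ext (d | u) (d' | u')
  · simp only [graphMatrix, fullMatrix, Matrix.map_apply, Matrix.fromBlocks_apply₁₁,
      Matrix.submatrix_apply, Sum.map_inl, id, Matrix.diagonal_apply]
    split_ifs <;> simp
  · simp only [graphMatrix, fullMatrix, Matrix.map_apply, Matrix.fromBlocks_apply₁₂,
      Matrix.submatrix_apply, Sum.map_inl, Sum.map_inr, id, incidence, inc, Matrix.of_apply]
    split_ifs <;> simp
  · simp only [graphMatrix, fullMatrix, Matrix.map_apply, Matrix.fromBlocks_apply₂₁,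
      Matrix.submatrix_apply, Sum.map_inl, Sum.map_inr, id, incidence, inc, Matrix.of_apply,
      Matrix.neg_apply, Matrix.transpose_apply]
    split_ifs <;> simp
  · simp [graphMatrix, fullMatrix]

lemma aeval_dodgson_eq_zero_iff {I J : Finset (Fin N)} (hIJ : I.card = J.card)
    (K : Finset (Fin N)) (w : Fin (n + 1)) (a : Fin N → F) :
    aeval a (G.dodgson I J K) = 0 ↔ ∃ v, G.MinorKernel I J K w a v := by
  have h : Jᶜ.card = Iᶜ.card := by rw [Finset.card_compl, Finset.card_compl, hIJ]
  have hcs : ∀ u : Fin (n + 1), u ∈ Set.range (Fin.castSucc : Fin n → Fin (n + 1)) ↔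
      u ≠ Fin.last n := by
    intro u
    rw [Fin.range_castSucc, Set.mem_ofPred_eq, ← Fin.lt_last_iff_ne_last, Fin.lt_def, Fin.val_last]
  have hmain : aeval a (G.dodgson I J K) = 0 ↔ ∃ v, G.MinorKernel I J K (Fin.last n) a v := by
    rw [dodgson, dif_pos h, AlgHom.map_det, AlgHom.mapMatrix_apply, ← Matrix.submatrix_map,
      aeval_graphMatrix, Matrix.submatrix_submatrix, det_submatrix_fullMatrix_eq_zero_iff]
    · exact (Function.Injective.sumMap Function.injective_id (Fin.castSucc_injective n)).comp
        (Function.Injective.sumMap (Finset.orderEmbOfFin _ h).injective Function.injective_id)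
    · intro d
      have : d ∈ Set.range (Iᶜ.orderEmbOfFin rfl) ↔ d ∉ I := by
        rw [Finset.range_orderEmbOfFin]; simp
      refine Iff.trans ?_ this
      simp only [Set.mem_range, Function.comp_apply, Sum.exists, Sum.map_inl, Sum.map_inr,
        Sum.inl.injEq, reduceCtorEq, exists_false, or_false, id]
    · intro u
      refine Iff.trans ?_ (hcs u)
      simp only [Set.mem_range, Function.comp_apply, Sum.exists, Sum.map_inl, Sum.map_inr,
        Sum.inr.injEq, reduceCtorEq, exists_false, false_or, id]
    · intro d
      have : d ∈ Set.range (Jᶜ.orderEmbOfFin h) ↔ d ∉ J := by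
        rw [Finset.range_orderEmbOfFin]; simp
      refine Iff.trans ?_ this
      simp only [Set.mem_range, Function.comp_apply, Sum.exists, Sum.map_inl, Sum.map_inr,
        Sum.inl.injEq, reduceCtorEq, exists_false, or_false, id]
    · intro u
      refine Iff.trans ?_ (hcs u)
      simp only [Set.mem_range, Function.comp_apply, Sum.exists, Sum.map_inl, Sum.map_inr,
        Sum.inr.injEq, reduceCtorEq, exists_false, false_or, id]
  rw [hmain]
  exact ⟨fun ⟨v, hv⟩ => hv.change_vertex G w, fun ⟨v, hv⟩ => hv.change_vertex G _⟩

end FeynmanGraph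

/-! ### The edges at a vertex -/

namespace FeynmanGraph

variable {n N : ℕ} (G : FeynmanGraph n N)

lemma mem_otherEdges {k : ℕ} {e : Fin k ↪ Fin N} {d : Fin N} :
    d ∈ otherEdges e ↔ ∀ i, d ≠ e i := by
  simp [otherEdges, eq_comm]

/-- A `k`-valent vertex with `k` different incident edges has no other edge and no self-loop. -/
lemma IsVertexWithEdges.ends {G : FeynmanGraph n N} {k : ℕ} {v : Fin (n + 1)} {e : Fin k ↪ Fin N}
    (h : G.IsVertexWithEdges v e) :
    (∀ i, (G.src (e i) = v ∧ G.tgt (e i) ≠ v) ∨ (G.src (e i) ≠ v ∧ G.tgt (e i) = v)) ∧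
      ∀ d ∈ otherEdges e, G.src d ≠ v ∧ G.tgt d ≠ v := by
  obtain ⟨hval, hinc⟩ := h
  let c : Fin N → ℕ := fun d => (if G.src d = v then 1 else 0) + (if G.tgt d = v then 1 else 0)
  have hsum : ∑ i, c (e i) + ∑ d ∈ otherEdges e, c d = k := by
    refine Eq.trans ?_ hval
    rw [valency, ← Finset.sum_map Finset.univ e c, otherEdges,
      Finset.sum_add_sum_compl]
  have hone : ∀ i, 1 ≤ c (e i) := by
    intro i
    rcases hinc i with h | h <;> simp [c, h]
  have hge : k ≤ ∑ i, c (e i) := by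
    have := Finset.sum_le_sum fun i (_ : i ∈ Finset.univ) => hone i
    simpa using this
  have hother : ∑ d ∈ otherEdges e, c d = 0 := by omega
  have heq : ∀ i, c (e i) = 1 := by
    by_contra hcon
    push Not at hcon
    obtain ⟨i, hi⟩ := hcon
    have := Finset.sum_lt_sum (fun i (_ : i ∈ Finset.univ) => hone i)
      ⟨i, Finset.mem_univ i, lt_of_le_of_ne (hone i) (Ne.symm hi)⟩
    simp only [Finset.sum_const, Finset.card_univ, Fintype.card_fin, smul_eq_mul, mul_one] at this
    omega
  constructor
  · intro i
    have := heq i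
    simp only [c] at this
    by_cases h1 : G.src (e i) = v <;> by_cases h2 : G.tgt (e i) = v <;> simp_all
  · intro d hd
    have := Finset.sum_eq_zero_iff.1 hother d hd
    simp only [c] at this
    by_cases h1 : G.src d = v <;> by_cases h2 : G.tgt d = v <;> simp_all

/-- The sign of the orientation of an edge at the vertex `v`. -/
def outSign (F : Type*) [Ring F] (v : Fin (n + 1)) (d : Fin N) : F :=
  if G.src d = v then 1 else -1

lemma outSign_mul_self {F : Type*} [Ring F] (v : Fin (n + 1)) (d : Fin N) :
    G.outSign F v d * G.outSign F v d = 1 := by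
  unfold outSign
  split_ifs <;> simp

lemma outSign_ne_zero {F : Type*} [Field F] (v : Fin (n + 1)) (d : Fin N) :
    G.outSign F v d ≠ 0 := fun h => by
  have := G.outSign_mul_self (F := F) v d
  rw [h, zero_mul] at this
  exact zero_ne_one this

lemma IsVertexWithEdges.outSign_mul_inc {G : FeynmanGraph n N} {k : ℕ} {v : Fin (n + 1)}
    {e : Fin k ↪ Fin N} (h : G.IsVertexWithEdges v e) (F : Type*) [Ring F] (i : Fin k) :
    G.outSign F v (e i) * G.inc F (e i) v = 1 := by
  rcases h.ends.1 i with ⟨h1, h2⟩ | ⟨h1, h2⟩ <;> simp [outSign, inc, h1, h2]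

/-- The vertices other than `v` and `w`. -/
abbrev InnerVertex (v w : Fin (n + 1)) : Type := {u : Fin (n + 1) // u ≠ v ∧ u ≠ w}

lemma card_innerVertex {v w : Fin (n + 1)} (h : w ≠ v) :
    Fintype.card (InnerVertex v w) = n - 1 := by
  have h1 : (Finset.univ.filter fun u : Fin (n + 1) => u ≠ v ∧ u ≠ w) = {v, w}ᶜ := by
    ext u; simp
  rw [Fintype.card_subtype, h1, Finset.card_compl, Finset.card_pair h.symm, Fintype.card_fin]
  omega

/-- The incidence matrix of the edges that do not meet `v`. -/
def innerMatrix {k : ℕ} (F : Type*) [Ring F] (e : Fin k ↪ Fin N) (v w : Fin (n + 1)) :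
    Matrix (otherEdges e) (InnerVertex v w) F :=
  Matrix.of fun d u => G.inc F d.1 u.1

/-- The rows of the edges at `v`, oriented away from `v`. -/
def starRows {k : ℕ} (F : Type*) [Ring F] (e : Fin k ↪ Fin N) (v w : Fin (n + 1)) :
    Matrix (Fin k) (InnerVertex v w) F :=
  Matrix.of fun i u => G.outSign F v (e i) * G.inc F (e i) u.1

/-- The edges at `v` in the rows and columns of a star matrix, next to the vertex `v`, the other
edges, and the other vertices. -/
def starIndex {k l : ℕ} (e : Fin k ↪ Fin N) (v w : Fin (n + 1)) (r : Fin l → Fin k) :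
    Fin l ⊕ (Unit ⊕ (otherEdges e ⊕ InnerVertex v w)) → Fin N ⊕ Fin (n + 1) :=
  Sum.elim (fun i => Sum.inl (e (r i))) (Sum.elim (fun _ => Sum.inr v)
    (Sum.elim (fun d => Sum.inl d.1) fun u => Sum.inr u.1))

lemma starIndex_injective {k l : ℕ} (e : Fin k ↪ Fin N) {v w : Fin (n + 1)} {r : Fin l → Fin k}
    (hr : Function.Injective r) : Function.Injective (starIndex e v w r) := by
  have hd : ∀ (d : otherEdges e) i, d.1 ≠ e i := fun d => mem_otherEdges.1 d.2
  rintro (i | i | i | i) (j | j | j | j) h <;>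
    simp only [starIndex, Sum.elim_inl, Sum.elim_inr, Sum.inl.injEq, Sum.inr.injEq,
      reduceCtorEq] at h ⊢
  · exact hr (e.injective h)
  · exact hd j _ h.symm
  · exact j.2.1 h.symm
  · exact hd i _ h
  · exact Subtype.ext h
  · exact i.2.1 h
  · exact Subtype.ext h

lemma inl_mem_range_starIndex {k l : ℕ} (e : Fin k ↪ Fin N) (v w : Fin (n + 1))
    (r : Fin l → Fin k) (d : Fin N) :
    Sum.inl d ∈ Set.range (starIndex e v w r) ↔ d ∉ ((Finset.univ.image r)ᶜ.map e) := by
  constructor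
  · rintro ⟨i | i | i | i, h⟩ hd <;>
      simp only [starIndex, Sum.elim_inl, Sum.elim_inr, Sum.inl.injEq, reduceCtorEq] at h
    · subst h
      simp at hd
    · subst h
      obtain ⟨j, -, hj⟩ := Finset.mem_map.1 hd
      exact mem_otherEdges.1 i.2 j hj.symm
  · intro hd
    by_cases h : d ∈ otherEdges e
    · exact ⟨Sum.inr (Sum.inr (Sum.inl ⟨d, h⟩)), rfl⟩
    · rw [mem_otherEdges] at h
      push Not at h
      obtain ⟨i, rfl⟩ := h
      simp only [Finset.mem_map', Finset.mem_compl, Finset.mem_image, Finset.mem_univ, true_and,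
        not_not] at hd
      obtain ⟨j, rfl⟩ := hd
      exact ⟨Sum.inl j, rfl⟩

lemma inr_mem_range_starIndex {k l : ℕ} (e : Fin k ↪ Fin N) {v w : Fin (n + 1)} (hw : w ≠ v)
    (r : Fin l → Fin k) (u : Fin (n + 1)) :
    Sum.inr u ∈ Set.range (starIndex e v w r) ↔ u ≠ w := by
  constructor
  · rintro ⟨i | i | i | i, h⟩ <;>
      simp only [starIndex, Sum.elim_inl, Sum.elim_inr, Sum.inr.injEq, reduceCtorEq] at h
    · rw [← h]; exact hw.symm
    · rw [← h]; exact i.2.2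
  · intro hu
    by_cases huv : u = v
    · exact ⟨Sum.inr (Sum.inl ()), by rw [huv]; rfl⟩
    · exact ⟨Sum.inr (Sum.inr (Sum.inr ⟨u, huv, hu⟩)), rfl⟩

/-- A Dodgson polynomial with all its removed edges at the vertex `v` vanishes exactly when the
star matrix of the remaining edges at `v` is singular. -/
lemma IsVertexWithEdges.aeval_dodgson_eq_zero_iff {G : FeynmanGraph n N} {k l : ℕ}
    {v : Fin (n + 1)} {e : Fin k ↪ Fin N} (h : G.IsVertexWithEdges v e) {w : Fin (n + 1)}
    (hw : w ≠ v) {F : Type*} [Field F] {r c : Fin l → Fin k} (hr : Function.Injective r)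
    (hc : Function.Injective c) {I J K : Finset (Fin N)} (hI : I = (Finset.univ.image r)ᶜ.map e)
    (hJ : J = (Finset.univ.image c)ᶜ.map e) (hK : ∀ d ∈ otherEdges e, d ∉ K) (a : Fin N → F) :
    aeval a (G.dodgson I J K) = 0 ↔
      (starMatrix (Matrix.of fun i j => if r i = c j then
          (if e (r i) ∈ K then 0 else a (e (r i))) else 0)
        (vertexRows ((G.starRows F e v w).submatrix r id))
        (vertexRows ((G.starRows F e v w).submatrix c id))
        (configMatrix (G.innerMatrix F e v w) fun d => a d.1)).det = 0 := by
  have hcard : I.card = J.card := by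
    rw [hI, hJ, Finset.card_map, Finset.card_map, Finset.card_compl, Finset.card_compl,
      Finset.card_image_of_injective _ hr, Finset.card_image_of_injective _ hc]
  rw [G.aeval_dodgson_eq_zero_iff hcard K w a, ← G.det_submatrix_fullMatrix_eq_zero_iff K a
    (f := starIndex e v w r) (g := starIndex e v w c) (starIndex_injective e hc)
    (fun d => by rw [inl_mem_range_starIndex, hI]) (inr_mem_range_starIndex e hw r)
    (fun d => by rw [inl_mem_range_starIndex, hJ]) (inr_mem_range_starIndex e hw c)]
  -- the two matrices differ by signs of rows and columns
  let s : Fin l ⊕ (Unit ⊕ (otherEdges e ⊕ InnerVertex v w)) → F :=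
    Sum.elim (fun i => G.outSign F v (e (r i))) (Sum.elim (fun _ => -1)
      (Sum.elim (fun _ => 1) fun _ => -1))
  let t : Fin l ⊕ (Unit ⊕ (otherEdges e ⊕ InnerVertex v w)) → F :=
    Sum.elim (fun i => G.outSign F v (e (c i))) fun _ => 1
  have hs : ∏ i, s i ≠ 0 := by
    refine Finset.prod_ne_zero_iff.2 fun i _ => ?_
    rcases i with i | i | i | i
    · exact G.outSign_ne_zero v _
    · exact neg_ne_zero.2 one_ne_zero
    · exact one_ne_zero
    · exact neg_ne_zero.2 one_ne_zero
  have ht : ∏ i, t i ≠ 0 := by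
    refine Finset.prod_ne_zero_iff.2 fun i _ => ?_
    rcases i with i | i
    · exact G.outSign_ne_zero v _
    · exact one_ne_zero
  have hout : ∀ d : otherEdges e, G.inc F d.1 v = 0 := fun d => by
    obtain ⟨h1, h2⟩ := h.ends.2 d.1 d.2
    simp [inc, h1, h2]
  have hd : ∀ (d : otherEdges e) i, d.1 ≠ e i := fun d => mem_otherEdges.1 d.2
  have hmat : starMatrix (Matrix.of fun i j => if r i = c j then
          (if e (r i) ∈ K then 0 else a (e (r i))) else 0)
        (vertexRows ((G.starRows F e v w).submatrix r id))
        (vertexRows ((G.starRows F e v w).submatrix c id))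
        (configMatrix (G.innerMatrix F e v w) fun d => a d.1)
      = Matrix.of fun i j => s i * (Matrix.of fun i j => t j *
        (G.fullMatrix K a).submatrix (starIndex e v w r) (starIndex e v w c) i j) i j := by
    ext (i | i | i | i) (j | j | j | j)
    · simp only [starMatrix, bordered, Matrix.fromBlocks_apply₁₁, Matrix.of_apply, s, t,
        Sum.elim_inl, Matrix.submatrix_apply, starIndex, fullMatrix, Matrix.diagonal_apply,
        e.injective.eq_iff]
      by_cases hij : r i = c j
      · rw [if_pos hij, ← hij, ← mul_assoc, outSign_mul_self, one_mul]
      · rw [if_neg hij, mul_zero, mul_zero]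
    · simpa [starMatrix, bordered, s, t, starIndex, fullMatrix]
        using (h.outSign_mul_inc F (r i)).symm
    · simp [starMatrix, bordered, s, t, starIndex, fullMatrix, vertexRows, vertexRow,
        Matrix.diagonal_apply_ne _ (hd j _).symm]
    · simp [starMatrix, bordered, s, t, starIndex, fullMatrix, vertexRows, vertexRow, starRows]
    · simpa [starMatrix, bordered, s, t, starIndex, fullMatrix]
        using (h.outSign_mul_inc F (c j)).symm
    · simp [starMatrix, bordered, s, t, starIndex, fullMatrix]
    · simp [starMatrix, bordered, s, t, starIndex, fullMatrix, hout]
    · simp [starMatrix, bordered, s, t, starIndex, fullMatrix]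
    · simp [starMatrix, bordered, s, t, starIndex, fullMatrix, vertexRows, vertexRow,
        Matrix.diagonal_apply_ne _ (hd i _)]
    · simp [starMatrix, bordered, s, t, starIndex, fullMatrix, hout]
    · by_cases hij : i = j
      · subst hij
        simp [starMatrix, bordered, s, t, starIndex, fullMatrix, configMatrix, hK i.1 i.2]
      · have hij' : i.1 ≠ j.1 := fun h => hij (Subtype.ext h)
        simp [starMatrix, bordered, s, t, starIndex, fullMatrix, configMatrix,
          Matrix.diagonal_apply_ne _ hij, Matrix.diagonal_apply_ne _ hij']
    · simp [starMatrix, bordered, s, t, starIndex, fullMatrix, configMatrix, innerMatrix]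
    · simp [starMatrix, bordered, s, t, starIndex, fullMatrix, vertexRows, vertexRow, starRows]
    · simp [starMatrix, bordered, s, t, starIndex, fullMatrix]
    · simp [starMatrix, bordered, s, t, starIndex, fullMatrix, configMatrix, innerMatrix]
    · simp [starMatrix, bordered, s, t, starIndex, fullMatrix, configMatrix]
  rw [hmat, Matrix.det_mul_column, Matrix.det_mul_row, mul_eq_zero, or_iff_right hs, mul_eq_zero,
    or_iff_right ht]

end FeynmanGraph

/-! ### The matrix-tree theorem and degrees -/

namespace FeynmanGraph

variable {n N : ℕ} (G : FeynmanGraph n N)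

/-- The rows `T` of the incidence matrix, the last vertex deleted. -/
def treeMatrix (R : Type*) [Ring R] (T : Finset (Fin N)) : Matrix T (Fin n) R :=
  Matrix.of fun d u => G.inc R d.1 u.castSucc

lemma treeMatrix_mulVec (R : Type*) [CommRing R] (T : Finset (Fin N)) (y : Fin n → R) (d : T) :
    (G.treeMatrix R T).mulVec y d
      = Fin.lastCases (motive := fun _ => R) 0 y (G.src d.1)
        - Fin.lastCases (motive := fun _ => R) 0 y (G.tgt d.1) := by
  have h : ∀ u : Fin (n + 1), ∑ i : Fin n, (if u = i.castSucc then 1 else 0) * y i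
      = Fin.lastCases (motive := fun _ => R) 0 y u := by
    intro u
    refine Fin.lastCases ?_ (fun j => ?_) u
    · simp [(Fin.castSucc_ne_last _).symm]
    · simp
  simp [Matrix.mulVec, dotProduct, treeMatrix, inc, sub_mul, Finset.sum_sub_distrib, ← h]

/-- For a connected set of edges the incidence matrix has trivial kernel. -/
lemma eq_zero_of_treeMatrix_mulVec {R : Type*} [CommRing R] {T : Finset (Fin N)}
    (hT : ∀ u u', G.JoinedIn T u u') {y : Fin n → R} (hy : (G.treeMatrix R T).mulVec y = 0) :
    y = 0 := by
  have h : ∀ u u', G.JoinedIn T u u' → Fin.lastCases (motive := fun _ => R) 0 y u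
      = Fin.lastCases (motive := fun _ => R) 0 y u' := by
    intro u u' huu'
    induction huu' with
    | rel a b hab =>
      obtain ⟨d, hd, rfl, rfl⟩ := hab
      have := congrFun hy ⟨d, hd⟩
      rw [treeMatrix_mulVec] at this
      exact sub_eq_zero.1 this
    | refl a => rfl
    | symm a b _ ih => exact ih.symm
    | trans a b c _ _ ih1 ih2 => exact ih1.trans ih2
  funext i
  have := h i.castSucc (Fin.last n) (hT _ _)
  simpa using this

/-- For a disconnected set of edges, the indicator of the vertices that are joined to some vertex,
but not to the last one, is in the kernel of the incidence matrix. -/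
lemma exists_treeMatrix_mulVec_eq_zero (R : Type*) [CommRing R] [Nontrivial R]
    {T : Finset (Fin N)} (hT : ¬ ∀ u u', G.JoinedIn T u u') :
    ∃ y : Fin n → R, y ≠ 0 ∧ (G.treeMatrix R T).mulVec y = 0 := by
  classical
  have hu : ∃ u, ¬ G.JoinedIn T u (Fin.last n) := by
    by_contra hcon
    push Not at hcon
    exact hT fun u u' => Relation.EqvGen.trans _ _ _ (hcon u)
      (Relation.EqvGen.symm _ _ (hcon u'))
  obtain ⟨u, hu⟩ := hu
  let y : Fin n → R := fun i => if G.JoinedIn T i.castSucc u then 1 else 0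
  have hy : ∀ u', Fin.lastCases (motive := fun _ => R) 0 y u'
      = if G.JoinedIn T u' u then 1 else 0 := by
    intro u'
    refine Fin.lastCases ?_ (fun j => ?_) u'
    · have h : ¬ G.JoinedIn T (Fin.last n) u := fun h => hu (Relation.EqvGen.symm _ _ h)
      rw [if_neg h]; simp
    · simp [y]
  refine ⟨y, ?_, ?_⟩
  · intro h0
    have hul : u ≠ Fin.last n := fun h => hu (h ▸ Relation.EqvGen.refl _)
    obtain ⟨j, rfl⟩ := Fin.exists_castSucc_eq.2 hul
    have := congrFun h0 j
    have hrefl : G.JoinedIn T j.castSucc j.castSucc := Relation.EqvGen.refl _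
    simp only [y, Pi.zero_apply, if_pos hrefl] at this
    exact one_ne_zero this
  · funext d
    rw [treeMatrix_mulVec, hy, hy]
    have hd : G.JoinedIn T (G.src d.1) (G.tgt d.1) :=
      Relation.EqvGen.rel _ _ ⟨d.1, d.2, rfl, rfl⟩
    have : G.JoinedIn T (G.src d.1) u ↔ G.JoinedIn T (G.tgt d.1) u :=
      ⟨fun h => Relation.EqvGen.trans _ _ _ (Relation.EqvGen.symm _ _ hd) h,
        fun h => Relation.EqvGen.trans _ _ _ hd h⟩
    simp only [this, sub_self]
    rfl

/-- The maximal minors of the incidence matrix are `±1` for spanning trees: they do not vanish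
modulo any prime. -/
lemma sq_det_treeMatrix (T : Finset (Fin N)) (e : Fin n ≃ T) :
    ((G.treeMatrix ℤ T).submatrix e id).det ^ 2 = ind (G.IsSpanningTree T) := by
  have hcard : T.card = n := by
    have := Fintype.card_congr e
    simpa using this.symm
  have hmul : ∀ {R : Type} [CommRing R] (y : Fin n → R),
      ((G.treeMatrix R T).submatrix e id).mulVec y = 0 ↔ (G.treeMatrix R T).mulVec y = 0 := by
    intro R _ y
    constructor
    · intro h
      funext d
      have := congrFun h (e.symm d)
      simpa [Matrix.mulVec, Matrix.submatrix, dotProduct] using this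
    · intro h
      funext i
      exact congrFun h (e i)
  by_cases hT : ∀ u u', G.JoinedIn T u u'
  · rw [ind_of ⟨hcard, hT⟩]
    have hprime : ∀ p : ℕ, p.Prime → ¬ p ∣ ((G.treeMatrix ℤ T).submatrix e id).det.natAbs := by
      intro p hp hdvd
      have : Fact p.Prime := ⟨hp⟩
      have h0 : (((G.treeMatrix ℤ T).submatrix e id).det : ZMod p) = 0 :=
        (ZMod.intCast_zmod_eq_zero_iff_dvd _ p).2 (Int.natCast_dvd.2 hdvd)
      have hmap : ((Int.castRingHom (ZMod p)).mapMatrix ((G.treeMatrix ℤ T).submatrix e id))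
          = (G.treeMatrix (ZMod p) T).submatrix e id := by
        ext i j
        simp only [RingHom.mapMatrix_apply, Matrix.map_apply, Matrix.submatrix_apply, treeMatrix,
          Matrix.of_apply, inc]
        split_ifs <;> simp
      have h1 : ((G.treeMatrix (ZMod p) T).submatrix e id).det = 0 := by
        rw [← hmap, ← RingHom.map_det]
        exact h0
      obtain ⟨y, hy, hMy⟩ := Matrix.exists_mulVec_eq_zero_iff.2 h1
      exact hy (G.eq_zero_of_treeMatrix_mulVec hT ((hmul y).1 hMy))
    have : ((G.treeMatrix ℤ T).submatrix e id).det.natAbs = 1 := by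
      by_contra hne
      obtain ⟨p, hp, hdvd⟩ := Nat.exists_prime_and_dvd hne
      exact hprime p hp hdvd
    rw [← Int.natAbs_pow_two, this]
    norm_num
  · rw [ind_of_not fun h => hT h.2]
    obtain ⟨y, hy, hMy⟩ := G.exists_treeMatrix_mulVec_eq_zero ℤ hT
    rw [Matrix.exists_mulVec_eq_zero_iff.1 ⟨y, hy, (hmul y).2 hMy⟩]
    norm_num

variable {F : Type*} [Field F]

lemma det_bordered_treeMatrix (T : Finset (Fin N)) :
    (bordered (0 : Matrix T T F) (G.treeMatrix F T) (-G.treeMatrix F T) 0).det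
      = (ind (G.IsSpanningTree T) : F) := by
  by_cases hcard : T.card = n
  · let e : Fin n ≃ T := Fintype.equivOfCardEq (by simpa using hcard.symm)
    set B : Matrix (Fin n) (Fin n) F := (G.treeMatrix F T).submatrix e id with hB
    have h1 : (bordered (0 : Matrix T T F) (G.treeMatrix F T) (-G.treeMatrix F T) 0).det
        = (Matrix.fromBlocks 0 B (-B.transpose) 0).det := by
      rw [← Matrix.det_submatrix_equiv_self (Equiv.sumCongr e (Equiv.refl (Fin n)))]
      congr 1
      ext (i | i) (j | j) <;> simp [bordered, hB]
    have h2 : Matrix.fromBlocks 0 B (-B.transpose) 0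
        = Matrix.fromBlocks B 0 0 B.transpose * Matrix.fromBlocks 0 1 (-1) 0 := by
      rw [Matrix.fromBlocks_multiply]
      simp
    have h3 : (Matrix.fromBlocks 0 1 (-1) 0 : Matrix (Fin n ⊕ Fin n) (Fin n ⊕ Fin n) F).det
        = 1 := by
      have : (Matrix.fromBlocks 0 1 (-1) 0 : Matrix (Fin n ⊕ Fin n) (Fin n ⊕ Fin n) F)
          = Matrix.fromBlocks 1 1 0 1 * (Matrix.fromBlocks 1 0 (-1) 1
            * Matrix.fromBlocks 1 1 0 1) := by
        rw [Matrix.fromBlocks_multiply, Matrix.fromBlocks_multiply]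
        simp
      rw [this, Matrix.det_mul, Matrix.det_mul]
      simp
    have h4 : (((G.treeMatrix ℤ T).submatrix e id).det : F) = B.det := by
      have hmap : ((Int.castRingHom F).mapMatrix ((G.treeMatrix ℤ T).submatrix e id)) = B := by
        ext i j
        simp only [RingHom.mapMatrix_apply, Matrix.map_apply, Matrix.submatrix_apply, treeMatrix,
          Matrix.of_apply, inc, hB]
        split_ifs <;> simp
      rw [← hmap, ← RingHom.map_det]
      rfl
    rw [h1, h2, Matrix.det_mul, h3, mul_one, Matrix.det_fromBlocks_zero₂₁, Matrix.det_transpose,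
      ← sq_det_treeMatrix G T e, Int.cast_pow, h4, sq]
  · rw [ind_of_not fun h => hcard h.1, Int.cast_zero]
    rcases lt_or_gt_of_ne hcard with hlt | hgt
    · have hker : LinearMap.ker (G.treeMatrix F T).mulVecLin ≠ ⊥ :=
        LinearMap.ker_ne_bot_of_finrank_lt (by simpa using hlt)
      obtain ⟨y, hy, hy0⟩ := (Submodule.ne_bot_iff _).1 hker
      refine Matrix.exists_mulVec_eq_zero_iff.1 ⟨Sum.elim 0 y, ?_, ?_⟩
      · intro h
        exact hy0 (funext fun i => congrFun h (Sum.inr i))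
      · have hy : (G.treeMatrix F T).mulVec y = 0 := hy
        rw [bordered, Matrix.fromBlocks_mulVec]
        funext i
        rcases i with i | i
        · simpa using congrFun hy i
        · simp
    · have hker : LinearMap.ker (G.treeMatrix F T).transpose.mulVecLin ≠ ⊥ :=
        LinearMap.ker_ne_bot_of_finrank_lt (by simpa using hgt)
      obtain ⟨x, hx, hx0⟩ := (Submodule.ne_bot_iff _).1 hker
      refine Matrix.exists_mulVec_eq_zero_iff.1 ⟨Sum.elim x 0, ?_, ?_⟩
      · intro h
        exact hx0 (funext fun i => congrFun h (Sum.inl i))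
      · have hx : (G.treeMatrix F T).transpose.mulVec x = 0 := hx
        rw [bordered, Matrix.fromBlocks_mulVec]
        funext i
        rcases i with i | i
        · simp
        · have := congrFun hx i
          simpa [Matrix.neg_mulVec] using this

/-- The matrix-tree theorem. -/
lemma aeval_graphPolynomial (a : Fin N → F) :
    aeval a G.graphPolynomial = aeval a (G.dodgson ∅ ∅ ∅) := by
  have h : (∅ᶜ : Finset (Fin N)).card = (∅ᶜ : Finset (Fin N)).card := rfl
  have hd : aeval a (G.dodgson ∅ ∅ ∅) = (bordered (Matrix.diagonal a)
      (Matrix.of fun d (u : Fin n) => G.inc F d u.castSucc)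
      (-Matrix.of fun d (u : Fin n) => G.inc F d u.castSucc) 0).det := by
    let e : Fin (∅ᶜ : Finset (Fin N)).card ≃ Fin N :=
      Equiv.ofBijective ((∅ᶜ : Finset (Fin N)).orderEmbOfFin rfl)
        ⟨(Finset.orderEmbOfFin _ _).injective, fun d => by
          have : d ∈ Set.range ((∅ᶜ : Finset (Fin N)).orderEmbOfFin rfl) := by
            rw [Finset.range_orderEmbOfFin]; simp
          exact this⟩
    rw [dodgson, dif_pos h, AlgHom.map_det, AlgHom.mapMatrix_apply, ← Matrix.submatrix_map,
      aeval_graphMatrix, Matrix.submatrix_submatrix,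
      ← Matrix.det_submatrix_equiv_self (Equiv.sumCongr e (Equiv.refl (Fin n)))]
    congr 1
    ext (i | i) (j | j)
    · simp [fullMatrix, bordered, e, Matrix.diagonal_apply]
    · simp [fullMatrix, bordered, e]
    · simp [fullMatrix, bordered, e]
    · simp [fullMatrix, bordered, e]
  rw [hd, det_bordered_diagonal, graphPolynomial, map_sum, Finset.sum_filter]
  refine Finset.sum_congr rfl fun T _ => ?_
  have h2 := G.det_bordered_treeMatrix (F := F) T
  have h3 : (bordered (0 : Matrix T T F)
      ((Matrix.of fun d (u : Fin n) => G.inc F d u.castSucc).submatrix (fun i : T => i.1) id)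
      ((-Matrix.of fun d (u : Fin n) => G.inc F d u.castSucc).submatrix (fun i : T => i.1) id)
      0).det = (ind (G.IsSpanningTree T) : F) := h2
  rw [h3]
  by_cases hT : G.IsSpanningTree T
  · rw [if_pos hT, ind_of hT, map_prod]
    simp
  · rw [if_neg hT, ind_of_not hT]
    simp

/-- In every term of the determinant the `n` vertex columns meet edge rows, in constants. -/
lemma totalDegree_dodgson_le (I J K : Finset (Fin N)) :
    (G.dodgson I J K).totalDegree ≤ N - n - I.card := by
  classical
  rw [dodgson]
  split_ifs with h
  swap
  · simp
  have hm : Iᶜ.card - n = N - n - I.card := by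
    rw [Finset.card_compl, Fintype.card_fin]; omega
  rw [← hm, Matrix.det_apply]
  refine totalDegree_finsetSum_le fun σ _ => ?_
  set M := (G.graphMatrix K).submatrix
      (Sum.map (Iᶜ.orderEmbOfFin rfl) id : Fin Iᶜ.card ⊕ Fin n → Fin N ⊕ Fin n)
      (Sum.map (Jᶜ.orderEmbOfFin h) id : Fin Iᶜ.card ⊕ Fin n → Fin N ⊕ Fin n) with hM
  refine (totalDegree_smul_le _ _).trans ?_
  by_cases h0 : ∏ i, M (σ i) i = 0
  · rw [h0]; simp
  have hne : ∀ i, M (σ i) i ≠ 0 := fun i => Finset.prod_ne_zero_iff.1 h0 i (Finset.mem_univ i)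
  have hright : ∀ j : Fin n, (σ (Sum.inr j)).isLeft = true := by
    intro j
    rcases hj : σ (Sum.inr j) with i | i
    · rfl
    · exact absurd (by rw [hj]; simp [hM, graphMatrix]) (hne (Sum.inr j))
  have hdeg : ∀ i, (M (σ i) i).totalDegree
      ≤ if i.isLeft = true ∧ (σ i).isLeft = true then 1 else 0 := by
    have hinc : ∀ d u, (G.incidence d u).totalDegree = 0 := by
      intro d u
      simp only [incidence, Matrix.of_apply]
      split_ifs <;> simp
    intro i
    rcases i with i | i <;> rcases hi : σ _ with j | j
    · simp only [hM, graphMatrix, Matrix.submatrix_apply, Sum.map_inl, Matrix.fromBlocks_apply₁₁,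
        Matrix.diagonal_apply, Sum.isLeft_inl, and_self, if_true]
      split_ifs <;> simp
    · simp [hM, graphMatrix, hinc]
    · simp [hM, graphMatrix, hinc]
    · simp [hM, graphMatrix]
  refine (totalDegree_finsetProd _ _).trans ((Finset.sum_le_sum fun i _ => hdeg i).trans ?_)
  -- the rows met by the vertex columns are edge rows
  have hcount : ∑ i, (if (σ i).isLeft = true then 1 else 0) = Iᶜ.card := by
    rw [Equiv.sum_comp σ fun i => if i.isLeft = true then 1 else 0, Fintype.sum_sum_type]
    simp
  rw [Fintype.sum_sum_type] at hcount ⊢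
  simp only [hright, if_true, Finset.sum_const, Finset.card_univ, Fintype.card_fin, smul_eq_mul,
    mul_one] at hcount
  simp only [Sum.isLeft_inl, Sum.isLeft_inr, true_and, Bool.false_eq_true, false_and, if_false,
    Finset.sum_const_zero, add_zero]
  omega

end FeynmanGraph

/-! ### Point counts -/

namespace FeynmanGraph

variable {n N : ℕ} {G : FeynmanGraph n N} {F : Type} [Field F] {v w : Fin (n + 1)}

namespace IsVertexWithEdges

/-- Two edges at `v` left in the rows and in the columns. -/
lemma aeval_dodgson_two {k : ℕ} {e : Fin k ↪ Fin N} (h : G.IsVertexWithEdges v e) (hw : w ≠ v)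
    (r c : Fin 2 → Fin k) (hr : r 0 ≠ r 1) (hc : c 0 ≠ c 1) {I J K : Finset (Fin N)}
    (hI : I = (Finset.univ.image r)ᶜ.map e) (hJ : J = (Finset.univ.image c)ᶜ.map e)
    (hK : ∀ d ∈ otherEdges e, d ∉ K) (hrc : ∀ i j, r i = c j → e (r i) ∈ K) (a : Fin N → F) :
    aeval a (G.dodgson I J K) = 0 ↔
      borderedForm (configMatrix (G.innerMatrix F e v w) fun d => a d.1)
        (vertexRow (G.starRows F e v w (r 1) - G.starRows F e v w (r 0)))
        (vertexRow (G.starRows F e v w (c 1) - G.starRows F e v w (c 0))) = 0 := by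
  have hinj : ∀ {s : Fin 2 → Fin k}, s 0 ≠ s 1 → Function.Injective s := by
    intro s hs i j hij
    fin_cases i <;> fin_cases j <;> simp_all [eq_comm]
  have hA : (Matrix.of fun i j => if r i = c j then
      (if e (r i) ∈ K then 0 else a (e (r i))) else 0 : Matrix (Fin 2) (Fin 2) F) = 0 := by
    ext i j
    rw [Matrix.of_apply]
    split_ifs with h1 h2
    · rfl
    · exact absurd (hrc i j h1) h2
    · rfl
  rw [h.aeval_dodgson_eq_zero_iff hw (hinj hr) (hinj hc) hI hJ hK, hA, det_starMatrix_two,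
    neg_eq_zero, vertexRows_sub, vertexRows_sub]
  rfl

/-- One edge at `v` left in the rows and in the columns. -/
lemma aeval_dodgson_one {k : ℕ} {e : Fin k ↪ Fin N} (h : G.IsVertexWithEdges v e) (hw : w ≠ v)
    (r c : Fin 1 → Fin k) {I J K : Finset (Fin N)}
    (hI : I = (Finset.univ.image r)ᶜ.map e) (hJ : J = (Finset.univ.image c)ᶜ.map e)
    (hK : ∀ d ∈ otherEdges e, d ∉ K) (a : Fin N → F) :
    aeval a (G.dodgson I J K) = 0 ↔
      (configMatrix (G.innerMatrix F e v w) fun d => a d.1).det = 0 := by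
  rw [h.aeval_dodgson_eq_zero_iff hw (Function.injective_of_subsingleton r)
    (Function.injective_of_subsingleton c) hI hJ hK, det_starMatrix_one, neg_eq_zero]

/-- The points of the graph hypersurface, fibred over the variables of the edges that do not
meet `v`. -/
lemma pointCount_eq [Fintype F] {k : ℕ} {e : Fin k ↪ Fin N} (h : G.IsVertexWithEdges v e)
    (hw : w ≠ v) : (G.pointCount F : ℤ) = ∑ b : otherEdges e → F,
      starCount (vertexRows (G.starRows F e v w)) (configMatrix (G.innerMatrix F e v w) b) := by
  have hd : ∀ (d : otherEdges e) i, d.1 ≠ e i := fun d => mem_otherEdges.1 d.2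
  let g : otherEdges e ⊕ Fin k ≃ Fin N := Equiv.ofBijective (Sum.elim (fun d => d.1) e) <| by
    constructor
    · rintro (i | i) (j | j) hij
      · exact congrArg _ (Subtype.ext hij)
      · exact absurd hij (hd i j)
      · exact absurd hij.symm (hd j i)
      · exact congrArg _ (e.injective hij)
    · intro d
      by_cases hd' : d ∈ otherEdges e
      · exact ⟨Sum.inl ⟨d, hd'⟩, rfl⟩
      · rw [mem_otherEdges] at hd'
        push Not at hd'
        obtain ⟨i, rfl⟩ := hd'
        exact ⟨Sum.inr i, rfl⟩
  have h1 : (G.pointCount F : ℤ) = count fun a : Fin N → F => aeval a (G.dodgson ∅ ∅ ∅) = 0 := by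
    rw [← count_congr fun a => iff_of_eq (congrArg (· = 0) (G.aeval_graphPolynomial a))]
    rfl
  have h2 : (Finset.univ.image (id : Fin k → Fin k))ᶜ.map e = ∅ := by
    rw [Finset.image_id, Finset.compl_univ, Finset.map_empty]
  have h3 := fun a : Fin N → F => h.aeval_dodgson_eq_zero_iff hw Function.injective_id
    Function.injective_id h2.symm h2.symm (K := ∅) (fun d _ => Finset.notMem_empty d) a
  rw [h1, count_congr h3, count_equiv ((Equiv.arrowCongr g.symm (Equiv.refl F)).trans
    (Equiv.sumArrowEquivProdArrow _ _ _)) (Q := fun p => (starMatrix (Matrix.diagonal p.2)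
      (vertexRows (G.starRows F e v w)) (vertexRows (G.starRows F e v w))
      (configMatrix (G.innerMatrix F e v w) p.1)).det = 0), count_prod]
  · rfl
  · intro a
    refine iff_of_eq (congrArg (fun A => (starMatrix A _ _ _).det = 0) ?_)
    ext i j
    simp only [Finset.notMem_empty, if_false, id, Matrix.of_apply, Matrix.diagonal_apply]
    rfl

end IsVertexWithEdges

/-- Points over the coordinate subspace of the edges that do not meet `v`. -/
lemma count_supportedOn_otherEdges [Finite F] {k : ℕ} {e : Fin k ↪ Fin N}
    {P : (Fin N → F) → Prop} {Q : (otherEdges e → F) → Prop}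
    (h : ∀ a, P a ↔ Q fun d => a d.1) :
    count (fun a => SupportedOn (otherEdges e) a ∧ P a) = count Q := by
  rw [count_supportedOn]
  refine count_congr fun b => (h _).trans (iff_of_eq (congrArg Q (funext fun d => ?_)))
  simp [extendZero]

lemma exists_ne_vertex (hn : 1 ≤ n) (v : Fin (n + 1)) : ∃ w, w ≠ v := by
  have : Nontrivial (Fin (n + 1)) := Fin.nontrivial_iff_two_le.2 (by omega)
  exact exists_ne v

lemma card_otherEdges {k : ℕ} (e : Fin k ↪ Fin N) : (otherEdges e).card = N - k := by
  rw [otherEdges, Finset.card_compl, Finset.card_map, Finset.card_univ, Fintype.card_fin,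
    Fintype.card_fin]

/-- At a 3-valent vertex the pair `(Ψ^{1,2}_3, Ψ^{13,23})` determines the point count modulo
`q³`. -/
lemma card_cube_dvd_pointCount_three [Fintype F] (hn : 3 ≤ n) {e : Fin 3 ↪ Fin N}
    (h : G.IsVertexWithEdges v e) (hne : (otherEdges e).Nonempty) :
    (Nat.card F : ℤ) ^ 3 ∣ G.pointCount F
      - Nat.card F ^ 2 * pointsOver F (otherEdges e) (G.pair3 e) := by
  obtain ⟨w, hw⟩ := exists_ne_vertex (by omega : 1 ≤ n) v
  have : Nonempty (otherEdges e) := hne.to_subtype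
  have hν : 2 ≤ Fintype.card (InnerVertex v w) := by rw [card_innerVertex hw]; omega
  have hmap : ∀ s : Finset (Fin 3), ∀ i ∈ s, e i ∈ s.map e := fun s i hi =>
    Finset.mem_map_of_mem e hi
  have h2 : ∀ a : Fin N → F, aeval a (G.dodgson {e 0} {e 1} {e 2}) = 0 ↔ _ := fun a =>
    h.aeval_dodgson_two hw ![2, 1] ![2, 0] (by decide) (by decide)
      (by rw [show (Finset.univ.image ![2, 1] : Finset (Fin 3))ᶜ = {0} by decide]; simp)
      (by rw [show (Finset.univ.image ![2, 0] : Finset (Fin 3))ᶜ = {1} by decide]; simp)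
      (fun d hd => by simpa using mem_otherEdges.1 hd 2)
      (fun i j hij => by
        have : (![2, 1] : Fin 2 → Fin 3) i = 2 := by revert i j; decide
        rw [this]; simp) a
  have h1 : ∀ a : Fin N → F, aeval a (G.dodgson {e 0, e 2} {e 1, e 2} ∅) = 0 ↔ _ := fun a =>
    h.aeval_dodgson_one hw ![1] ![0]
      (by rw [show (Finset.univ.image ![1] : Finset (Fin 3))ᶜ = {0, 2} by decide]; simp)
      (by rw [show (Finset.univ.image ![0] : Finset (Fin 3))ᶜ = {1, 2} by decide]; simp)
      (fun d _ => Finset.notMem_empty d) a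
  let M := fun b : otherEdges e → F => configMatrix (G.innerMatrix F e v w) b
  let R := G.starRows F e v w
  have hp : pointsOver F (otherEdges e) (G.pair3 e) = count fun b => (M b).det = 0 ∧
      borderedForm (M b) (vertexRow (R 1 - R 2))
      (vertexRow (R 0 - R 2)) = 0 :=
    count_supportedOn_otherEdges (Q := fun b => (M b).det = 0 ∧
      borderedForm (M b) (vertexRow (R 1 - R 2)) (vertexRow (R 0 - R 2)) = 0)
      fun a => (and_congr (h2 a) (h1 a)).trans and_comm
  rw [hp, h.pointCount_eq hw]
  exact card_cube_dvd_sum_starCount_three hν _ _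

/-- At a 4-valent vertex the five pairs determine the point count modulo `q³`. The contributions of
the single Dodgson polynomials `Ψ^{13,24}`, `Ψ^{14,23}`, `Ψ^{12,34}` vanish by Ax's theorem. -/
lemma card_cube_dvd_pointCount_four [Fintype F] (hn : 3 ≤ n) {e : Fin 4 ↪ Fin N}
    (h : G.IsVertexWithEdges v e) (hne : (otherEdges e).Nonempty) :
    (Nat.card F : ℤ) ^ 3 ∣ G.pointCount F + Nat.card F ^ 2 *
      (pointsOver F (otherEdges e) (G.pair4 e)
        + ∑ i, pointsOver F (otherEdges e) (G.pair4Del e i)) := by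
  obtain ⟨w, hw⟩ := exists_ne_vertex (by omega : 1 ≤ n) v
  have : Nonempty (otherEdges e) := hne.to_subtype
  have hν : 2 ≤ Fintype.card (InnerVertex v w) := by rw [card_innerVertex hw]; omega
  have hempty : ∀ d ∈ otherEdges e, d ∉ (∅ : Finset (Fin N)) := fun d _ => Finset.notMem_empty d
  have hA : ∀ a : Fin N → F, aeval a (G.dodgson {e 0, e 2} {e 1, e 3} ∅) = 0 ↔ _ := fun a =>
    h.aeval_dodgson_two hw ![3, 1] ![2, 0] (by decide) (by decide)
      (by rw [show (Finset.univ.image ![3, 1] : Finset (Fin 4))ᶜ = {0, 2} by decide]; simp)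
      (by rw [show (Finset.univ.image ![2, 0] : Finset (Fin 4))ᶜ = {1, 3} by decide]; simp)
      hempty (fun i j hij => absurd hij (by revert i j; decide)) a
  have hB : ∀ a : Fin N → F, aeval a (G.dodgson {e 0, e 3} {e 1, e 2} ∅) = 0 ↔ _ := fun a =>
    h.aeval_dodgson_two hw ![2, 1] ![3, 0] (by decide) (by decide)
      (by rw [show (Finset.univ.image ![2, 1] : Finset (Fin 4))ᶜ = {0, 3} by decide]; simp)
      (by rw [show (Finset.univ.image ![3, 0] : Finset (Fin 4))ᶜ = {1, 2} by decide]; simp)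
      hempty (fun i j hij => absurd hij (by revert i j; decide)) a
  have hC : ∀ a : Fin N → F, aeval a (G.dodgson {e 0, e 1} {e 2, e 3} ∅) = 0 ↔ _ := fun a =>
    h.aeval_dodgson_two hw ![3, 2] ![1, 0] (by decide) (by decide)
      (by rw [show (Finset.univ.image ![3, 2] : Finset (Fin 4))ᶜ = {0, 1} by decide]; simp)
      (by rw [show (Finset.univ.image ![1, 0] : Finset (Fin 4))ᶜ = {2, 3} by decide]; simp)
      hempty (fun i j hij => absurd hij (by revert i j; decide)) a
  have hD : ∀ (i : Fin 4) (a : Fin N → F),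
      aeval a (G.dodgson {e i, e (i + 3)} {e (i + 1), e (i + 3)} {e (i + 2)}) = 0 ↔ _ := fun i a =>
    h.aeval_dodgson_two hw ![i + 2, i + 1] ![i + 2, i] (by revert i; decide) (by revert i; decide)
      (by
        rw [show (Finset.univ.image ![i + 2, i + 1] : Finset (Fin 4))ᶜ = {i, i + 3} by
          revert i; decide]
        simp)
      (by
        rw [show (Finset.univ.image ![i + 2, i] : Finset (Fin 4))ᶜ = {i + 1, i + 3} by
          revert i; decide]
        simp)
      (fun d hd => by simpa using mem_otherEdges.1 hd (i + 2))
      (fun j l hjl => by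
        have : (![i + 2, i + 1] : Fin 2 → Fin 4) j = i + 2 := by revert i j l; decide
        rw [this]; simp) a
  have hf : ∀ (i : Fin 4) (a : Fin N → F), aeval a (G.dodgson {e i, e (i + 2), e (i + 3)}
      {e (i + 1), e (i + 2), e (i + 3)} ∅) = 0 ↔ _ := fun i a =>
    h.aeval_dodgson_one hw ![i + 1] ![i]
      (by
        rw [show (Finset.univ.image ![i + 1] : Finset (Fin 4))ᶜ = {i, i + 2, i + 3} by
          revert i; decide]
        simp)
      (by
        rw [show (Finset.univ.image ![i] : Finset (Fin 4))ᶜ = {i + 1, i + 2, i + 3} by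
          revert i; decide]
        simp)
      hempty a
  let M := fun b : otherEdges e → F => configMatrix (G.innerMatrix F e v w) b
  let R := G.starRows F e v w
  have hp : pointsOver F (otherEdges e) (G.pair4 e) = count fun b =>
      borderedForm (M b) (vertexRow (R 1 - R 3))
      (vertexRow (R 0 - R 2)) = 0 ∧
      borderedForm (M b) (vertexRow (R 1 - R 2))
      (vertexRow (R 0 - R 3)) = 0 :=
    count_supportedOn_otherEdges (Q := fun b => borderedForm (M b) (vertexRow (R 1 - R 3))
      (vertexRow (R 0 - R 2)) = 0 ∧
      borderedForm (M b) (vertexRow (R 1 - R 2))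
      (vertexRow (R 0 - R 3)) = 0) fun a => and_congr (hA a) (hB a)
  have hp' : ∀ i, pointsOver F (otherEdges e) (G.pair4Del e i) = count fun b => (M b).det = 0 ∧
      borderedForm (M b) (vertexRow (R (i + 1) - R (i + 2)))
      (vertexRow (R i - R (i + 2))) = 0 := fun i =>
    count_supportedOn_otherEdges (Q := fun b => (M b).det = 0 ∧
      borderedForm (M b) (vertexRow (R (i + 1) - R (i + 2)))
      (vertexRow (R i - R (i + 2))) = 0)
      fun a => (and_congr (hD i a) (hf i a)).trans and_comm
  have hdeg : ∀ i j k l : Fin 4, i ≠ j → (G.dodgson {e i, e j} {e k, e l} ∅).totalDegree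
      < (otherEdges e).card := by
    intro i j k l hij
    refine (G.totalDegree_dodgson_le _ _ _).trans_lt ?_
    have hpos := hne.card_pos
    rw [Finset.card_pair fun hh => hij (e.injective hh)]
    rw [card_otherEdges] at hpos ⊢
    omega
  rw [hp, Finset.sum_congr rfl fun i _ => hp' i, h.pointCount_eq hw]
  refine card_cube_dvd_sum_starCount_four hν _ _ ?_ ?_ ?_
  · have := card_dvd_count_zeros_supportedOn (F := F) (hdeg 0 2 1 3 (by decide))
    rw [count_supportedOn_otherEdges
      (Q := fun b => borderedForm (M b) (vertexRow (R 1 - R 3))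
      (vertexRow (R 0 - R 2)) = 0) hA] at this
    exact this
  · have := card_dvd_count_zeros_supportedOn (F := F) (hdeg 0 3 1 2 (by decide))
    rw [count_supportedOn_otherEdges
      (Q := fun b => borderedForm (M b) (vertexRow (R 1 - R 2))
      (vertexRow (R 0 - R 3)) = 0) hB] at this
    exact this
  · have := card_dvd_count_zeros_supportedOn (F := F) (hdeg 0 1 2 3 (by decide))
    rw [count_supportedOn_otherEdges
      (Q := fun b => borderedForm (M b) (vertexRow (R 2 - R 3))
      (vertexRow (R 0 - R 1)) = 0) hC] at this
    exact this

end FeynmanGraph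

/-! ### The `c₂` invariant from a reduction -/

namespace FeynmanGraph

variable {n N : ℕ} {G : FeynmanGraph n N} {F : Type} [Field F]

/-- Point counts modulo `q³` determine `c₂`. -/
lemma c2_eq_of_dvd_sub [Finite F] {P : ℤ}
    (h : (Nat.card F : ℤ) ^ 3 ∣ G.pointCount F - Nat.card F ^ 2 * P) :
    Nat.card F ^ 2 ∣ G.pointCount F ∧ G.c2 F = (P : ZMod (Nat.card F)) := by
  obtain ⟨d, hd⟩ := h
  have hq : 0 < Nat.card F ^ 2 := pow_pos Nat.card_pos 2
  have hdvd : Nat.card F ^ 2 ∣ G.pointCount F := by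
    rw [← Int.natCast_dvd_natCast]
    push_cast
    exact ⟨Nat.card F * d + P, by linear_combination hd⟩
  refine ⟨hdvd, ?_⟩
  obtain ⟨m, hm⟩ := hdvd
  rw [c2, hm, Nat.mul_div_cancel_left _ hq, ← Int.cast_natCast, ZMod.intCast_eq_intCast_iff_dvd_sub]
  refine ⟨-d, mul_left_cancel₀ (Int.natCast_ne_zero.2 hq.ne') ?_⟩
  rw [hm] at hd
  push_cast at hd ⊢
  linear_combination -hd

lemma Reduction.c2_eq (hn : 3 ≤ n) [Finite F] (R : G.Reduction) (hF : ringChar F ∉ R.badPrimes) :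
    Nat.card F ^ 2 ∣ G.pointCount F ∧ G.c2 F = -(R.value : ZMod (Nat.card F)) := by
  have := Fintype.ofFinite F
  cases R with
  | three v e hv T =>
    obtain ⟨h1, h2⟩ := c2_eq_of_dvd_sub (card_cube_dvd_pointCount_three (F := F) hn hv T.nonempty)
    refine ⟨h1, ?_⟩
    rw [h2, ← Int.cast_neg, ZMod.intCast_eq_intCast_iff_dvd_sub, ← dvd_neg]
    refine (T.card_dvd_pointsOver_sub_value hF).trans (dvd_of_eq ?_)
    simp only [Reduction.value]
    ring
  | four v e hv T T' =>
    have hT : ringChar F ∉ T.badPrimes := fun h => hF (Finset.mem_union_left _ h)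
    have hT' : ∀ i, ringChar F ∉ (T' i).badPrimes := fun i h =>
      hF (Finset.mem_union_right _ (Finset.mem_biUnion.2 ⟨i, Finset.mem_univ i, h⟩))
    have h := card_cube_dvd_pointCount_four (F := F) hn hv T.nonempty
    rw [← sub_neg_eq_add, ← mul_neg] at h
    obtain ⟨h1, h2⟩ := c2_eq_of_dvd_sub h
    refine ⟨h1, ?_⟩
    rw [h2, ← Int.cast_neg, ZMod.intCast_eq_intCast_iff_dvd_sub]
    have h3 := dvd_add (T.card_dvd_pointsOver_sub_value hT)
      (Finset.dvd_sum fun i (_ : i ∈ Finset.univ) =>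
        (T' i).card_dvd_pointsOver_sub_value (hT' i))
    refine h3.trans (dvd_of_eq ?_)
    simp only [Reduction.value, Finset.sum_sub_distrib]
    ring

/-- All reductions have the same value: it is determined by `c₂` at a large prime. -/
lemma Reduction.value_eq_value (hn : 3 ≤ n) (R R' : G.Reduction) : R.value = R'.value := by
  obtain ⟨p, hp, hprime⟩ := Nat.exists_infinite_primes
    (R.badPrimes.sup id + R'.badPrimes.sup id + (R'.value - R.value).natAbs + 1)
  have := Fact.mk hprime
  have hbad : ∀ S : G.Reduction, S.badPrimes.sup id < p → ringChar (ZMod p) ∉ S.badPrimes := by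
    intro S hS hmem
    rw [ZMod.ringChar_zmod_n] at hmem
    exact (Finset.le_sup (f := id) hmem).not_gt hS
  have h1 := (R.c2_eq hn (hbad R (by omega))).2
  rw [(R'.c2_eq hn (hbad R' (by omega))).2, neg_inj, ZMod.intCast_eq_intCast_iff_dvd_sub,
    Nat.card_zmod] at h1
  have h2 := Int.eq_zero_of_dvd_of_natAbs_lt_natAbs h1 (by rw [Int.natAbs_natCast]; omega)
  omega

lemma _root_.SemilinearTree.abs_value_le {σ : Type} [Fintype σ] [DecidableEq σ]
    {s : Finset σ} {f g : MvPolynomial σ ℤ} (T : SemilinearTree s (.pair f g)) {k l : ℕ}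
    (hf : f.totalDegree ≤ k) (hg : g.totalDegree ≤ l) : |T.value| ≤ 2 ^ (k + l) - 1 :=
  Int.le_sub_one_of_lt <| T.abs_value_lt.trans_le <|
    pow_le_pow_right₀ one_le_two (add_le_add hf hg)

/-- The values of the pairs at a vertex are bounded through the degrees of the Dodgson
polynomials. -/
lemma Reduction.two_mul_abs_value_lt (R : G.Reduction) : 2 * |R.value| < 4 ^ (N - n) := by
  have hdeg : ∀ {I J K : Finset (Fin N)} {m : ℕ}, m ≤ I.card →
      (G.dodgson I J K).totalDegree ≤ N - n - m := fun h =>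
    (G.totalDegree_dodgson_le _ _ _).trans (Nat.sub_le_sub_left h _)
  have hcard : ∀ {k : ℕ} (e : Fin k ↪ Fin N) {i j : Fin k}, i ≠ j →
      2 ≤ ({e i, e j} : Finset (Fin N)).card := fun e _ _ hij =>
    (Finset.card_pair fun h => hij (e.injective h)).ge
  cases R with
  | three v e hv T =>
    have h1 : |T.value| ≤ 2 ^ (N - n - 1 + (N - n - 2)) - 1 :=
      T.abs_value_le (hdeg (Finset.card_singleton _).ge)
        (hdeg (hcard e (by decide : (0 : Fin 3) ≠ 2)))
    simp only [Reduction.value, abs_neg]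
    rcases Nat.lt_or_ge (N - n) 2 with hh | hh
    · have h2 : N - n - 1 + (N - n - 2) = 0 := by omega
      rw [h2] at h1
      have h3 : (0 : ℤ) < 4 ^ (N - n) := by positivity
      linarith
    · obtain ⟨m, hm⟩ := Nat.exists_eq_add_of_le hh
      have h2 : N - n - 1 + (N - n - 2) = 2 * m + 1 := by omega
      rw [h2, pow_succ, pow_mul] at h1
      rw [hm, pow_add]
      have h3 : (0 : ℤ) < 4 ^ m := by positivity
      norm_num at h1 ⊢
      linarith
  | four v e hv T T' =>
    have h1 : |T.value| ≤ 2 ^ (N - n - 2 + (N - n - 2)) - 1 :=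
      T.abs_value_le (hdeg (hcard e (by decide : (0 : Fin 4) ≠ 2)))
      (hdeg (hcard e (by decide : (0 : Fin 4) ≠ 3)))
    have h2 : ∀ i, |(T' i).value| ≤ 2 ^ (N - n - 2 + (N - n - 3)) - 1 := fun i => by
      refine (T' i).abs_value_le (hdeg (hcard e (by revert i; decide : i ≠ i + 3))) (hdeg ?_)
      have : ({e i, e (i + 2), e (i + 3)} : Finset (Fin N))
          = ({i, i + 2, i + 3} : Finset (Fin 4)).map e := by simp
      rw [this, Finset.card_map]
      clear this
      revert i
      decide
    have h3 : |T.value + ∑ i, (T' i).value| ≤ (2 ^ (N - n - 2 + (N - n - 2)) - 1)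
        + ∑ _i : Fin 4, (2 ^ (N - n - 2 + (N - n - 3)) - 1) :=
      (abs_add_le _ _).trans (add_le_add h1
        ((Finset.abs_sum_le_sum_abs _ _).trans (Finset.sum_le_sum fun i _ => h2 i)))
    simp only [Finset.sum_const, Finset.card_univ, Fintype.card_fin] at h3
    simp only [Reduction.value]
    rcases Nat.lt_or_ge (N - n) 3 with hh | hh
    · have h4 : N - n - 2 + (N - n - 2) = 0 := by omega
      have h5 : N - n - 2 + (N - n - 3) = 0 := by omega
      rw [h4, h5] at h3
      norm_num at h3 ⊢
      rw [h3]
      simp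
    · obtain ⟨m, hm⟩ := Nat.exists_eq_add_of_le hh
      have h4 : N - n - 2 + (N - n - 2) = 2 * m + 2 := by omega
      have h5 : N - n - 2 + (N - n - 3) = 2 * m + 1 := by omega
      rw [h4, h5, pow_succ, pow_add, pow_mul] at h3
      rw [hm, pow_add]
      have h6 : (0 : ℤ) < 4 ^ m := by positivity
      norm_num at h3 ⊢
      linarith

lemma Reduction.abs_value_lt (R : G.Reduction) :
    |(R.value : ℚ)| < 1 / 2 * (4 : ℚ) ^ G.loopNumber := by
  have h := R.two_mul_abs_value_lt
  rcases le_total n N with hnN | hnN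
  · have h1 : G.loopNumber = ((N - n : ℕ) : ℤ) := by
      rw [loopNumber]
      omega
    have h2 : (2 : ℚ) * |(R.value : ℚ)| < 4 ^ (N - n) := by exact_mod_cast h
    rw [h1, zpow_natCast]
    linarith
  · -- The loop number is at most `0` here, and the value vanishes.
    rw [Nat.sub_eq_zero_of_le hnN, pow_zero] at h
    have h1 : R.value = 0 := abs_eq_zero.1 (by have := abs_nonneg R.value; omega)
    rw [h1, Int.cast_zero, abs_zero]
    positivity

lemma SemilinearlyReducible.nonempty_reduction (hG : G.SemilinearlyReducible) :
    Nonempty G.Reduction := by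
  rcases hG with ⟨v, e, hv, -, -, ⟨T⟩⟩ | ⟨v, e, hv, ⟨-, -, ⟨T⟩⟩, hT'⟩
  · exact ⟨.three v e hv T⟩
  · exact ⟨.four v e hv T fun i => (hT' i).2.2.some⟩

end FeynmanGraph

theorem mainTheorem4 {n N : ℕ} (G : FeynmanGraph n N) (hV : 4 ≤ n + 1)
    (hval : ∃ v : Fin (n + 1), G.valency v ≤ 4) (hG : G.SemilinearlyReducible) :
    Nonempty G.Reduction ∧
    ∃ c : ℤ, |(c : ℚ)| < 1 / 2 * (4 : ℚ) ^ G.loopNumber ∧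
      ∀ R : G.Reduction, R.value = c ∧
        ∀ (F : Type) [Field F] [Finite F], ringChar F ∉ R.badPrimes →
          Nat.card F ^ 2 ∣ G.pointCount F ∧ G.c2 F = -(c : ZMod (Nat.card F)) := by
  have hn : 3 ≤ n := by omega
  obtain ⟨R₀⟩ := hG.nonempty_reduction
  refine ⟨⟨R₀⟩, R₀.value, R₀.abs_value_lt, fun R => ?_⟩
  have hR : R.value = R₀.value := R.value_eq_value hn R₀
  refine ⟨hR, fun F _ _ hF => ?_⟩
  rw [← hR]
  exact R.c2_eq hn hF
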